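/- Let $\Gamma\subset\mathrm{SL}_2(\mathbf R)$ be a discrete subgroup of finite covolume acting on the upper half-plane $\mathbf H$, let $\mathfrak a$ run over representatives of its $r$ inequivalent cusps, with stabilizers $\Gamma_{\mathfrak a}$ and scaling matrices $\sigma_{\mathfrak a}\in \mathrm{SL}_2(\mathbf R)$ ($\sigma_{\mathfrak a}\infty=\mathfrak a$, and $\sigma_{\mathfrak a}^{-1}\Gamma_{\mathfrak a}\sigma_{\mathfrak a}$ equals, modulo $\pm1$, the group of translations $z\mapsto z+k$, $k\in\mathbf Z$). Let $f,g$ be holomorphic cusp forms of weight $2$ for $\Gamma$, put $\langle\gamma,f\rangle=\int_{z_0}^{\gamma z_0}f(w)\,dw$ with $z_0\in\mathbf H$ (similarly for $g$), and let $\chi:\Gamma\to\{|u|=1\}$ be a character with $\chi=1$ on every $\Gamma_{\mathfrak a}$. For integers $m,n\ge 0$ and $\mathrm{Re}\,s>1$ define $$E_{\mathfrak a}^{m,n}(z,s)=\sum_{\gamma\in\Gamma_{\mathfrak a}\backslash\Gamma}\chi(\gamma)\langle\gamma,f\rangle^m\,\overline{\langle\gamma,g\rangle}^{\,n}\,\mathrm{Im}(\sigma_{\mathfrak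 a}^{-1}\gamma z)^s,$$ where the terms are well defined on cosets and the series converges absolutely. Let $\mathbb E^{m,n}(z,s)$ be the column vector of length $N=r(m+1)(n+1)$ with entries $E_{\mathfrak a}^{m-i_1,n-i_2}(z,s)$ indexed by $(i_1,i_2,\mathfrak a)$, $0\le i_1\le m$, $0\le i_2\le n$, in lexicographic order. For $\gamma\in\Gamma$ let $$\pi^{m,n}(\gamma)=\left(\binom{m-i_1}{m-j_1}\binom{n-i_2}{n-j_2}\,\overline{\chi}(\gamma)\bigl(-\langle\gamma,f\rangle\bigr)^{j_1-i_1}\bigl(-\overline{\langle\gamma,g\rangle}\bigr)^{j_2-i_2}\,I_r\right)_{(i_1,i_2),(j_1,j_2)},$$ an entry being $0$ if $j_1<i_1$ or $j_2<i_2$. Then $\pi^{m,n}$ is a representation of $\Gamma$ by upper triangular $N\times N$ matrices such that $\chi(\gamma)\pi^{m,n}(\gamma)$ is unipotent for every $\gamma\in\Gamma$; that is, $\pi^{m,n}$ is the twist by $\overline\chi$ of a unipotent representation (and is itself unipotent if $\chi=1$). For all $\gamma\in\Gamma$, $z\in\mathbf H$ and $\mathrm{Re}\,s>1$, $$\mathbb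 E^{m,n}(\gamma z,s)=\pi^{m,n}(\gamma)\,\mathbb E^{m,n}(z,s).$$ Moreover $\mathbb E^{m,n}(z,s)$ is $C^\infty$ in $z$ and $$\Delta\mathbb E^{m,n}=s(1-s)\,\mathbb E^{m,n},\qquad \Delta=-4y^2\frac{\partial}{\partial z}\frac{\partial}{\partial\bar z}.$$ Hence $\mathbb E^{m,n}(\cdot,s)$ is a $C^\infty$ section, with $\Delta$-eigenvalue $s(1-s)$, of the flat vector bundle $\Gamma\backslash(\mathbf H\times\mathbf C^N)\to\Gamma\backslash\mathbf H$ attached to $\pi^{m,n}$. -/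

import Mathlib

open UpperHalfPlane Matrix
open scoped MatrixGroups ContDiff ComplexConjugate

noncomputable section

namespace HigherEisenstein

/-- `Γ\ℍ` has finite hyperbolic area: some measurable set of finite area meets every `Γ`-orbit.
(This phrasing is insensitive to whether `-1`, which acts trivially, belongs to `Γ`.) -/
def HasFiniteCovolume (Γ : Subgroup (GL (Fin 2) ℝ)) : Prop :=
  ∃ F : Set ℍ, MeasurableSet F ∧ MeasureTheory.volume F < ⊤ ∧ ∀ z : ℍ, ∃ γ ∈ Γ, γ • z ∈ F

/-- `a` lists representatives of the `Γ`-classes of cusps, each class exactly once. -/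
def IsCuspRepresentatives (Γ : Subgroup (GL (Fin 2) ℝ)) {r : ℕ} (a : Fin r → OnePoint ℝ) : Prop :=
  (∀ i, IsCusp (a i) Γ) ∧
    ∀ c : OnePoint ℝ, IsCusp c Γ → ∃! i, ∃ γ ∈ Γ, γ • a i = c

/-- `σ` is a scaling matrix for the cusp `c`: it sends `∞` to `c` and, modulo `±1`,
it conjugates the stabilizer `Γ_c` to the group of integral translations. -/
def IsScalingMatrix (Γ : Subgroup (GL (Fin 2) ℝ)) (c : OnePoint ℝ) (σ : SL(2, ℝ)) : Prop :=
  (σ : GL (Fin 2) ℝ) • (OnePoint.infty : OnePoint ℝ) = c ∧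
    ∀ g : GL (Fin 2) ℝ, ((g ∈ Γ ∨ -g ∈ Γ) ∧ g • c = c) ↔
      ∃ k : ℤ,
        g = (σ : GL (Fin 2) ℝ) * GeneralLinearGroup.upperRightHom (k : ℝ) * (σ : GL (Fin 2) ℝ)⁻¹ ∨
        g = -((σ : GL (Fin 2) ℝ) * GeneralLinearGroup.upperRightHom (k : ℝ) *
              (σ : GL (Fin 2) ℝ)⁻¹)

/-- `∫_z^w f(u) du` along the straight segment from `z` to `w` (which lies in `ℍ`). -/
def segmentIntegral (f : ℍ → ℂ) (z w : ℍ) : ℂ :=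
  ∫ t in (0 : ℝ)..1, f (ofComplex ((z : ℂ) + (t : ℂ) * ((w : ℂ) - (z : ℂ)))) * ((w : ℂ) - (z : ℂ))

/-- The modular symbol `⟨γ, f⟩ = ∫_{z₀}^{γ z₀} f(w) dw`. -/
def modularSymbol (f : ℍ → ℂ) (z₀ : ℍ) (γ : GL (Fin 2) ℝ) : ℂ :=
  segmentIntegral f z₀ (γ • z₀)

section Series

variable (Γ : Subgroup (GL (Fin 2) ℝ)) (χ : Γ →* Circle) (f g : CuspForm Γ 2) (z₀ : ℍ)

/-- The term `χ(γ) ⟨γ, f⟩^m conj(⟨γ, g⟩)^n Im(σ⁻¹ γ z)^s`. -/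
def eisensteinTerm (σ : SL(2, ℝ)) (m n : ℕ) (s : ℂ) (z : ℍ) (γ : Γ) : ℂ :=
  (χ γ : ℂ) * modularSymbol f z₀ γ ^ m * conj (modularSymbol g z₀ γ) ^ n *
    (((((σ : GL (Fin 2) ℝ)⁻¹ * (γ : GL (Fin 2) ℝ)) • z).im : ℝ) : ℂ) ^ s

/-- The set `Γ_c \ Γ` of right cosets of the stabilizer of `c`. -/
abbrev CuspCosets (c : OnePoint ℝ) : Type :=
  Quotient (QuotientGroup.rightRel (MulAction.stabilizer Γ c))

/-- The series `E_c^{m,n}(z, s)`, summed over `Γ_c \ Γ`. -/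
def eisensteinSeries (c : OnePoint ℝ) (σ : SL(2, ℝ)) (m n : ℕ) (z : ℍ) (s : ℂ) : ℂ :=
  ∑' q : CuspCosets Γ c, eisensteinTerm Γ χ f g z₀ σ m n s z q.out

/-- Positions in the vector `𝔼^{m,n}`: triples `(i₁, i₂, cusp)`, ordered lexicographically. -/
abbrev EisIndex (m n r : ℕ) : Type := Fin (m + 1) ×ₗ Fin (n + 1) ×ₗ Fin r

theorem card_eisIndex (m n r : ℕ) : Fintype.card (EisIndex m n r) = r * (m + 1) * (n + 1) := by
  simp only [EisIndex, Fintype.card_lex, Fintype.card_prod, Fintype.card_fin]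
  ring

/-- The first component `i₁`. -/
def EisIndex.fst {m n r : ℕ} (I : EisIndex m n r) : ℕ := (ofLex I).1

/-- The second component `i₂`. -/
def EisIndex.snd {m n r : ℕ} (I : EisIndex m n r) : ℕ := (ofLex (ofLex I).2).1

/-- The cusp component. -/
def EisIndex.cusp {m n r : ℕ} (I : EisIndex m n r) : Fin r := (ofLex (ofLex I).2).2

/-- The vector `𝔼^{m,n}(z, s)`, whose entry at `(i₁, i₂, 𝔞)` is `E_𝔞^{m-i₁, n-i₂}(z, s)`. -/
def eisensteinVector {r : ℕ} (a : Fin r → OnePoint ℝ) (σ : Fin r → SL(2, ℝ)) (m n : ℕ)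
    (z : ℍ) (s : ℂ) : EisIndex m n r → ℂ :=
  fun I => eisensteinSeries Γ χ f g z₀ (a I.cusp) (σ I.cusp) (m - I.fst) (n - I.snd) z s

/-- `S_{i,j}(τ) = conj(χ(τ)) (-⟨τ, f⟩)^i (-conj ⟨τ, g⟩)^j`. -/
def symbolFactor (i j : ℕ) (τ : Γ) : ℂ :=
  conj (χ τ : ℂ) * (-modularSymbol f z₀ τ) ^ i * (-conj (modularSymbol g z₀ τ)) ^ j

/-- The explicit matrix `π^{m,n}(γ)`. If `j₁ < i₁` or `j₂ < i₂` a binomial coefficient vanishes,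
so the truncated differences are only used where they are genuine. -/
def piMatrix (m n r : ℕ) (γ : Γ) : Matrix (EisIndex m n r) (EisIndex m n r) ℂ :=
  Matrix.of fun I J =>
    ((m - I.fst).choose (m - J.fst) : ℂ) * ((n - I.snd).choose (n - J.snd) : ℂ) *
      symbolFactor Γ χ f g z₀ (J.fst - I.fst) (J.snd - I.snd) γ *
      (if I.cusp = J.cusp then 1 else 0)

end Series

/-- The unipotent matrices. -/
def Uni (ι : Type) [Fintype ι] [DecidableEq ι] : Set (Matrix ι ι ℂ) :=
  {A | IsNilpotent (A - 1)}

/-- `∂F/∂z = (∂F/∂x - i ∂F/∂y) / 2`. -/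
def dz (F : ℂ → ℂ) (w : ℂ) : ℂ := (fderiv ℝ F w 1 - Complex.I * fderiv ℝ F w Complex.I) / 2

/-- `∂F/∂z̄ = (∂F/∂x + i ∂F/∂y) / 2`. -/
def dzbar (F : ℂ → ℂ) (w : ℂ) : ℂ := (fderiv ℝ F w 1 + Complex.I * fderiv ℝ F w Complex.I) / 2

/-- The hyperbolic Laplacian `Δ = -4 y² (∂/∂z)(∂/∂z̄)`. -/
def hyperbolicLaplacian (u : ℍ → ℂ) (z : ℍ) : ℂ :=
  -4 * (z.im : ℂ) ^ 2 * dz (dzbar fun w => u (ofComplex w)) z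

/-- `u` is `C^∞` on `ℍ` in the real sense. -/
def IsSmooth (u : ℍ → ℂ) : Prop :=
  ContDiffOn ℝ ∞ (fun w : ℂ => u (ofComplex w)) {w : ℂ | 0 < w.im}

section FlatBundle

variable {Γ : Subgroup (GL (Fin 2) ℝ)} {ι : Type} [Fintype ι] [DecidableEq ι]

/-- `(z, v) ∼ (γ z, π(γ) v)` on `ℍ × ℂ^ι`. -/
def flatSetoid (π : Γ →* Matrix ι ι ℂ) : Setoid (ℍ × (ι → ℂ)) where
  r p q := ∃ γ : Γ, γ • p.1 = q.1 ∧ π γ *ᵥ p.2 = q.2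
  iseqv :=
    { refl := fun p => ⟨1, by simp⟩
      symm := by
        rintro ⟨z, v⟩ ⟨w, u⟩ ⟨γ, h₁, h₂⟩
        refine ⟨γ⁻¹, ?_, ?_⟩
        · exact inv_smul_eq_iff.mpr h₁.symm
        · simp only at h₂ ⊢
          rw [← h₂, Matrix.mulVec_mulVec, ← map_mul]
          simp
      trans := by
        rintro ⟨z, v⟩ ⟨w, u⟩ ⟨x, t⟩ ⟨γ, h₁, h₂⟩ ⟨δ, h₃, h₄⟩
        refine ⟨δ * γ, ?_, ?_⟩
        · simp only at h₁ h₃ ⊢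
          rw [mul_smul, h₁, h₃]
        · simp only at h₂ h₄ ⊢
          rw [map_mul, ← Matrix.mulVec_mulVec, h₂, h₄] }

/-- The total space `Γ \ (ℍ × ℂ^ι)` of the flat (orbifold) vector bundle over `Γ \ ℍ`
attached to the representation `π`. -/
def FlatBundle (π : Γ →* Matrix ι ι ℂ) : Type := Quotient (flatSetoid π)

/-- The class of `(z, v)` in the bundle. -/
def FlatBundle.mk (π : Γ →* Matrix ι ι ℂ) (z : ℍ) (v : ι → ℂ) : FlatBundle π :=
  Quotient.mk (flatSetoid π) (z, v)

/-- The projection of the bundle to `Γ \ ℍ`. -/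
def FlatBundle.proj (π : Γ →* Matrix ι ι ℂ) : FlatBundle π → MulAction.orbitRel.Quotient Γ ℍ :=
  Quotient.lift (fun p => Quotient.mk (MulAction.orbitRel Γ ℍ) p.1) (by
    rintro ⟨z, v⟩ ⟨w, u⟩ ⟨γ, h₁, -⟩
    exact Quotient.sound ⟨γ⁻¹, inv_smul_eq_iff.mpr h₁.symm⟩)

/-- `u : ℍ → ℂ^ι` is (the lift of) a `C^∞` section of the bundle of `π` that is an
eigenvector of `Δ` with eigenvalue `ev`: it is smooth and `π`-equivariant, it descends to a section
of the projection, and each of its components is an eigenfunction of `Δ`. -/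
def IsEigensection (π : Γ →* Matrix ι ι ℂ) (ev : ℂ) (u : ℍ → ι → ℂ) : Prop :=
  (∀ i, IsSmooth fun z => u z i) ∧
  (∀ (γ : Γ) (z : ℍ), u (γ • z) = π γ *ᵥ u z) ∧
  (∃ sec : MulAction.orbitRel.Quotient Γ ℍ → FlatBundle π,
    (∀ p, FlatBundle.proj π (sec p) = p) ∧
    ∀ z : ℍ, sec (Quotient.mk (MulAction.orbitRel Γ ℍ) z) = FlatBundle.mk π z (u z)) ∧
  (∀ (z : ℍ) (i : ι), hyperbolicLaplacian (fun w => u w i) z = ev * u z i)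

end FlatBundle

end HigherEisenstein

end

open UpperHalfPlane Matrix
open scoped MatrixGroups ContDiff ComplexConjugate

noncomputable section

/-! The algebra is short. The form `f(w) dw` is `Γ`-invariant, so `γ ↦ ⟨γ, f⟩` is additive
(`modularSymbol_mul`) and `⟨τ, f⟩ = ⟨τγ, f⟩ - ⟨γ, f⟩`. Putting this into the term of `τ` at `γ z`,
expanding by the binomial theorem and re-indexing the cosets by `τ ↦ τγ` gives
`eisensteinVector_smul`. That `π` is multiplicative is a composition of two such expansions
(`sum_choose_mul_choose`).

The symbols do not involve `z`, so as a function of `z` each entry is `∑ c_q Im(h_q z)^s` with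
constant `c_q`. The functions `Im(h z)^s (conj j / j)^k`, `k ∈ ℤ`, are closed under `∂/∂z` and
`∂/∂z̄` with coefficients independent of `h`, and their absolute value does not depend on `k`.
Absolute convergence therefore yields smoothness and the eigenvalue equation by termwise
differentiation.

The real work is absolute convergence for `Re s > 1`. Without symbols it is a count of orbit points
in dyadic boxes (`IsScalingMatrix.summable_im_rpow`). The symbols grow at most logarithmically in
the height once `Im z |f z|` is bounded on `ℍ` (`exists_im_mul_norm_le`), and logarithms cost only a
small part of the exponent.

That bound is where finite covolume enters, through a thick-thin decomposition instead of a
fundamental domain. Thick points lie in finitely many unit balls modulo `Γ`, by packing against the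
area. A point that is thin because of a non-parabolic element lies at bounded distance from a thick
one (`FiniteDisplacement.exists_isThick_near`). A point that is thin because of a parabolic element
lies high in a cusp, where `f` decays exponentially. -/

namespace HigherEisenstein

open scoped ModularForm Manifold Topology
open Filter

/-! ### Primitives of weight two forms and additivity of modular symbols. -/

/-- `F` is a holomorphic primitive of `f` on the upper half-plane. -/
def IsPrimitive (f : ℍ → ℂ) (F : ℂ → ℂ) : Prop :=
  ∀ z : ℍ, HasDerivAt F (f z) z

theorem exists_isPrimitive {f : ℍ → ℂ} (hf : MDiff f) : ∃ F, IsPrimitive f F := by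
  obtain ⟨F, hF⟩ := Convex.exists_forall_hasDerivWithinAt (𝕜 := ℂ) (convex_halfSpace_im_gt 0)
    (UpperHalfPlane.mdifferentiable_iff.mp hf)
  refine ⟨F, fun z => ?_⟩
  have := (hF z z.im_pos).hasDerivAt (isOpen_upperHalfPlaneSet.mem_nhds z.im_pos)
  simpa using this

theorem IsPrimitive.sub_eq_sub {f : ℍ → ℂ} {F G : ℂ → ℂ} (hF : IsPrimitive f F)
    (hG : IsPrimitive f G) (z w : ℍ) : F z - F w = G z - G w := by
  have h := (convex_halfSpace_im_gt (0 : ℝ)).norm_image_sub_le_of_norm_hasDerivWithin_le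
    (f := fun x => F x - G x) (f' := fun _ => 0) (C := 0)
    (fun x hx => by
      have := (hF ⟨x, hx⟩).sub (hG ⟨x, hx⟩)
      rw [sub_self] at this
      exact this.hasDerivWithinAt) (by simp) w.im_pos z.im_pos
  have h' : F z - G z - (F w - G w) = 0 := by simpa using h
  linear_combination h'

/-- The segment stays in the convex half-plane, so the fundamental theorem of calculus applies. From
here on only values of primitives matter, not the path. -/
theorem segmentIntegral_eq_sub {f : ℍ → ℂ} {F : ℂ → ℂ} (hf : MDiff f) (hF : IsPrimitive f F)
    (z w : ℍ) : segmentIntegral f z w = F w - F z := by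
  have hmem : ∀ t ∈ Set.uIcc (0 : ℝ) 1, 0 < ((z : ℂ) + (t : ℂ) * ((w : ℂ) - z)).im := by
    intro t ht
    rw [Set.uIcc_of_le zero_le_one] at ht
    have := z.im_pos
    have := w.im_pos
    have h2 : ((z : ℂ) + (t : ℂ) * ((w : ℂ) - z)).im = (1 - t) * z.im + t * w.im := by
      simp; ring
    rw [h2]
    rcases eq_or_lt_of_le ht.1 with h | h
    · subst h; simpa
    · have h3 : 0 < t * w.im := by positivity
      have h4 : 0 ≤ (1 - t) * z.im := mul_nonneg (by linarith [ht.2]) (by positivity)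
      linarith
  have hd : ∀ t ∈ Set.uIcc (0 : ℝ) 1, HasDerivAt (fun t : ℝ => F ((z : ℂ) + t * ((w : ℂ) - z)))
      (f (ofComplex ((z : ℂ) + t * ((w : ℂ) - z))) * ((w : ℂ) - z)) t := by
    intro t ht
    have h1 : HasDerivAt (fun t : ℝ => (z : ℂ) + (t : ℂ) * ((w : ℂ) - z)) ((w : ℂ) - z) t := by
      simpa using (((hasDerivAt_id t).ofReal_comp).mul_const ((w : ℂ) - z)).const_add (z : ℂ)
    have h2 := hF (ofComplex ((z : ℂ) + (t : ℂ) * ((w : ℂ) - z)))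
    rw [ofComplex_apply_of_im_pos (hmem t ht)] at h2 ⊢
    exact h2.comp t h1
  have hc : ContinuousOn (fun t : ℝ => f (ofComplex ((z : ℂ) + t * ((w : ℂ) - z))) * ((w : ℂ) - z))
      (Set.uIcc 0 1) := by
    intro t ht
    refine ContinuousAt.continuousWithinAt (ContinuousAt.mul ?_ continuousAt_const)
    have h1 : ContinuousAt (fun t : ℝ => (z : ℂ) + (t : ℂ) * ((w : ℂ) - z)) t := by fun_prop
    have h3 : ContinuousAt (f ∘ ofComplex) ((z : ℂ) + (t : ℂ) * ((w : ℂ) - z)) :=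
      ((UpperHalfPlane.mdifferentiable_iff.mp hf).continuousOn).continuousAt
        (isOpen_upperHalfPlaneSet.mem_nhds (hmem t ht))
    exact ContinuousAt.comp (g := f ∘ ofComplex) h3 h1
  unfold segmentIntegral
  rw [intervalIntegral.integral_eq_sub_of_hasDerivAt hd (hc.intervalIntegrable)]
  simp

theorem slash_two_apply (f : ℍ → ℂ) {g : GL (Fin 2) ℝ} (hg : g.val.det = 1) (z : ℍ) :
    (f ∣[(2 : ℤ)] g) z = f (g • z) * (1 / denom g z ^ 2) := by
  have h1 : 0 < g.det.val := by
    rw [Matrix.GeneralLinearGroup.val_det_apply, hg]; exact one_pos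
  rw [ModularForm.slash_apply]
  simp [UpperHalfPlane.σ, hg]

theorem hasDerivAt_smul {g : GL (Fin 2) ℝ} (hg : g.val.det = 1) (z : ℍ) :
    HasDerivAt (fun w : ℂ => ((g • ofComplex w : ℍ) : ℂ)) (1 / denom g z ^ 2) z := by
  have h1 : 0 < g.det.val := by
    rw [Matrix.GeneralLinearGroup.val_det_apply, hg]; exact one_pos
  have hd := denom_ne_zero g z
  have h2 : HasDerivAt (fun w : ℂ => num g w / denom g w) (1 / denom g z ^ 2) z := by
    have hn : HasDerivAt (fun w : ℂ => num g w) (g 0 0 : ℂ) z := by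
      simpa [num] using ((hasDerivAt_id (z : ℂ)).const_mul (g 0 0 : ℂ)).add_const (g 0 1 : ℂ)
    have hd' : HasDerivAt (fun w : ℂ => denom g w) (g 1 0 : ℂ) z := by
      simpa [denom] using ((hasDerivAt_id (z : ℂ)).const_mul (g 1 0 : ℂ)).add_const (g 1 1 : ℂ)
    refine (hn.fun_div hd' hd).congr_deriv ?_
    congr 1
    rw [Matrix.det_fin_two] at hg
    have : ((g 0 0 : ℝ) : ℂ) * (g 1 1 : ℝ) - (g 0 1 : ℝ) * (g 1 0 : ℝ) = 1 := by exact_mod_cast hg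
    unfold num denom
    linear_combination this
  refine h2.congr_of_eventuallyEq ?_
  filter_upwards [isOpen_upperHalfPlaneSet.mem_nhds z.im_pos] with w hw
  rw [coe_smul_of_det_pos h1, ofComplex_apply_of_im_pos hw]

/-- The Möbius map has derivative `j⁻²`, which is exactly the weight two factor, so this is the
chain rule. -/
theorem IsPrimitive.slash {f : ℍ → ℂ} {F : ℂ → ℂ} (hF : IsPrimitive f F) {g : GL (Fin 2) ℝ}
    (hg : g.val.det = 1) :
    IsPrimitive (f ∣[(2 : ℤ)] g) (fun w => F ((g • ofComplex w : ℍ) : ℂ)) := by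
  intro z
  rw [slash_two_apply f hg]
  have h : HasDerivAt F (f (g • z)) ((g • ofComplex z : ℍ) : ℂ) := by
    rw [ofComplex_apply]
    exact hF (g • z)
  have h2 := hasDerivAt_smul hg z
  exact HasDerivAt.comp (h₂ := F) (z : ℂ) h h2

/-- The increment of a primitive of an invariant form along `γ` does not depend on the point. -/
theorem IsPrimitive.smul_sub {f : ℍ → ℂ} {F : ℂ → ℂ} (hF : IsPrimitive f F) {g : GL (Fin 2) ℝ}
    (hg : g.val.det = 1) (hf : f ∣[(2 : ℤ)] g = f) (z w : ℍ) :
    F (g • z : ℍ) - F z = F (g • w : ℍ) - F w := by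
  -- By invariance `F` and `F ∘ g` are primitives of the same function, so they differ by a
  -- constant.
  have h := hF.slash hg
  rw [hf] at h
  have := hF.sub_eq_sub h z w
  simp only [ofComplex_apply] at this
  linear_combination -this

theorem det_eq_one_of_mem {Γ : Subgroup (GL (Fin 2) ℝ)} [Γ.HasDetOne] {g : GL (Fin 2) ℝ}
    (hg : g ∈ Γ) : g.val.det = 1 := by
  have := Subgroup.HasDetOne.det_eq hg
  rw [← Matrix.GeneralLinearGroup.val_det_apply, this]; rfl

section Symbols

variable {Γ : Subgroup (GL (Fin 2) ℝ)} [Γ.HasDetOne] (f : CuspForm Γ 2) (z₀ : ℍ)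

theorem modularSymbol_eq {F : ℂ → ℂ} (hF : IsPrimitive f F) {γ : GL (Fin 2) ℝ} (hγ : γ ∈ Γ)
    (z : ℍ) : modularSymbol f z₀ γ = F (γ • z : ℍ) - F z := by
  rw [modularSymbol, segmentIntegral_eq_sub (CuspFormClass.holo f) hF]
  exact hF.smul_sub (det_eq_one_of_mem hγ) (SlashInvariantFormClass.slash_action_eq f γ hγ) _ _

/-- The increment along `γ` may be taken from the base point `δ z₀`, after which the two increments
telescope. -/
theorem modularSymbol_mul {γ δ : GL (Fin 2) ℝ} (hγ : γ ∈ Γ) (hδ : δ ∈ Γ) :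
    modularSymbol f z₀ (γ * δ) = modularSymbol f z₀ γ + modularSymbol f z₀ δ := by
  obtain ⟨F, hF⟩ := exists_isPrimitive (CuspFormClass.holo f)
  rw [modularSymbol_eq f z₀ hF (mul_mem hγ hδ) z₀, modularSymbol_eq f z₀ hF hγ (δ • z₀),
    modularSymbol_eq f z₀ hF hδ z₀, mul_smul]
  ring

theorem modularSymbol_one : modularSymbol f z₀ 1 = 0 := by
  simpa using modularSymbol_mul f z₀ (one_mem Γ) (one_mem Γ)

end Symbols

/-! ### Vanishing of modular symbols on cusp stabilizers. -/

/-- If `h` vanishes at `i∞`, the increments of its primitives along horizontal segments of a fixed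
length tend to zero at `i∞`. -/
theorem IsPrimitive.tendsto_vadd_sub {h : ℍ → ℂ} {H : ℂ → ℂ} (hH : IsPrimitive h H)
    (h0 : IsZeroAtImInfty h) (x : ℝ) :
    Tendsto (fun z : ℍ => H (x +ᵥ z : ℍ) - H z) atImInfty (𝓝 0) := by
  rw [Metric.tendsto_nhds]
  intro ε hε
  have h1 := (Metric.tendsto_nhds.mp h0) (ε / (|x| + 1)) (by positivity)
  obtain ⟨Y, hY⟩ := (UpperHalfPlane.atImInfty_mem _).mp h1
  refine (UpperHalfPlane.atImInfty_mem _).mpr ⟨max Y 1, fun z hz => ?_⟩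
  have hconv := (convex_halfSpace_im_ge (max Y 1)).norm_image_sub_le_of_norm_hasDerivWithin_le
    (f := H) (f' := fun w => h (ofComplex w)) (C := ε / (|x| + 1))
    (fun w hw => by
      have hw0 : 0 < w.im := lt_of_lt_of_le (by simp) (show max Y 1 ≤ w.im from hw)
      have := hH (ofComplex w)
      rw [ofComplex_apply_of_im_pos hw0] at this ⊢
      exact this.hasDerivWithinAt)
    (fun w hw => by
      have hw0 : 0 < w.im := lt_of_lt_of_le (by simp) (show max Y 1 ≤ w.im from hw)
      have := hY ⟨w, hw0⟩ (le_trans (le_max_left _ _) hw)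
      rw [ofComplex_apply_of_im_pos hw0]
      exact le_of_lt (by simpa using this)) (x := (z : ℂ)) (y := ((x +ᵥ z : ℍ) : ℂ)) hz
    (by simpa using hz)
  simp only [Set.mem_ofPred_eq, dist_zero_right]
  refine lt_of_le_of_lt hconv ?_
  have : ‖((x +ᵥ z : ℍ) : ℂ) - z‖ = |x| := by simp
  rw [this, div_mul_eq_mul_div, div_lt_iff₀ (by positivity)]
  nlinarith [abs_nonneg x]

theorem upperRightHom_smul (x : ℝ) (z : ℍ) :
    GeneralLinearGroup.upperRightHom x • z = x +ᵥ z := by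
  ext
  rw [coe_smul_of_det_pos (by simp)]
  simp [num, denom, add_comm]

section Scaling

variable {Γ : Subgroup (GL (Fin 2) ℝ)} {c : OnePoint ℝ} {σ : SL(2, ℝ)}

theorem IsScalingMatrix.exists_smul_eq (hσ : IsScalingMatrix Γ c σ) {γ : GL (Fin 2) ℝ}
    (hγ : γ ∈ Γ) (hc : γ • c = c) :
    ∃ k : ℤ, ∀ z : ℍ, γ • z = (σ : GL (Fin 2) ℝ) • ((k : ℝ) +ᵥ (σ : GL (Fin 2) ℝ)⁻¹ • z) := by
  obtain ⟨k, hk⟩ := (hσ.2 γ).mp ⟨Or.inl hγ, hc⟩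
  refine ⟨k, fun z => ?_⟩
  rcases hk with rfl | rfl
  · simp only [mul_smul, upperRightHom_smul]
  · simp only [neg_smul, mul_smul, upperRightHom_smul]

theorem IsScalingMatrix.exists_mem_smul_eq (hσ : IsScalingMatrix Γ c σ) (k : ℤ) :
    ∃ γ ∈ Γ, γ • c = c ∧
      ∀ z : ℍ, γ • z = (σ : GL (Fin 2) ℝ) • ((k : ℝ) +ᵥ (σ : GL (Fin 2) ℝ)⁻¹ • z) := by
  set τ := (σ : GL (Fin 2) ℝ) * GeneralLinearGroup.upperRightHom (k : ℝ) *
    (σ : GL (Fin 2) ℝ)⁻¹ with hτ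
  obtain ⟨h1, h2⟩ := (hσ.2 τ).mpr ⟨k, Or.inl rfl⟩
  -- Only one of `τ`, `-τ` need lie in `Γ`; both fix the cusp and act in the same way on `ℍ`.
  obtain ⟨-, h3⟩ := (hσ.2 (-τ)).mpr ⟨k, Or.inr rfl⟩
  rcases h1 with h1 | h1
  · exact ⟨τ, h1, h2, fun z => by simp only [hτ, mul_smul, upperRightHom_smul]⟩
  · exact ⟨-τ, h1, h3, fun z => by simp only [hτ, neg_smul, mul_smul, upperRightHom_smul]⟩

theorem det_coe_eq_one (σ : SL(2, ℝ)) : (σ : GL (Fin 2) ℝ).val.det = 1 := by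
  simp

/-- In the coordinate of the cusp the element is a translation. The increment of the primitive is
the same at every point and tends to zero at `i∞`, so it is zero. -/
theorem modularSymbol_eq_zero [Γ.HasDetOne] (f : CuspForm Γ 2) (z₀ : ℍ)
    (hσ : IsScalingMatrix Γ c σ) (hc : IsCusp c Γ) {γ : GL (Fin 2) ℝ} (hγ : γ ∈ Γ)
    (h : γ • c = c) : modularSymbol f z₀ γ = 0 := by
  obtain ⟨F, hF⟩ := exists_isPrimitive (CuspFormClass.holo f)
  obtain ⟨k, hk⟩ := hσ.exists_smul_eq hγ h
  have h0 : IsZeroAtImInfty (f ∣[(2 : ℤ)] (σ : GL (Fin 2) ℝ)) :=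
    CuspFormClass.zero_at_cusps f hc _ hσ.1
  have ht := (hF.slash (det_coe_eq_one σ)).tendsto_vadd_sub h0 (k : ℝ)
  refine tendsto_nhds_unique (tendsto_const_nhds.congr fun z => ?_) ht
  rw [modularSymbol_eq f z₀ hF hγ ((σ : GL (Fin 2) ℝ) • z), hk]
  simp only [ofComplex_apply, inv_smul_smul]

end Scaling

/-! ### Matrix norms and hyperbolic displacement in `SL(2, ℝ)`. -/

section Displacement

open scoped Matrix.Norms.Frobenius

/-- The Frobenius distance of an element of `SL(2, ℝ)` from the identity. -/
def deviation (A : SL(2, ℝ)) : ℝ := ‖(A : Matrix (Fin 2) (Fin 2) ℝ) - 1‖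

/-- The quantity `2 cosh d(i, A i) - 2`. -/
def displacement (A : SL(2, ℝ)) : ℝ := (A 0 0 - A 1 1) ^ 2 + (A 0 1 + A 1 0) ^ 2

theorem frobenius_norm_sq_fin_two (M : Matrix (Fin 2) (Fin 2) ℝ) :
    ‖M‖ ^ 2 = M 0 0 ^ 2 + M 0 1 ^ 2 + M 1 0 ^ 2 + M 1 1 ^ 2 := by
  rw [Matrix.frobenius_norm_def, ← Real.sqrt_eq_rpow, Real.sq_sqrt (by positivity)]
  simp [Fin.sum_univ_two]
  ring

theorem det_eq_one_fin_two (A : SL(2, ℝ)) : A 0 0 * A 1 1 - A 0 1 * A 1 0 = 1 := by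
  have := A.det_coe
  rwa [Matrix.det_fin_two] at this

theorem deviation_nonneg (A : SL(2, ℝ)) : 0 ≤ deviation A := norm_nonneg _

theorem displacement_nonneg (A : SL(2, ℝ)) : 0 ≤ displacement A := by
  unfold displacement; positivity

/-- With `cosh_dist_I_smul` this reads `‖A‖² = 2 cosh d(i, A i)`, the bridge between matrix
estimates and hyperbolic geometry. -/
theorem norm_sq_eq_displacement_add_two (A : SL(2, ℝ)) :
    ‖(A : Matrix (Fin 2) (Fin 2) ℝ)‖ ^ 2 = displacement A + 2 := by
  rw [frobenius_norm_sq_fin_two, displacement]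
  linear_combination 2 * det_eq_one_fin_two A

/-- The deviation thus depends only on displacement and trace, which is why `deviationAt` does not
depend on the frame chosen at the point. -/
theorem deviation_sq (A : SL(2, ℝ)) :
    deviation A ^ 2 = displacement A + 2 * (2 - (A 0 0 + A 1 1)) := by
  rw [deviation, frobenius_norm_sq_fin_two, displacement]
  simp
  linear_combination 2 * det_eq_one_fin_two A

theorem deviation_eq_zero_iff {A : SL(2, ℝ)} : deviation A = 0 ↔ A = 1 := by
  rw [deviation, norm_eq_zero, sub_eq_zero]
  constructor
  · intro h; exact Subtype.ext (by simpa using h)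
  · rintro rfl; simp

theorem norm_le_add_deviation (A : SL(2, ℝ)) :
    ‖(A : Matrix (Fin 2) (Fin 2) ℝ)‖ ≤ 3 / 2 + deviation A := by
  have h1 : ‖(1 : Matrix (Fin 2) (Fin 2) ℝ)‖ ≤ 3 / 2 := by
    refine le_of_sq_le_sq ?_ (by norm_num)
    rw [frobenius_norm_sq_fin_two]; norm_num
  have := norm_add_le ((A : Matrix (Fin 2) (Fin 2) ℝ) - 1) 1
  rw [sub_add_cancel] at this
  unfold deviation
  linarith

theorem norm_inv_eq_norm (A : SL(2, ℝ)) :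
    ‖((A⁻¹ : SL(2, ℝ)) : Matrix (Fin 2) (Fin 2) ℝ)‖ = ‖(A : Matrix (Fin 2) (Fin 2) ℝ)‖ := by
  refine (sq_eq_sq₀ (norm_nonneg _) (norm_nonneg _)).mp ?_
  rw [frobenius_norm_sq_fin_two, frobenius_norm_sq_fin_two, Matrix.SpecialLinearGroup.coe_inv,
    Matrix.adjugate_fin_two]
  simp
  ring

/-- The commutator minus `1` is `[A - 1, B - 1] A⁻¹ B⁻¹`, quadratic in the deviations. The threshold
`1 / 10` gives the factor `2 · (1/10) · (8/5)² < 3/5`; any factor below `1` would serve. -/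
theorem deviation_commutator_le {A B : SL(2, ℝ)} (hA : deviation A ≤ 1 / 10)
    (hB : deviation B ≤ 1 / 10) : deviation (A * B * A⁻¹ * B⁻¹) ≤ 3 / 5 * deviation A := by
  set X : Matrix (Fin 2) (Fin 2) ℝ := A.1 with hX
  set Y : Matrix (Fin 2) (Fin 2) ℝ := B.1 with hY
  have hXX : X * ((A⁻¹ : SL(2, ℝ)) : Matrix (Fin 2) (Fin 2) ℝ) = 1 := by
    rw [← Matrix.SpecialLinearGroup.coe_mul, mul_inv_cancel, Matrix.SpecialLinearGroup.coe_one]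
  have hYY : Y * ((B⁻¹ : SL(2, ℝ)) : Matrix (Fin 2) (Fin 2) ℝ) = 1 := by
    rw [← Matrix.SpecialLinearGroup.coe_mul, mul_inv_cancel, Matrix.SpecialLinearGroup.coe_one]
  have h1 : ((A * B * A⁻¹ * B⁻¹ : SL(2, ℝ)) : Matrix (Fin 2) (Fin 2) ℝ) - 1 =
      ((X - 1) * (Y - 1) - (Y - 1) * (X - 1)) *
        ((A⁻¹ : SL(2, ℝ)) : Matrix (Fin 2) (Fin 2) ℝ) *
        ((B⁻¹ : SL(2, ℝ)) : Matrix (Fin 2) (Fin 2) ℝ) := by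
    have : (X - 1) * (Y - 1) - (Y - 1) * (X - 1) = X * Y - Y * X := by noncomm_ring
    rw [this, sub_mul, sub_mul, mul_assoc Y X, hXX, mul_one, hYY]
    simp only [Matrix.SpecialLinearGroup.coe_mul]
    rfl
  have hAi := norm_le_add_deviation A
  have hBi := norm_le_add_deviation B
  rw [← norm_inv_eq_norm] at hAi hBi
  have hn : ‖(X - 1) * (Y - 1) - (Y - 1) * (X - 1)‖ ≤ 2 * (deviation A * deviation B) := by
    refine (norm_sub_le _ _).trans ?_
    have h2 := norm_mul_le (X - 1) (Y - 1)
    have h3 := norm_mul_le (Y - 1) (X - 1)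
    have e1 : ‖X - 1‖ = deviation A := rfl
    have e2 : ‖Y - 1‖ = deviation B := rfl
    rw [e1, e2] at h2 h3
    linarith
  have hA0 := deviation_nonneg A
  have hB0 := deviation_nonneg B
  unfold deviation at hA0 hB0 ⊢
  rw [h1]
  calc _ ≤ ‖(X - 1) * (Y - 1) - (Y - 1) * (X - 1)‖ *
        ‖((A⁻¹ : SL(2, ℝ)) : Matrix (Fin 2) (Fin 2) ℝ)‖ *
        ‖((B⁻¹ : SL(2, ℝ)) : Matrix (Fin 2) (Fin 2) ℝ)‖ := by
          refine (norm_mul_le _ _).trans ?_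
          gcongr
          exact norm_mul_le _ _
    _ ≤ (2 * (deviation A * (1 / 10))) * (8 / 5) * (8 / 5) := by
          have hA1 := deviation_nonneg A
          gcongr
          · exact hn.trans (by gcongr)
          · linarith
          · linarith
    _ ≤ 3 / 5 * ‖X - 1‖ := by
          have e1 : ‖X - 1‖ = deviation A := rfl
          rw [e1]
          have hA1 := deviation_nonneg A
          nlinarith

theorem eq_one_or_eq_neg_one {A : SL(2, ℝ)} (h1 : A 0 1 = 0) (h2 : A 1 0 = 0)
    (h3 : A 0 0 = A 1 1) : A = 1 ∨ A = -1 := by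
  have hd := det_eq_one_fin_two A
  rw [h1, h3] at hd
  have h4 : (A 1 1 - 1) * (A 1 1 + 1) = 0 := by linear_combination hd
  rcases mul_eq_zero.mp h4 with h | h
  · left
    ext i j
    fin_cases i <;> fin_cases j <;> simp <;> linarith
  · right
    ext i j
    fin_cases i <;> fin_cases j <;> simp <;> linarith

theorem deviation_neg_one : 1 < deviation (-1) := by
  have h := deviation_sq (-1)
  have h0 := deviation_nonneg (-1)
  simp [displacement] at h
  nlinarith

/-- The relations expressing that two elements of `SL(2, ℝ)` commute. -/
theorem commute_iff_fin_two {A B : SL(2, ℝ)} : A * B = B * A ↔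
    A 0 1 * B 1 0 = B 0 1 * A 1 0 ∧
    A 0 1 * (B 0 0 - B 1 1) = B 0 1 * (A 0 0 - A 1 1) ∧
    A 1 0 * (B 0 0 - B 1 1) = B 1 0 * (A 0 0 - A 1 1) := by
  rw [Matrix.SpecialLinearGroup.ext_iff]
  simp only [Fin.forall_fin_two, Matrix.SpecialLinearGroup.coe_mul, Matrix.mul_apply,
    Fin.sum_univ_two]
  constructor
  · rintro ⟨⟨h1, h2⟩, h3, h4⟩
    refine ⟨by linear_combination h1, by linear_combination -h2, by linear_combination h3⟩
  · rintro ⟨h1, h2, h3⟩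
    refine ⟨⟨by linear_combination h1, by linear_combination -h2⟩, by linear_combination h3,
      by linear_combination -h1⟩

/-- Commuting means that the traceless parts are parallel vectors in a space of dimension three. Two
vectors parallel to the same nonzero vector are parallel to each other. -/
theorem commute_of_commute {A B C : SL(2, ℝ)} (hA : A ≠ 1) (hA' : A ≠ -1)
    (hB : A * B = B * A) (hC : A * C = C * A) : B * C = C * B := by
  rw [commute_iff_fin_two] at *
  obtain ⟨b1, b2, b3⟩ := hB
  obtain ⟨c1, c2, c3⟩ := hC
  by_cases h1 : A 0 1 = 0
  · by_cases h2 : A 1 0 = 0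
    · have h3 : A 0 0 - A 1 1 ≠ 0 := by
        intro h3
        rcases eq_one_or_eq_neg_one h1 h2 (by linarith) with h | h
        · exact hA h
        · exact hA' h
      have e1 : B 0 1 = 0 := by simpa [h1, h3] using b2
      have e2 : B 1 0 = 0 := by simpa [h2, h3] using b3
      have e3 : C 0 1 = 0 := by simpa [h1, h3] using c2
      have e4 : C 1 0 = 0 := by simpa [h2, h3] using c3
      simp [e1, e2, e3, e4]
    · refine ⟨?_, ?_, ?_⟩ <;> apply mul_left_cancel₀ h2
      · linear_combination C 1 0 * (-b1) + B 1 0 * c1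
      · linear_combination -(C 0 0 - C 1 1) * b1 + (B 0 0 - B 1 1) * c1 +
          ((C 0 0 - C 1 1) * B 1 0 - (B 0 0 - B 1 1) * C 1 0) * h1
      · linear_combination B 1 0 * c3 - C 1 0 * b3
  · have h : B 0 1 * C 1 0 = C 0 1 * B 1 0 := by
      apply mul_left_cancel₀ h1
      linear_combination B 0 1 * c1 - C 0 1 * b1
    refine ⟨h, ?_, ?_⟩ <;> apply mul_left_cancel₀ h1
    · linear_combination B 0 1 * c2 - C 0 1 * b2
    · linear_combination B 1 0 * c2 - C 1 0 * b2 - (A 0 0 - A 1 1) * h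

theorem cosh_dist_I_smul (A : SL(2, ℝ)) :
    Real.cosh (dist UpperHalfPlane.I (A • UpperHalfPlane.I)) = 1 + displacement A / 2 := by
  have hd := det_eq_one_fin_two A
  rw [UpperHalfPlane.cosh_dist']
  have hne : A 1 0 ^ 2 + A 1 1 ^ 2 ≠ 0 := by
    intro h
    have h1 : A 1 0 = 0 := by nlinarith [sq_nonneg (A 1 0), sq_nonneg (A 1 1)]
    have h2 : A 1 1 = 0 := by nlinarith [sq_nonneg (A 1 0), sq_nonneg (A 1 1)]
    rw [h1, h2] at hd; simp at hd
  have hc : ((A • UpperHalfPlane.I : ℍ) : ℂ) =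
      (A 0 0 * Complex.I + A 0 1) / (A 1 0 * Complex.I + A 1 1) := by
    rw [UpperHalfPlane.coe_specialLinearGroup_apply]; simp
  have key : ∀ a b c d : ℝ, a * d - b * c = 1 → c ^ 2 + d ^ 2 ≠ 0 →
      ((a : ℂ) * Complex.I + b) / (c * Complex.I + d) =
        ⟨(a * c + b * d) / (c ^ 2 + d ^ 2), 1 / (c ^ 2 + d ^ 2)⟩ := by
    intro a b c d h1 h2
    have h3 : (c : ℂ) * Complex.I + d ≠ 0 := by
      intro h
      have e1 := congrArg Complex.re h
      have e2 := congrArg Complex.im h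
      simp at e1 e2
      simp [e1, e2] at h2
    rw [div_eq_iff h3]
    apply Complex.ext
    · simp
      field_simp
      linear_combination -c * h1
    · simp
      field_simp
      linear_combination d * h1
  have key2 : ∀ a b c d : ℝ, a * d - b * c = 1 → c ^ 2 + d ^ 2 ≠ 0 →
      ((0 - (a * c + b * d) / (c ^ 2 + d ^ 2)) ^ 2 + 1 ^ 2 + (1 / (c ^ 2 + d ^ 2)) ^ 2) /
        (2 * 1 * (1 / (c ^ 2 + d ^ 2))) = 1 + ((a - d) ^ 2 + (b + c) ^ 2) / 2 := by
    intro a b c d h1 h2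
    field_simp
    linear_combination (-1 - (a * d - b * c) + 2 * (c ^ 2 + d ^ 2)) * h1
  rw [key _ _ _ _ hd hne] at hc
  have hre := congrArg Complex.re hc
  have him := congrArg Complex.im hc
  simp only [UpperHalfPlane.coe_re, UpperHalfPlane.coe_im] at hre him
  rw [hre, him, UpperHalfPlane.I_re, UpperHalfPlane.I_im, key2 _ _ _ _ hd hne, displacement]

theorem cosh_dist_smul (g γ : SL(2, ℝ)) :
    Real.cosh (dist (g • UpperHalfPlane.I) (γ • g • UpperHalfPlane.I)) =
      1 + displacement (g⁻¹ * γ * g) / 2 := by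
  rw [← cosh_dist_I_smul, ← dist_smul g UpperHalfPlane.I]
  simp only [← mul_smul]
  rw [show g * (g⁻¹ * γ * g) = γ * g by group]

end Displacement

/-! ### Zassenhaus' lemma and the thick part of a quotient of finite area. -/

section Thick

open scoped Matrix.Norms.Frobenius
open MeasureTheory

theorem dist_smul_le_two_add_displacement (g γ : SL(2, ℝ)) :
    dist (g • UpperHalfPlane.I) (γ • g • UpperHalfPlane.I) ≤
      2 + displacement (g⁻¹ * γ * g) := by
  have h := cosh_dist_smul g γ
  rw [Real.cosh_eq] at h
  have h1 := Real.add_one_le_exp (dist (g • UpperHalfPlane.I) (γ • g • UpperHalfPlane.I))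
  have h2 := Real.exp_pos (-dist (g • UpperHalfPlane.I) (γ • g • UpperHalfPlane.I))
  linarith

theorem displacement_le_of_dist_le {g γ : SL(2, ℝ)} {R : ℝ}
    (h : dist (g • UpperHalfPlane.I) (γ • g • UpperHalfPlane.I) ≤ R) :
    displacement (g⁻¹ * γ * g) ≤ 2 * Real.cosh R := by
  have h1 := cosh_dist_smul g γ
  have h2 : Real.cosh (dist (g • UpperHalfPlane.I) (γ • g • UpperHalfPlane.I)) ≤ Real.cosh R := by
    rw [Real.cosh_le_cosh, abs_of_nonneg dist_nonneg]
    exact h.trans (le_abs_self R)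
  linarith

theorem displacement_le_of_deviation_le {A : SL(2, ℝ)} (h : deviation A ≤ 1 / 10) :
    displacement A ≤ 1 := by
  have h1 := norm_sq_eq_displacement_add_two A
  have h2 := norm_le_add_deviation A
  nlinarith [norm_nonneg (A : Matrix (Fin 2) (Fin 2) ℝ)]

/-- The deviation of `γ` from the identity, seen from the point `z`. -/
def deviationAt (z : ℍ) (γ : SL(2, ℝ)) : ℝ := deviation (z.toSL2R⁻¹ * γ * z.toSL2R)

theorem trace_conj_fin_two (g γ : SL(2, ℝ)) :
    (g⁻¹ * γ * g) 0 0 + (g⁻¹ * γ * g) 1 1 = γ 0 0 + γ 1 1 := by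
  have h : ((g⁻¹ * γ * g : SL(2, ℝ)) : Matrix (Fin 2) (Fin 2) ℝ).trace =
      (γ : Matrix (Fin 2) (Fin 2) ℝ).trace := by
    rw [Matrix.SpecialLinearGroup.coe_mul, Matrix.trace_mul_comm,
      ← Matrix.SpecialLinearGroup.coe_mul, show g * (g⁻¹ * γ) = γ by group]
  simpa [Matrix.trace_fin_two] using h

theorem deviation_conj_sq (g γ : SL(2, ℝ)) :
    deviation (g⁻¹ * γ * g) ^ 2 =
      2 * Real.cosh (dist (g • UpperHalfPlane.I) (γ • g • UpperHalfPlane.I)) + 2 -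
        2 * (γ 0 0 + γ 1 1) := by
  rw [deviation_sq, trace_conj_fin_two, cosh_dist_smul]
  ring

theorem deviationAt_sq (z : ℍ) (γ : SL(2, ℝ)) :
    deviationAt z γ ^ 2 = 2 * Real.cosh (dist z (γ • z)) + 2 - 2 * (γ 0 0 + γ 1 1) := by
  rw [deviationAt, deviation_conj_sq, toSL2R_smul_I]

theorem deviationAt_nonneg (z : ℍ) (γ : SL(2, ℝ)) : 0 ≤ deviationAt z γ := norm_nonneg _

theorem deviationAt_smul_I (g γ : SL(2, ℝ)) :
    deviationAt (g • UpperHalfPlane.I) γ = deviation (g⁻¹ * γ * g) := by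
  refine (sq_eq_sq₀ (norm_nonneg _) (norm_nonneg _)).mp ?_
  exact (deviationAt_sq _ _).trans (deviation_conj_sq _ _).symm

theorem dist_le_of_deviationAt_le {z : ℍ} {γ : SL(2, ℝ)} (h : deviationAt z γ ≤ 1 / 10) :
    dist z (γ • z) ≤ 3 := by
  have := dist_smul_le_two_add_displacement z.toSL2R γ
  rw [toSL2R_smul_I] at this
  linarith [displacement_le_of_deviation_le h]

/-- `G` moves only finitely many times a given point by a bounded amount. -/
def FiniteDisplacement (G : Subgroup SL(2, ℝ)) : Prop :=
  ∀ (z : ℍ) (R : ℝ), {γ : SL(2, ℝ) | γ ∈ G ∧ dist z (γ • z) ≤ R}.Finite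

theorem finiteDisplacement_of_discrete (G : Subgroup SL(2, ℝ)) [DiscreteTopology G] :
    FiniteDisplacement G := by
  intro z R
  have h := ProperlyDiscontinuousSMul.finite_disjoint_inter_image (Γ := G) (T := ℍ)
    (K := {z}) (L := Metric.closedBall z R) isCompact_singleton (isCompact_closedBall z R)
  refine (h.image (fun γ : G => (γ : SL(2, ℝ)))).subset ?_
  rintro γ ⟨hγ, hd⟩
  refine ⟨⟨γ, hγ⟩, ?_, rfl⟩
  simp only [Set.mem_ofPred_eq, Set.image_singleton]
  exact ⟨γ • z, rfl, by rw [Metric.mem_closedBall, dist_comm]; exact hd⟩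

variable {G : Subgroup SL(2, ℝ)}

/-- Zassenhaus: the elements of a discrete group that are close to the identity, as seen from a
point, commute with each other. -/
theorem FiniteDisplacement.commute (hG : FiniteDisplacement G) {z : ℍ} {α β : SL(2, ℝ)}
    (hα : α ∈ G) (hβ : β ∈ G) (hα' : deviationAt z α ≤ 1 / 10) (hβ' : deviationAt z β ≤ 1 / 10) :
    α * β = β * α := by
  by_cases h1 : α = 1
  · simp [h1]
  set W : Set SL(2, ℝ) := {γ | γ ∈ G ∧ γ ≠ 1 ∧ deviationAt z γ ≤ 1 / 10} with hW
  have hWfin : W.Finite := (hG z 3).subset fun γ hγ => ⟨hγ.1, dist_le_of_deviationAt_le hγ.2.2⟩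
  -- Take a nontrivial element of least deviation. Its commutator with any thin `B` deviates less
  -- still, so it is trivial, and all thin elements lie in the centralizer of `A`, which is abelian.
  obtain ⟨A, hA, hmin⟩ := Set.exists_min_image W (deviationAt z) hWfin ⟨α, hα, h1, hα'⟩
  have hpos : 0 < deviationAt z A := by
    refine (deviationAt_nonneg z A).lt_of_ne fun h => hA.2.1 ?_
    have h2 := deviation_eq_zero_iff.mp h.symm
    have h3 : A = z.toSL2R * (z.toSL2R⁻¹ * A * z.toSL2R) * z.toSL2R⁻¹ := by group
    rw [h3, h2]; group
  have hcomm : ∀ B ∈ G, deviationAt z B ≤ 1 / 10 → A * B = B * A := by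
    intro B hB hB'
    have hle : deviationAt z (A * B * A⁻¹ * B⁻¹) ≤ 3 / 5 * deviationAt z A := by
      have := deviation_commutator_le hA.2.2 hB'
      unfold deviationAt
      convert this using 2
      group
    have hone : A * B * A⁻¹ * B⁻¹ = 1 := by
      by_contra hne
      have := hmin _ ⟨mul_mem (mul_mem (mul_mem hA.1 hB) (inv_mem hA.1)) (inv_mem hB), hne,
        by linarith [hA.2.2]⟩
      linarith
    calc A * B = (A * B * A⁻¹ * B⁻¹) * (B * A) := by group
      _ = B * A := by rw [hone, one_mul]
  refine commute_of_commute hA.2.1 ?_ (hcomm α hα hα') (hcomm β hβ hβ')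
  rintro rfl
  have h2 : deviationAt z (-1) = deviation (-1) := by
    unfold deviationAt; congr 1; simp
  have := hA.2.2
  rw [h2] at this
  linarith [deviation_neg_one]

/-- A point is `ε`-thick if no nontrivial element of `G` deviates there by less than `ε`. -/
def IsThick (G : Subgroup SL(2, ℝ)) (ε : ℝ) (z : ℍ) : Prop :=
  ∀ γ ∈ G, γ ≠ 1 → ε ≤ deviationAt z γ

/-- Seen from `z`, the elements in question are matrices in a ball of radius independent of `z`.
Thickness forbids two of them in the same small ball, since `M⁻¹ M'` would deviate by less than `ε`.
A finite cover gives a bound uniform in `z`. -/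
theorem exists_card_le_of_isThick (G : Subgroup SL(2, ℝ)) {ε : ℝ} (hε : 0 < ε) (R : ℝ) :
    ∃ N : ℕ, ∀ z : ℍ, IsThick G ε z → ∀ s : Finset SL(2, ℝ),
      (∀ γ ∈ s, γ ∈ G ∧ dist z (γ • z) ≤ R) → s.card ≤ N := by
  classical
  set ρ : ℝ := 2 * Real.cosh R + 2 with hρ
  have hρ1 : 2 ≤ ρ := by
    have := Real.cosh_pos R
    linarith
  have : ProperSpace (Matrix (Fin 2) (Fin 2) ℝ) := FiniteDimensional.proper_real _
  obtain ⟨t, -, htfin, ht⟩ := (isCompact_closedBall (0 : Matrix (Fin 2) (Fin 2) ℝ) ρ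
    ).finite_cover_balls (e := ε / (2 * ρ)) (by positivity)
  refine ⟨htfin.toFinset.card, fun z hz s hs => ?_⟩
  set M : SL(2, ℝ) → SL(2, ℝ) := fun γ => z.toSL2R⁻¹ * γ * z.toSL2R with hM
  have hnorm : ∀ γ ∈ s, ‖((M γ : SL(2, ℝ)) : Matrix (Fin 2) (Fin 2) ℝ)‖ ≤ ρ := by
    intro γ hγ
    have h1 := (hs γ hγ).2
    have h2 : displacement (M γ) ≤ 2 * Real.cosh R :=
      displacement_le_of_dist_le (by rw [toSL2R_smul_I]; exact h1)
    have h3 := norm_sq_eq_displacement_add_two (M γ)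
    nlinarith [norm_nonneg ((M γ : SL(2, ℝ)) : Matrix (Fin 2) (Fin 2) ℝ)]
  have hcen : ∀ γ ∈ s, ∃ x ∈ t, dist ((M γ : SL(2, ℝ)) : Matrix (Fin 2) (Fin 2) ℝ) x <
      ε / (2 * ρ) := by
    intro γ hγ
    have := ht (show ((M γ : SL(2, ℝ)) : Matrix (Fin 2) (Fin 2) ℝ) ∈ Metric.closedBall 0 ρ by
      rw [mem_closedBall_zero_iff]; exact hnorm γ hγ)
    simpa using this
  choose! c hc hcd using hcen
  refine Finset.card_le_card_of_injOn c (fun γ hγ => by simpa using hc γ hγ) ?_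
  intro γ hγ γ' hγ' heq
  by_contra hne
  have h1 : γ⁻¹ * γ' ≠ 1 := fun h => hne (inv_mul_eq_one.mp h)
  have h2 := hz _ (mul_mem (inv_mem (hs γ hγ).1) (hs γ' hγ').1) h1
  have h3 : dist ((M γ' : SL(2, ℝ)) : Matrix (Fin 2) (Fin 2) ℝ) (M γ).1 < ε / ρ := by
    have e1 := hcd γ hγ
    have e2 := hcd γ' hγ'
    rw [← heq] at e2
    calc _ ≤ _ := dist_triangle_right _ _ (c γ)
      _ < ε / (2 * ρ) + ε / (2 * ρ) := add_lt_add e2 e1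
      _ = ε / ρ := by field_simp; norm_num
  have h4 : deviationAt z (γ⁻¹ * γ') ≤ ρ * dist (M γ').1 (M γ).1 := by
    have e1 : z.toSL2R⁻¹ * (γ⁻¹ * γ') * z.toSL2R = (M γ)⁻¹ * M γ' := by
      simp only [hM]; group
    unfold deviationAt deviation
    rw [e1, dist_eq_norm]
    have e2 : (((M γ)⁻¹ * M γ' : SL(2, ℝ)) : Matrix (Fin 2) (Fin 2) ℝ) - 1 =
        ((M γ)⁻¹).1 * ((M γ').1 - (M γ).1) := by
      rw [mul_sub, ← Matrix.SpecialLinearGroup.coe_mul, ← Matrix.SpecialLinearGroup.coe_mul,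
        inv_mul_cancel, Matrix.SpecialLinearGroup.coe_one]
    rw [e2]
    refine (norm_mul_le _ _).trans ?_
    gcongr
    rw [norm_inv_eq_norm]
    exact hnorm γ hγ
  have h5 : ρ * dist (M γ').1 (M γ).1 < ε := by
    calc _ < ρ * (ε / ρ) := by gcongr
      _ = ε := by field_simp
  linarith

instance : SMulInvariantMeasure SL(2, ℝ) ℍ volume :=
  ⟨fun c s hs => by
    have := measure_preimage_smul_of_nullMeasurableSet (μ := (volume : Measure ℍ))
      hs.nullMeasurableSet (c : GL (Fin 2) ℝ)
    exact this⟩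

theorem FiniteDisplacement.countable (hG : FiniteDisplacement G) : Countable G := by
  have : (G : Set SL(2, ℝ)).Countable := by
    refine (Set.countable_iUnion fun n : ℕ => (hG UpperHalfPlane.I n).countable).mono ?_
    intro γ hγ
    obtain ⟨n, hn⟩ := exists_nat_ge (dist UpperHalfPlane.I (γ • UpperHalfPlane.I))
    exact Set.mem_iUnion.mpr ⟨n, hγ, hn⟩
  exact this.to_subtype

theorem volume_ball_eq (z : ℍ) (r : ℝ) :
    volume (Metric.ball z r) = volume (Metric.ball UpperHalfPlane.I r) := by
  have h : Metric.ball UpperHalfPlane.I r = (fun w => z.toSL2R • w) ⁻¹' Metric.ball z r := by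
    ext w
    simp only [Set.mem_preimage, Metric.mem_ball]
    rw [← dist_smul z.toSL2R w UpperHalfPlane.I, toSL2R_smul_I]
  rw [h, measure_preimage_smul]

theorem volume_ball_pos (z : ℍ) {r : ℝ} (hr : 0 < r) : 0 < volume (Metric.ball z r) := by
  rw [UpperHalfPlane.volume_eq_lintegral, setLIntegral_pos_iff (by fun_prop)]
  have hopen : IsOpen (UpperHalfPlane.coe '' Metric.ball z r) :=
    isOpenEmbedding_coe.isOpenMap _ Metric.isOpen_ball
  refine (hopen.measure_pos volume ⟨z, z, Metric.mem_ball_self hr, rfl⟩).trans_le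
    (measure_mono ?_)
  rintro _ ⟨w, hw, rfl⟩
  refine ⟨?_, w, hw, rfl⟩
  have := w.im_ne_zero
  simp [this]

/-- Packing: thick points with `1`-separated orbits are bounded in number by the covolume. -/
theorem FiniteDisplacement.card_mul_volume_le (hG : FiniteDisplacement G) {F : Set ℍ}
    (hF : ∀ z : ℍ, ∃ γ ∈ G, γ • z ∈ F) {N : ℕ} {S : Finset ℍ}
    (hN : ∀ z ∈ S, ∀ s : Finset SL(2, ℝ), (∀ γ ∈ s, γ ∈ G ∧ dist z (γ • z) ≤ 1) → s.card ≤ N)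
    (hS : ∀ z ∈ S, ∀ w ∈ S, z ≠ w → ∀ γ ∈ G, 1 ≤ dist (γ • z) w) :
    S.card * volume (Metric.ball UpperHalfPlane.I (1 / 2)) ≤ N * volume F := by
  classical
  have := hG.countable
  set B : S → Set ℍ := fun z => Metric.ball (z : ℍ) (1 / 2) with hB
  set A : S × G → Set ℍ := fun p => (fun w => (p.2⁻¹ : G) • w) ⁻¹' B p.1 with hA
  have hAm : ∀ p, MeasurableSet (A p) := fun p =>
    (continuous_const_smul ((p.2⁻¹ : G) : SL(2, ℝ))).measurable Metric.isOpen_ball.measurableSet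
  -- The translates of `F` cover each half-ball; invariance of the area moves the pieces into `F`.
  have h1 : ∀ z : S, volume (B z) ≤ ∑' γ : G, volume (A (z, γ) ∩ F) := by
    intro z
    have hsub : B z ⊆ ⋃ γ : G, (B z ∩ (fun w => (γ : SL(2, ℝ)) • w) ⁻¹' F) := by
      intro w hw
      obtain ⟨γ, hγ, hγF⟩ := hF w
      exact Set.mem_iUnion.mpr ⟨⟨γ, hγ⟩, hw, hγF⟩
    refine (measure_mono hsub).trans ((measure_iUnion_le _).trans (le_of_eq ?_))
    refine tsum_congr fun γ => ?_
    rw [← measure_preimage_smul (μ := (volume : Measure ℍ)) ((γ⁻¹ : G) : SL(2, ℝ))]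
    congr 1
    ext w
    simp [A]
    intro _
    rfl
  -- If two translated half-balls contain `w`, their centres are less than `1` apart, so separation
  -- forces a common `z`. The group elements then differ by one moving `z` by less than `1`, and
  -- there are at most `N` of those.
  have h2 : ∀ w : ℍ, ∑' p : S × G, (A p).indicator (fun _ => (1 : ENNReal)) w ≤ N := by
    intro w
    rw [ENNReal.tsum_eq_iSup_sum]
    refine iSup_le fun s => ?_
    simp only [Set.indicator_apply, Finset.sum_ite, Finset.sum_const,
      nsmul_eq_mul, mul_one]
    norm_cast
    set s' := s.filter fun p => w ∈ A p with hs'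
    rcases s'.eq_empty_or_nonempty with h | ⟨p₀, hp₀⟩
    · rw [h]; simp
    have hmem : ∀ p ∈ s', dist ((p.2⁻¹ : G) • w) (p.1 : ℍ) < 1 / 2 := fun p hp =>
      (Finset.mem_filter.mp hp).2
    have hd : ∀ p ∈ s', dist (((p.2⁻¹ * p₀.2 : G) : SL(2, ℝ)) • (p₀.1 : ℍ)) p.1 < 1 := by
      intro p hp
      have e1 := hmem p hp
      have e2 := hmem p₀ hp₀
      have e3 : dist (((p.2⁻¹ * p₀.2 : G) : SL(2, ℝ)) • (p₀.1 : ℍ)) ((p.2⁻¹ : G) • w) =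
          dist ((p₀.2⁻¹ : G) • w) (p₀.1 : ℍ) := by
        rw [dist_comm, ← dist_smul ((p.2⁻¹ * p₀.2 : G) : SL(2, ℝ)) ((p₀.2⁻¹ : G) • w)]
        congr 1
        simp only [Subgroup.smul_def, ← mul_smul]
        simp
      calc _ ≤ _ := dist_triangle _ ((p.2⁻¹ : G) • w) _
        _ < 1 / 2 + 1 / 2 := by rw [e3]; exact add_lt_add e2 e1
        _ = 1 := by norm_num
    have hfst : ∀ p ∈ s', p.1 = p₀.1 := by
      intro p hp
      by_contra hne
      have := hS p₀.1 p₀.1.2 p.1 p.1.2 (fun h => hne (Subtype.ext h.symm)) _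
        (p.2⁻¹ * p₀.2).2
      linarith [hd p hp]
    have hinj : Set.InjOn (fun p : S × G => ((p.2⁻¹ * p₀.2 : G) : SL(2, ℝ))) s' := by
      intro p hp q hq h
      refine Prod.ext ((hfst p hp).trans (hfst q hq).symm) ?_
      simpa using h
    rw [← Finset.card_image_of_injOn hinj]
    refine hN p₀.1 p₀.1.2 _ ?_
    intro γ hγ
    obtain ⟨p, hp, rfl⟩ := Finset.mem_image.mp hγ
    refine ⟨(p.2⁻¹ * p₀.2).2, ?_⟩
    have := hd p hp
    rw [hfst p hp] at this
    rw [dist_comm]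
    exact this.le
  calc S.card * volume (Metric.ball UpperHalfPlane.I (1 / 2))
      = ∑ z : S, volume (B z) := by
        simp only [hB, volume_ball_eq]
        simp
    _ ≤ ∑ z : S, ∑' γ : G, volume (A (z, γ) ∩ F) := Finset.sum_le_sum fun z _ => h1 z
    _ = ∑' p : S × G, volume (A p ∩ F) := by
        rw [ENNReal.tsum_prod', tsum_fintype]
    _ = ∑' p : S × G, ∫⁻ w in F, (A p).indicator (fun _ => (1 : ENNReal)) w := by
        refine tsum_congr fun p => ?_
        rw [lintegral_indicator_const (hAm p), one_mul, Measure.restrict_apply (hAm p)]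
    _ = ∫⁻ w in F, ∑' p : S × G, (A p).indicator (fun _ => (1 : ENNReal)) w := by
        rw [lintegral_tsum]
        exact fun p => (measurable_const.indicator (hAm p)).aemeasurable
    _ ≤ ∫⁻ w in F, (N : ENNReal) := lintegral_mono h2
    _ = N * volume F := by rw [setLIntegral_const]

/-- The thick part of a finite-area quotient is covered by finitely many unit balls. -/
theorem FiniteDisplacement.exists_finset_isThick (hG : FiniteDisplacement G) {F : Set ℍ}
    (hFfin : volume F < ⊤) (hF : ∀ z : ℍ, ∃ γ ∈ G, γ • z ∈ F)
    {ε : ℝ} (hε : 0 < ε) :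
    ∃ T : Finset ℍ, ∀ z, IsThick G ε z → ∃ t ∈ T, ∃ γ ∈ G, dist (γ • z) t < 1 := by
  classical
  obtain ⟨N, hN⟩ := exists_card_le_of_isThick G hε 1
  set v := volume (Metric.ball UpperHalfPlane.I (1 / 2)) with hv
  have hv0 : v ≠ 0 := (volume_ball_pos _ (by norm_num)).ne'
  obtain ⟨C, hC⟩ : ∃ C : ℕ, (N * volume F) / v ≤ C := by
    have : (N * volume F) / v < ⊤ :=
      ENNReal.div_lt_top (ENNReal.mul_ne_top (by simp) hFfin.ne) hv0
    obtain ⟨C, hC⟩ := ENNReal.exists_nat_gt this.ne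
    exact ⟨C, hC.le⟩
  set P : Set (Finset ℍ) := {S | (∀ z ∈ S, IsThick G ε z) ∧
    ∀ z ∈ S, ∀ w ∈ S, z ≠ w → ∀ γ ∈ G, 1 ≤ dist (γ • z) w} with hP
  have hbd : ∀ S ∈ P, S.card ≤ C := by
    intro S hS
    have h1 := hG.card_mul_volume_le hF (N := N) (fun z hz => hN z (hS.1 z hz)) hS.2
    have h2 : (S.card : ENNReal) ≤ C := by
      refine le_trans ?_ hC
      rw [ENNReal.le_div_iff_mul_le (Or.inl hv0) (Or.inl ?_)]
      · exact h1
      · exact (Metric.isBounded_ball.measure_lt_top).ne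
    exact_mod_cast h2
  -- A separated set of thick points of the largest possible size: a thick point not within distance
  -- `1` of its orbits could be added to it.
  obtain ⟨T, hTP, hTmax⟩ : ∃ T ∈ P, ∀ S ∈ P, S.card ≤ T.card := by
    have hfin : (Finset.card '' P).Finite :=
      (Set.finite_Iic C).subset (by rintro _ ⟨S, hS, rfl⟩; exact hbd S hS)
    obtain ⟨_, ⟨T, hT, rfl⟩, hmax⟩ := Set.exists_max_image _ id hfin
      ⟨_, ∅, by simp [hP], rfl⟩
    exact ⟨T, hT, fun S hS => hmax _ ⟨S, hS, rfl⟩⟩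
  refine ⟨T, fun z hz => ?_⟩
  by_contra! hcon
  have hzT : z ∉ T := fun h => by
    have := hcon z h 1 (one_mem G)
    rw [one_smul, dist_self] at this
    linarith
  have : insert z T ∈ P := by
    refine ⟨?_, ?_⟩
    · intro w hw
      rcases Finset.mem_insert.mp hw with rfl | hw
      · exact hz
      · exact hTP.1 w hw
    · intro x hx y hy hxy γ hγ
      rcases Finset.mem_insert.mp hx with rfl | hx'
      · rcases Finset.mem_insert.mp hy with rfl | hy
        · exact absurd rfl hxy
        · exact hcon y hy γ hγ
      · rcases Finset.mem_insert.mp hy with h | hy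
        · subst h
          have := hcon x hx' γ⁻¹ (inv_mem hγ)
          rwa [← dist_smul γ, smul_inv_smul, dist_comm] at this
        · exact hTP.2 x hx' y hy hxy γ hγ
  have := hTmax _ this
  rw [Finset.card_insert_of_notMem hzT] at this
  omega

end Thick

/-! ### Flowing from a thin point to a thick one along a geodesic. -/

section Escape

/-- The rotation with entries `c, -s; s, c`. -/
def rotation {c s : ℝ} (h : c ^ 2 + s ^ 2 = 1) : SL(2, ℝ) :=
  ⟨!![c, -s; s, c], by rw [Matrix.det_fin_two_of]; linarith⟩

/-- The diagonal matrix with entries `e^{t/2}, e^{-t/2}`. -/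
def geodesicFlow (t : ℝ) : SL(2, ℝ) :=
  ⟨!![Real.exp (t / 2), 0; 0, Real.exp (-(t / 2))], by
    rw [Matrix.det_fin_two_of, ← Real.exp_add]; simp⟩

theorem coe_rotation {c s : ℝ} (h : c ^ 2 + s ^ 2 = 1) :
    (rotation h : Matrix (Fin 2) (Fin 2) ℝ) = !![c, -s; s, c] := rfl

theorem coe_geodesicFlow (t : ℝ) : (geodesicFlow t : Matrix (Fin 2) (Fin 2) ℝ) =
    !![Real.exp (t / 2), 0; 0, Real.exp (-(t / 2))] := rfl

theorem rotation_smul_I {c s : ℝ} (h : c ^ 2 + s ^ 2 = 1) :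
    rotation h • UpperHalfPlane.I = UpperHalfPlane.I := by
  have h1 := cosh_dist_I_smul (rotation h)
  have h2 : displacement (rotation h) = 0 := by simp [displacement, rotation]
  rw [h2, zero_div, add_zero, ← Real.cosh_zero] at h1
  have h3 := Real.cosh_le_cosh.mp h1.le
  rw [abs_zero, abs_nonpos_iff, dist_eq_zero] at h3
  exact h3.symm

/-- A rotation fixes `i` and turns the vector `(M 0 0 - M 1 1, M 0 1 + M 1 0)` by twice its angle,
so the first coordinate can be made zero. -/
theorem conj_rotation {c s : ℝ} (h : c ^ 2 + s ^ 2 = 1) (M : SL(2, ℝ)) :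
    ((rotation h)⁻¹ * M * rotation h) 0 0 - ((rotation h)⁻¹ * M * rotation h) 1 1 =
      (M 0 0 - M 1 1) * (c ^ 2 - s ^ 2) + 2 * (M 0 1 + M 1 0) * (c * s) ∧
    ((rotation h)⁻¹ * M * rotation h) 0 1 =
      M 0 1 * c ^ 2 - M 1 0 * s ^ 2 - (M 0 0 - M 1 1) * (c * s) ∧
    ((rotation h)⁻¹ * M * rotation h) 1 0 =
      M 1 0 * c ^ 2 - M 0 1 * s ^ 2 - (M 0 0 - M 1 1) * (c * s) := by
  simp only [Matrix.SpecialLinearGroup.coe_mul, Matrix.SpecialLinearGroup.coe_inv, coe_rotation,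
    Matrix.adjugate_fin_two_of, Matrix.mul_apply, Fin.sum_univ_two]
  simp
  refine ⟨?_, ?_, ?_⟩ <;> ring

theorem conj_geodesicFlow (t : ℝ) (M : SL(2, ℝ)) :
    ((geodesicFlow t)⁻¹ * M * geodesicFlow t) 0 0 = M 0 0 ∧
    ((geodesicFlow t)⁻¹ * M * geodesicFlow t) 1 1 = M 1 1 ∧
    ((geodesicFlow t)⁻¹ * M * geodesicFlow t) 0 1 = M 0 1 * Real.exp (-t) ∧
    ((geodesicFlow t)⁻¹ * M * geodesicFlow t) 1 0 = M 1 0 * Real.exp t := by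
  have e1 : Real.exp (t / 2) * Real.exp (-(t / 2)) = 1 := by rw [← Real.exp_add]; simp
  have e2 : Real.exp (-t) = Real.exp (-(t / 2)) * Real.exp (-(t / 2)) := by
    rw [← Real.exp_add]; ring_nf
  have e3 : Real.exp t = Real.exp (t / 2) * Real.exp (t / 2) := by
    rw [← Real.exp_add]; ring_nf
  rw [e2, e3]
  simp only [Matrix.SpecialLinearGroup.coe_mul, Matrix.SpecialLinearGroup.coe_inv, coe_geodesicFlow,
    Matrix.adjugate_fin_two_of, Matrix.mul_apply, Fin.sum_univ_two]
  simp
  refine ⟨?_, ?_, ?_, ?_⟩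
  · linear_combination M 0 0 * e1
  · linear_combination M 1 1 * e1
  · ring
  · ring

/-- A frame at `z` amounts to a direction at `z`. This one points where the displacement of `A`
grows: along the flow it is `(M 0 1 e^{-t} + M 1 0 e^t)²`. -/
theorem exists_smul_I_eq_and_conj (z : ℍ) (A : SL(2, ℝ)) :
    ∃ h : SL(2, ℝ), h • UpperHalfPlane.I = z ∧ (h⁻¹ * A * h) 0 0 = (h⁻¹ * A * h) 1 1 ∧
      (h⁻¹ * A * h) 0 1 ^ 2 ≤ (h⁻¹ * A * h) 1 0 ^ 2 := by
  set M := z.toSL2R⁻¹ * A * z.toSL2R with hM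
  set u : ℂ := ⟨M 0 0 - M 1 1, M 0 1 + M 1 0⟩ with hu
  -- This angle turns `u` onto the imaginary axis, the rotation acting on `u` by the double angle.
  set θ := u.arg / 2 + Real.pi / 4 with hθ
  have hcs : Real.cos θ ^ 2 + Real.sin θ ^ 2 = 1 := Real.cos_sq_add_sin_sq θ
  set k := rotation hcs with hk
  set h := z.toSL2R * k with hh
  have hz : h • UpperHalfPlane.I = z := by
    rw [hh, mul_smul, hk, rotation_smul_I, toSL2R_smul_I]
  have hconj : h⁻¹ * A * h = k⁻¹ * M * k := by rw [hh, hM]; group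
  have hdiag : (h⁻¹ * A * h) 0 0 = (h⁻¹ * A * h) 1 1 := by
    rw [hconj, ← sub_eq_zero, hk, (conj_rotation hcs M).1]
    have e1 : Real.cos θ ^ 2 - Real.sin θ ^ 2 = -Real.sin u.arg := by
      rw [← Real.cos_two_mul', hθ, show 2 * (u.arg / 2 + Real.pi / 4) = u.arg + Real.pi / 2 by ring,
        Real.cos_add_pi_div_two]
    have e2 : 2 * (Real.cos θ * Real.sin θ) = Real.cos u.arg := by
      rw [show 2 * (Real.cos θ * Real.sin θ) = 2 * Real.sin θ * Real.cos θ by ring,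
        ← Real.sin_two_mul, hθ, show 2 * (u.arg / 2 + Real.pi / 4) = u.arg + Real.pi / 2 by ring,
        Real.sin_add_pi_div_two]
    have e3 : M 0 0 - M 1 1 = ‖u‖ * Real.cos u.arg := by
      rw [Complex.norm_mul_cos_arg]
    have e4 : M 0 1 + M 1 0 = ‖u‖ * Real.sin u.arg := by
      rw [Complex.norm_mul_sin_arg]
    rw [e1, e3, e4]
    linear_combination ‖u‖ * Real.sin u.arg * e2
  rcases le_total ((h⁻¹ * A * h) 0 1 ^ 2) ((h⁻¹ * A * h) 1 0 ^ 2) with hle | hle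
  · exact ⟨h, hz, hdiag, hle⟩
  -- A quarter turn exchanges the off-diagonal entries up to sign.
  · have h01 : (0 : ℝ) ^ 2 + 1 ^ 2 = 1 := by norm_num
    refine ⟨h * rotation h01, by rw [mul_smul, rotation_smul_I, hz], ?_⟩
    have hconj2 : (h * rotation h01)⁻¹ * A * (h * rotation h01) =
        (rotation h01)⁻¹ * (h⁻¹ * A * h) * rotation h01 := by group
    obtain ⟨c1, c2, c3⟩ := conj_rotation h01 (h⁻¹ * A * h)
    rw [hconj2, c2, c3]
    refine ⟨?_, by nlinarith⟩
    rw [← sub_eq_zero, c1, hdiag]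
    ring

theorem displacement_geodesicFlow (t : ℝ) {M : SL(2, ℝ)} (hM : M 0 0 = M 1 1) :
    displacement ((geodesicFlow t)⁻¹ * M * geodesicFlow t) =
      (M 0 1 * Real.exp (-t) + M 1 0 * Real.exp t) ^ 2 := by
  obtain ⟨h1, h2, h3, h4⟩ := conj_geodesicFlow t M
  rw [displacement, h1, h2, h3, h4, hM]
  ring

/-- In the expanded square the mixed term is constant, and for nonnegative times `e^{2t}` gains at
least what `e^{-2t}` loses. -/
theorem displacement_geodesicFlow_mono {M : SL(2, ℝ)} (hM : M 0 0 = M 1 1)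
    (hM' : M 0 1 ^ 2 ≤ M 1 0 ^ 2) {s t : ℝ} (hs : 0 ≤ s) (hst : s ≤ t) :
    displacement ((geodesicFlow s)⁻¹ * M * geodesicFlow s) ≤
      displacement ((geodesicFlow t)⁻¹ * M * geodesicFlow t) := by
  rw [displacement_geodesicFlow s hM, displacement_geodesicFlow t hM]
  have e1 : Real.exp (-s) * Real.exp s = 1 := by rw [← Real.exp_add]; simp
  have e2 : Real.exp (-t) * Real.exp t = 1 := by rw [← Real.exp_add]; simp
  have p1 := Real.exp_pos (-s)
  have p2 := Real.exp_pos (-t)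
  have l1 : Real.exp s ≤ Real.exp t := Real.exp_le_exp.mpr hst
  have l2 : Real.exp (-t) ≤ Real.exp (-s) := Real.exp_le_exp.mpr (by linarith)
  have l3 : 1 ≤ Real.exp s := Real.one_le_exp hs
  have l4 : Real.exp (-s) ≤ 1 := Real.exp_le_one_iff.mpr (by linarith)
  have k1 : Real.exp s ^ 2 ≤ Real.exp t ^ 2 := by gcongr
  have k3 : Real.exp (-s) ^ 2 - Real.exp (-t) ^ 2 ≤ Real.exp t ^ 2 - Real.exp s ^ 2 := by
    have : (Real.exp (-s) ^ 2 - Real.exp (-t) ^ 2) =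
        (Real.exp t ^ 2 - Real.exp s ^ 2) * (Real.exp (-s) ^ 2 * Real.exp (-t) ^ 2) := by
      linear_combination (-(Real.exp (-s) ^ 2) * (Real.exp (-t) * Real.exp t + 1)) * e2 +
        (Real.exp (-t) ^ 2 * (Real.exp (-s) * Real.exp s + 1)) * e1
    rw [this]
    have h1 : Real.exp (-s) ^ 2 * Real.exp (-t) ^ 2 ≤ 1 := by
      have : Real.exp (-t) ≤ 1 := l2.trans l4
      calc _ ≤ (1 : ℝ) ^ 2 * 1 ^ 2 := by gcongr
        _ = 1 := by norm_num
    nlinarith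
  have k4 : (0 : ℝ) ≤ Real.exp (-s) ^ 2 - Real.exp (-t) ^ 2 := by
    have : Real.exp (-t) ^ 2 ≤ Real.exp (-s) ^ 2 := by gcongr
    linarith
  have key : M 0 1 ^ 2 * (Real.exp (-s) ^ 2 - Real.exp (-t) ^ 2) ≤
      M 1 0 ^ 2 * (Real.exp t ^ 2 - Real.exp s ^ 2) := by
    gcongr
  have c1 : M 0 1 * M 1 0 * (Real.exp (-s) * Real.exp s) = M 0 1 * M 1 0 := by rw [e1, mul_one]
  have c2 : M 0 1 * M 1 0 * (Real.exp (-t) * Real.exp t) = M 0 1 * M 1 0 := by rw [e2, mul_one]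
  nlinarith

/-- From `|M 1 0| e^t - |M 0 1| e^{-t} ≥ 2 |M 1 0| sinh t`. Linear growth suffices to make every
nontrivial displacement reach the threshold and to bound the time this takes. -/
theorem mul_sq_le_displacement_geodesicFlow {M : SL(2, ℝ)} (hM : M 0 0 = M 1 1)
    (hM' : M 0 1 ^ 2 ≤ M 1 0 ^ 2) {t : ℝ} (ht : 0 ≤ t) :
    (2 * M 1 0 * t) ^ 2 ≤ displacement ((geodesicFlow t)⁻¹ * M * geodesicFlow t) := by
  rw [displacement_geodesicFlow t hM]
  have h1 : t ≤ Real.sinh t := Real.self_le_sinh_iff.mpr ht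
  rw [Real.sinh_eq] at h1
  have p2 := Real.exp_pos (-t)
  have habs : |M 0 1| ≤ |M 1 0| := sq_le_sq.mp hM'
  rw [sq_le_sq]
  calc |2 * M 1 0 * t| = |M 1 0| * (2 * t) := by
        rw [abs_mul, abs_mul, abs_of_nonneg ht]; simp; ring
    _ ≤ |M 1 0| * (Real.exp t - Real.exp (-t)) := by gcongr; linarith
    _ ≤ |M 1 0| * Real.exp t - |M 0 1| * Real.exp (-t) := by nlinarith
    _ = |M 1 0 * Real.exp t| - |M 0 1 * Real.exp (-t)| := by
        rw [abs_mul, abs_mul, abs_of_pos (Real.exp_pos _), abs_of_pos p2]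
    _ ≤ |M 0 1 * Real.exp (-t) + M 1 0 * Real.exp t| := by
        have := abs_sub_abs_le_abs_sub (M 1 0 * Real.exp t) (-(M 0 1 * Real.exp (-t)))
        rw [abs_neg, sub_neg_eq_add, add_comm (M 1 0 * Real.exp t)] at this
        exact this

theorem dist_geodesicFlow (h : SL(2, ℝ)) {t : ℝ} (ht : 0 ≤ t) :
    dist (h • UpperHalfPlane.I) ((h * geodesicFlow t) • UpperHalfPlane.I) = t := by
  rw [mul_smul, dist_smul]
  have h1 := cosh_dist_I_smul (geodesicFlow t)
  have h2 : 1 + displacement (geodesicFlow t) / 2 = Real.cosh t := by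
    have e1 : Real.exp (t / 2) * Real.exp (-(t / 2)) = 1 := by rw [← Real.exp_add]; simp
    have e2 : Real.exp (-t) = Real.exp (-(t / 2)) * Real.exp (-(t / 2)) := by
      rw [← Real.exp_add]; ring_nf
    have e3 : Real.exp t = Real.exp (t / 2) * Real.exp (t / 2) := by
      rw [← Real.exp_add]; ring_nf
    rw [Real.cosh_eq, e2, e3]
    simp [displacement, geodesicFlow]
    linear_combination -e1
  rw [h2] at h1
  have h3 := (Real.cosh_le_cosh.mp h1.le)
  have h4 := (Real.cosh_le_cosh.mp h1.ge)
  rw [abs_of_nonneg ht, abs_of_nonneg dist_nonneg] at h3 h4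
  exact le_antisymm h3 h4

variable {G : Subgroup SL(2, ℝ)}

theorem trace_pos_of_deviation {A : SL(2, ℝ)} (h : deviation A ≤ 1 / 10) :
    0 < A 0 0 + A 1 1 := by
  have h1 := deviation_sq A
  have h2 := displacement_nonneg A
  have h3 := deviation_nonneg A
  nlinarith

theorem ne_neg_one_of_deviationAt {z : ℍ} {A : SL(2, ℝ)} (h : deviationAt z A ≤ 1 / 10) :
    A ≠ -1 := by
  rintro rfl
  have := trace_pos_of_deviation h
  rw [trace_conj_fin_two] at this
  simp at this
  linarith

/-- A thin point of non-parabolic type lies within a controlled distance of a thick point. -/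
theorem FiniteDisplacement.exists_isThick_near (hG : FiniteDisplacement G) {ε : ℝ} (hε : 0 < ε)
    (hε' : ε ≤ 1 / 10) {z : ℍ} {A : SL(2, ℝ)} (hA : A ∈ G) (hA1 : A ≠ 1)
    (hAε : deviationAt z A < ε) (hAtr : A 0 0 + A 1 1 ≠ 2) :
    ∃ z', IsThick G ε z' ∧ ∃ B ∈ G, deviationAt z' B ≤ 1 / 10 ∧
      (B 0 0 + B 1 1) ^ 2 ≠ 4 ∧ dist z z' ^ 2 * |(B 0 0 + B 1 1) ^ 2 - 4| ≤ 1 := by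
  -- Starting from `z`, flow in the direction adapted to `A` until the last of the elements thin at
  -- `z` reaches the threshold `ε`.
  obtain ⟨h, rfl, hd, hle⟩ := exists_smul_I_eq_and_conj z A
  obtain ⟨C, hC⟩ : ∃ C : SL(2, ℝ) → SL(2, ℝ), ∀ γ, C γ = h⁻¹ * γ * h := ⟨_, fun _ => rfl⟩
  rw [← hC] at hd hle
  have hAneg := ne_neg_one_of_deviationAt (hAε.le.trans hε')
  have hCne : ∀ γ, γ ≠ 1 → γ ≠ -1 → C γ ≠ 1 ∧ C γ ≠ -1 := by
    intro γ h1 h2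
    refine ⟨fun e => h1 ?_, fun e => h2 ?_⟩
    · rw [show γ = h * C γ * h⁻¹ by simp only [hC]; group, e]; group
    · rw [show γ = h * C γ * h⁻¹ by simp only [hC]; group, e]; simp
  have hM10 : ∀ γ, γ ≠ 1 → γ ≠ -1 → (C γ) 0 0 = (C γ) 1 1 → (C γ) 0 1 ^ 2 ≤ (C γ) 1 0 ^ 2 →
      (C γ) 1 0 ≠ 0 := by
    intro γ h1 h2 h3 h4 h5
    have h6 : (C γ) 0 1 = 0 := by
      rw [h5] at h4; nlinarith
    rcases eq_one_or_eq_neg_one h6 h5 h3 with e | e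
    · exact (hCne γ h1 h2).1 e
    · exact (hCne γ h1 h2).2 e
  have hA10 := hM10 A hA1 hAneg hd hle
  -- Anything commuting with `A` has the same shape in this frame, with proportional off-diagonal
  -- entries, so the same flow increases its displacement.
  have hcommC : ∀ γ, A * γ = γ * A → (C γ) 0 0 = (C γ) 1 1 ∧
      (C A) 0 1 * (C γ) 1 0 = (C γ) 0 1 * (C A) 1 0 ∧ (C γ) 0 1 ^ 2 ≤ (C γ) 1 0 ^ 2 := by
    intro γ hγ
    have h1 : C A * C γ = C γ * C A := by
      simp only [hC]
      calc _ = h⁻¹ * (A * γ) * h := by group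
        _ = _ := by rw [hγ]; group
    obtain ⟨e1, e2, e3⟩ := commute_iff_fin_two.mp h1
    rw [hd, sub_self, mul_zero] at e3
    refine ⟨by linarith [(mul_eq_zero.mp e3).resolve_left hA10], e1, ?_⟩
    have h2 : (C A) 1 0 ^ 2 * (C γ) 0 1 ^ 2 ≤ (C A) 1 0 ^ 2 * (C γ) 1 0 ^ 2 := by
      calc _ = (C A) 0 1 ^ 2 * (C γ) 1 0 ^ 2 := by
            rw [← mul_pow, ← mul_pow, e1]; ring
        _ ≤ _ := by gcongr
    have h3 : 0 < (C A) 1 0 ^ 2 := by positivity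
    exact le_of_mul_le_mul_left h2 h3
  obtain ⟨D, hD⟩ : ∃ D : ℝ → SL(2, ℝ) → ℝ, ∀ t γ,
      D t γ = deviationAt ((h * geodesicFlow t) • UpperHalfPlane.I) γ := ⟨_, fun _ _ => rfl⟩
  have hDsq : ∀ t γ, D t γ ^ 2 =
      displacement ((geodesicFlow t)⁻¹ * C γ * geodesicFlow t) + 2 * (2 - (γ 0 0 + γ 1 1)) := by
    intro t γ
    have e : (h * geodesicFlow t)⁻¹ * γ * (h * geodesicFlow t) =
        (geodesicFlow t)⁻¹ * C γ * geodesicFlow t := by simp only [hC]; group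
    rw [hD, deviationAt_smul_I, e, deviation_sq, trace_conj_fin_two, hC, trace_conj_fin_two]
  have hD0 : ∀ t γ, 0 ≤ D t γ := fun t γ => by rw [hD]; exact deviationAt_nonneg _ _
  have hDzero : ∀ γ, D 0 γ = deviationAt (h • UpperHalfPlane.I) γ := by
    intro γ
    have : geodesicFlow 0 = 1 := by
      apply Subtype.ext
      simp [geodesicFlow, Matrix.one_fin_two]
    rw [hD, this, mul_one]
  have hDmono : ∀ γ, A * γ = γ * A → ∀ s t, 0 ≤ s → s ≤ t → D s γ ≤ D t γ := by
    intro γ hγ s t hs hst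
    obtain ⟨e1, -, e3⟩ := hcommC γ hγ
    refine le_of_sq_le_sq ?_ (hD0 t γ)
    rw [hDsq, hDsq]
    have := displacement_geodesicFlow_mono e1 e3 hs hst
    linarith
  set W : Set SL(2, ℝ) := {γ | γ ∈ G ∧ γ ≠ 1 ∧ D 0 γ < ε} with hW
  have hWfin : W.Finite := (hG (h • UpperHalfPlane.I) 3).subset fun γ hγ =>
    ⟨hγ.1, dist_le_of_deviationAt_le (((hDzero γ).symm.trans_le hγ.2.2.le).trans hε')⟩
  have hAW : A ∈ W := ⟨hA, hA1, by rw [hDzero]; exact hAε⟩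
  have hWcomm : ∀ γ ∈ W, A * γ = γ * A := fun γ hγ =>
    hG.commute hA hγ.1 (hAε.le.trans hε') (((hDzero γ).symm.trans_le hγ.2.2.le).trans hε')
  have hWne : ∀ γ ∈ W, γ ≠ -1 := fun γ hγ =>
    ne_neg_one_of_deviationAt (((hDzero γ).symm.trans_le hγ.2.2.le).trans hε')
  have hexit : ∀ γ ∈ W, ∃ t, 0 ≤ t ∧ D t γ = ε := by
    intro γ hγ
    obtain ⟨e1, -, e3⟩ := hcommC γ (hWcomm γ hγ)
    have h10 := hM10 γ hγ.2.1 (hWne γ hγ) e1 e3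
    have hcont : Continuous fun t => D t γ ^ 2 := by
      simp only [hDsq, displacement_geodesicFlow _ e1]
      fun_prop
    set K := |2 * (2 - (γ 0 0 + γ 1 1))| + ε ^ 2 with hK
    obtain ⟨t, ht0, ht⟩ : ∃ t, 0 ≤ t ∧ ε ^ 2 ≤ D t γ ^ 2 := by
      refine ⟨Real.sqrt K / |2 * (C γ) 1 0|, by positivity, ?_⟩
      rw [hDsq]
      have h1 := mul_sq_le_displacement_geodesicFlow e1 e3
        (t := Real.sqrt K / |2 * (C γ) 1 0|) (by positivity)
      have h2 : (2 * (C γ) 1 0 * (Real.sqrt K / |2 * (C γ) 1 0|)) ^ 2 = K := by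
        rw [mul_pow, div_pow, sq_abs, Real.sq_sqrt (by positivity)]
        field_simp
      rw [h2] at h1
      have := neg_abs_le (2 * (2 - (γ 0 0 + γ 1 1)))
      linarith
    obtain ⟨x, hx, hx2⟩ := intermediate_value_Icc ht0 hcont.continuousOn
      (show ε ^ 2 ∈ Set.Icc (D 0 γ ^ 2) (D t γ ^ 2) from
        ⟨by have := hγ.2.2; have := hD0 0 γ; gcongr, ht⟩)
    exact ⟨x, hx.1, (sq_eq_sq₀ (hD0 x γ) hε.le).mp hx2⟩
  choose! τ hτ0 hτ using hexit
  -- `B` is the last to reach the threshold; the new point is taken at its exit time.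
  obtain ⟨B, hBW, hmax⟩ := Set.exists_max_image W τ hWfin ⟨A, hAW⟩
  set T := τ B with hT
  have hT0 : 0 ≤ T := hτ0 B hBW
  have hBT : D T B = ε := hτ B hBW
  obtain ⟨b1, b2, b3⟩ := hcommC B (hWcomm B hBW)
  have hB10 := hM10 B hBW.2.1 (hWne B hBW) b1 b3
  have htr : ∀ γ, (C γ) 0 0 = (C γ) 1 1 →
      (γ 0 0 + γ 1 1) ^ 2 - 4 = 4 * ((C γ) 0 1 * (C γ) 1 0) := by
    intro γ hγ
    rw [← trace_conj_fin_two h γ]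
    have h1 := det_eq_one_fin_two (C γ)
    rw [← hC]
    rw [hγ] at h1 ⊢
    linear_combination 4 * h1
  refine ⟨(h * geodesicFlow T) • UpperHalfPlane.I, ?_, B, hBW.1,
    (hD T B).symm.trans_le (hBT.le.trans hε'), ?_, ?_⟩
  -- An element thin at the new point commutes with `B`, hence with `A`. By monotonicity it was thin
  -- at `z` and reached `ε` no later than `B`, a contradiction.
  · intro γ hγ hγ1
    by_contra! hlt
    have hBT' := (hD T B).symm.trans_le (hBT.le.trans hε')
    have hBγ : B * γ = γ * B := hG.commute hBW.1 hγ hBT' (hlt.le.trans hε')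
    have hAγ : A * γ = γ * A :=
      commute_of_commute hBW.2.1 (hWne B hBW) (hWcomm B hBW).symm hBγ
    have hγW : γ ∈ W := ⟨hγ, hγ1, (hDmono γ hAγ 0 T le_rfl hT0).trans_lt
      ((hD T γ).trans_lt hlt)⟩
    have h1 := hDmono γ hAγ (τ γ) T (hτ0 γ hγW) (hmax γ hγW)
    rw [hτ γ hγW] at h1
    exact absurd hlt (not_lt.mpr (h1.trans_eq (hD T γ)))
  -- If `B` had trace `±2`, its upper off-diagonal entry would vanish. By proportionality that of
  -- `A` would too, and `A` would have trace `2`.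
  · intro h4
    have h5 := htr B b1
    rw [h4, sub_self] at h5
    have h6 : (C B) 0 1 = 0 := by
      rcases mul_eq_zero.mp ((mul_eq_zero.mp h5.symm).resolve_left (by norm_num)) with e | e
      · exact e
      · exact absurd e hB10
    have h7 : (C A) 0 1 = 0 := by
      rw [h6, zero_mul] at b2
      exact (mul_eq_zero.mp b2).resolve_right hB10
    have h8 := htr A hd
    rw [h7, zero_mul, mul_zero] at h8
    have h9 : 0 < A 0 0 + A 1 1 := by
      have := trace_pos_of_deviation (hAε.le.trans hε')
      rwa [trace_conj_fin_two] at this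
    apply hAtr
    nlinarith
  -- Since `tr² - 4 = 4 (M 0 1)(M 1 0)` has absolute value at most `4 (M 1 0)²`, the linear lower
  -- bound for the displacement, itself at most `1`, controls the exit time.
  · rw [dist_geodesicFlow h hT0, htr B b1]
    have h1 := mul_sq_le_displacement_geodesicFlow b1 b3 hT0
    have h2 : displacement ((geodesicFlow T)⁻¹ * C B * geodesicFlow T) ≤ 1 := by
      have e : (h * geodesicFlow T)⁻¹ * B * (h * geodesicFlow T) =
        (geodesicFlow T)⁻¹ * C B * geodesicFlow T := by simp only [hC]; group
      rw [← e]
      apply displacement_le_of_deviation_le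
      rw [← deviationAt_smul_I]
      exact (hD T B).symm.trans_le (hBT.le.trans hε')
    have h3 : |(C B) 0 1| ≤ |(C B) 1 0| := sq_le_sq.mp b3
    rw [abs_mul, abs_mul]
    have h4 : |(C B) 0 1| * |(C B) 1 0| ≤ (C B) 1 0 ^ 2 := by
      rw [← sq_abs ((C B) 1 0)]
      nlinarith [abs_nonneg ((C B) 1 0)]
    have h5 : |(4 : ℝ)| = 4 := by norm_num
    rw [h5]
    nlinarith [sq_nonneg T]

/-- Every point of `ℍ` is, up to `G`, within a bounded distance of a finite set, or else it is
moved very little by a parabolic element of `G`. -/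
theorem FiniteDisplacement.exists_finset_or_parabolic (hG : FiniteDisplacement G) {F : Set ℍ}
    (hFfin : MeasureTheory.volume F < ⊤) (hF : ∀ z : ℍ, ∃ γ ∈ G, γ • z ∈ F)
    {ε : ℝ} (hε : 0 < ε) (hε' : ε ≤ 1 / 10) :
    ∃ (T : Finset ℍ) (R : ℝ), ∀ z : ℍ, (∃ t ∈ T, ∃ γ ∈ G, dist (γ • z) t ≤ R) ∨
      ∃ A ∈ G, A ≠ 1 ∧ A 0 0 + A 1 1 = 2 ∧ deviationAt z A < ε := by
  obtain ⟨T, hT⟩ := hG.exists_finset_isThick hFfin hF hε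
  -- The `5` is `1 + 3 + 1`: a conjugate of the last thin element moves some `t ∈ T` by at most
  -- that. Only finitely many elements, hence traces, occur, which bounds the distance to the thick
  -- part.
  set E : Set SL(2, ℝ) := ⋃ t ∈ T, {γ | γ ∈ G ∧ dist t (γ • t) ≤ 5} with hE
  have hEfin : E.Finite := Set.Finite.biUnion T.finite_toSet fun t _ => hG t 5
  obtain ⟨R, hR⟩ := (hEfin.image fun γ : SL(2, ℝ) =>
    Real.sqrt (1 / |(γ 0 0 + γ 1 1) ^ 2 - 4|)).bddAbove
  refine ⟨T, max R 0 + 1, fun z => ?_⟩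
  by_cases hz : IsThick G ε z
  · obtain ⟨t, ht, γ, hγ, hd⟩ := hT z hz
    exact Or.inl ⟨t, ht, γ, hγ, by linarith [le_max_right R 0]⟩
  · simp only [IsThick, not_forall, not_le] at hz
    obtain ⟨A, hA, hA1, hAε⟩ := hz
    by_cases htr : A 0 0 + A 1 1 = 2
    · exact Or.inr ⟨A, hA, hA1, htr, hAε⟩
    · left
      obtain ⟨z', hz', B, hB, hBd, hB4, hdist⟩ :=
        hG.exists_isThick_near hε hε' hA hA1 hAε htr
      obtain ⟨t, ht, γ, hγ, hd⟩ := hT z' hz'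
      refine ⟨t, ht, γ, hγ, ?_⟩
      have hBE : γ * B * γ⁻¹ ∈ E := by
        refine Set.mem_iUnion₂.mpr ⟨t, ht, mul_mem (mul_mem hγ hB) (inv_mem hγ), ?_⟩
        have e1 : dist ((γ * B * γ⁻¹) • γ • z') ((γ * B * γ⁻¹) • t) < 1 := by rwa [dist_smul]
        have e2 : (γ * B * γ⁻¹) • γ • z' = γ • B • z' := by
          simp only [← mul_smul]; congr 1; group
        have e3 := dist_le_of_deviationAt_le hBd
        rw [← dist_smul γ] at e3
        rw [e2] at e1
        have e5 := dist_comm t (γ • z')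
        have e7 := dist_triangle4 t (γ • z') (γ • B • z') ((γ * B * γ⁻¹) • t)
        linarith
      have h1 := hR ⟨_, hBE, rfl⟩
      have h2 : (γ * B * γ⁻¹) 0 0 + (γ * B * γ⁻¹) 1 1 = B 0 0 + B 1 1 := by
        have := trace_conj_fin_two γ⁻¹ B
        rwa [inv_inv] at this
      simp only [h2] at h1
      have h3 : dist z z' ≤ R := by
        refine le_trans ?_ h1
        apply Real.le_sqrt_of_sq_le
        have : 0 < |(B 0 0 + B 1 1) ^ 2 - 4| := abs_pos.mpr (sub_ne_zero.mpr hB4)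
        rwa [le_div_iff₀ this]
      have h4 := dist_triangle (γ • z) (γ • z') t
      rw [dist_smul] at h4
      linarith [le_max_left R 0]

end Escape

/-! ### Boundedness of `Im z |f z|` for cusp forms of weight two. -/

section Bounded

open scoped ModularForm Manifold Topology
open Filter

theorem exists_specialLinearGroup {g : GL (Fin 2) ℝ} (hg : g.val.det = 1) :
    ∃ s : SL(2, ℝ), (s : GL (Fin 2) ℝ) = g :=
  ⟨⟨g.val, hg⟩, Units.ext rfl⟩

theorem coe_smul_eq (s : SL(2, ℝ)) (z : ℍ) : (s : GL (Fin 2) ℝ) • z = s • z := rfl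

theorem dist_smul_smul_of_det_eq_one {g : GL (Fin 2) ℝ} (hg : g.val.det = 1) (z w : ℍ) :
    dist (g • z) (g • w) = dist z w := by
  obtain ⟨s, rfl⟩ := exists_specialLinearGroup hg
  rw [coe_smul_eq, coe_smul_eq, dist_smul]

theorem det_inv_eq_one {g : GL (Fin 2) ℝ} (hg : g.val.det = 1) : (g⁻¹).val.det = 1 := by
  have h : (g.det : ℝˣ) = 1 := Units.ext (by simpa using hg)
  rw [← GeneralLinearGroup.val_det_apply, map_inv, h]; simp

theorem det_mul_eq_one {g h : GL (Fin 2) ℝ} (hg : g.val.det = 1) (hh : h.val.det = 1) :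
    (g * h).val.det = 1 := by
  rw [Units.val_mul, Matrix.det_mul, hg, hh, one_mul]

/-- The preimage in `SL(2, ℝ)` of a subgroup of `GL(2, ℝ)`. -/
def slSubgroup (Γ : Subgroup (GL (Fin 2) ℝ)) : Subgroup SL(2, ℝ) :=
  Γ.comap Matrix.SpecialLinearGroup.toGL

theorem finiteDisplacement_slSubgroup (Γ : Subgroup (GL (Fin 2) ℝ)) [DiscreteTopology Γ] :
    FiniteDisplacement (slSubgroup Γ) := by
  have hcont : Continuous (Matrix.SpecialLinearGroup.toGL : SL(2, ℝ) → GL (Fin 2) ℝ) :=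
    Matrix.SpecialLinearGroup.continuous_toGL
  have : DiscreteTopology (slSubgroup Γ) := by
    refine DiscreteTopology.of_continuous_injective (β := Γ)
      (f := fun s : slSubgroup Γ => (⟨Matrix.SpecialLinearGroup.toGL s.1, s.2⟩ : Γ)) ?_ ?_
    · exact (hcont.comp continuous_subtype_val).subtype_mk _
    · intro s t h
      have h1 := congrArg (fun x : Γ => (x : GL (Fin 2) ℝ).val) h
      exact Subtype.ext (Subtype.ext h1)
  exact finiteDisplacement_of_discrete _

theorem cosh_dist_vadd (x : ℝ) (z : ℍ) :
    Real.cosh (dist z (x +ᵥ z)) = 1 + x ^ 2 / (2 * z.im ^ 2) := by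
  rw [UpperHalfPlane.cosh_dist]
  have h1 : dist (z : ℂ) ((x +ᵥ z : ℍ) : ℂ) ^ 2 = x ^ 2 := by
    rw [dist_comm, dist_eq_norm]; simp
  rw [h1, UpperHalfPlane.vadd_im]
  congr 2
  ring

theorem im_mul_norm_slash (f : ℍ → ℂ) {g : GL (Fin 2) ℝ} (hg : g.val.det = 1) (z : ℍ) :
    (g • z).im * ‖f (g • z)‖ = z.im * ‖(f ∣[(2 : ℤ)] g) z‖ := by
  rw [slash_two_apply f hg, im_smul_eq_div_normSq, GeneralLinearGroup.val_det_apply, hg,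
    Complex.normSq_eq_norm_sq]
  simp
  ring

theorem slash_two_neg (f : ℍ → ℂ) {g : GL (Fin 2) ℝ} (hg : g.val.det = 1) :
    f ∣[(2 : ℤ)] (-g) = f ∣[(2 : ℤ)] g := by
  ext z
  have hg' : (-g).val.det = 1 := by simpa [Matrix.det_neg] using hg
  rw [slash_two_apply f hg, slash_two_apply f hg', neg_smul, denom_neg, neg_sq]

/-- The unit translation of the cusp comes from `Γ` only up to sign, but in even weight the sign is
invisible. -/
theorem slash_periodic {Γ : Subgroup (GL (Fin 2) ℝ)} (f : CuspForm Γ 2)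
    {c : OnePoint ℝ} {σ : SL(2, ℝ)}
    (hσ : IsScalingMatrix Γ c σ) :
    Function.Periodic ((⇑f ∣[(2 : ℤ)] (σ : GL (Fin 2) ℝ)) ∘ ofComplex) (1 : ℝ) := by
  set s : GL (Fin 2) ℝ := (σ : GL (Fin 2) ℝ) with hs
  have hT : (⇑f ∣[(2 : ℤ)] s) ∣[(2 : ℤ)] (GeneralLinearGroup.upperRightHom (1 : ℝ)) =
      ⇑f ∣[(2 : ℤ)] s := by
    set τ := s * GeneralLinearGroup.upperRightHom ((1 : ℤ) : ℝ) * s⁻¹ with hτ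
    have hτdet : τ.val.det = 1 := by
      refine det_mul_eq_one (det_mul_eq_one (det_coe_eq_one σ) ?_)
        (det_inv_eq_one (det_coe_eq_one σ))
      simp
    obtain ⟨h1, -⟩ := (hσ.2 τ).mpr ⟨1, Or.inl rfl⟩
    have hf : ⇑f ∣[(2 : ℤ)] τ = f := by
      rcases h1 with h | h
      · exact SlashInvariantFormClass.slash_action_eq f τ h
      · rw [← slash_two_neg f hτdet]
        exact SlashInvariantFormClass.slash_action_eq f _ h
    conv_rhs => rw [← hf]
    rw [← SlashAction.slash_mul, ← SlashAction.slash_mul, hτ]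
    simp
  intro w
  by_cases hw : 0 < w.im
  · have h1 := congrFun hT ⟨w, hw⟩
    rw [slash_two_apply _ (by simp)] at h1
    simp only [Function.comp_apply]
    have h2 : (ofComplex (w + (1 : ℝ)) : ℍ) =
        GeneralLinearGroup.upperRightHom (1 : ℝ) • (⟨w, hw⟩ : ℍ) := by
      rw [upperRightHom_smul]
      ext
      rw [ofComplex_apply_of_im_pos (by simpa using hw)]
      simp [add_comm]
    rw [h2, ofComplex_apply_of_im_pos hw, ← h1]
    simp [denom]
  -- Off the half-plane `ofComplex` is constant, so periodicity is trivial there.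
  · have hw' : ¬ 0 < (w + (1 : ℝ)).im := by simpa using hw
    simp only [Function.comp_apply]
    rw [ofComplex_apply_of_im_nonpos (not_lt.mp hw), ofComplex_apply_of_im_nonpos (not_lt.mp hw')]

/-- A periodic holomorphic function vanishing at `i∞` decays like `e^{-2π Im w}`, which beats the
factor `Im w`. -/
theorem exists_im_mul_norm_slash_le {Γ : Subgroup (GL (Fin 2) ℝ)} (f : CuspForm Γ 2)
    {c : OnePoint ℝ} {σ : SL(2, ℝ)}
    (hc : IsCusp c Γ) (hσ : IsScalingMatrix Γ c σ) :
    ∃ C Y : ℝ, ∀ w : ℍ, Y ≤ w.im → w.im * ‖(⇑f ∣[(2 : ℤ)] (σ : GL (Fin 2) ℝ)) w‖ ≤ C := by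
  have h0 : IsZeroAtImInfty (⇑f ∣[(2 : ℤ)] (σ : GL (Fin 2) ℝ)) :=
    CuspFormClass.zero_at_cusps f hc _ hσ.1
  have hdec := h0.exp_decay_atImInfty (h := 1) one_pos (slash_periodic f hσ)
    (MDifferentiable.slash (CuspFormClass.holo f) 2 _) (h0.isBoundedAtImInfty)
  obtain ⟨C, hC0, hC⟩ := hdec.exists_nonneg
  rw [Asymptotics.isBigOWith_iff] at hC
  obtain ⟨Y, hY⟩ := (UpperHalfPlane.atImInfty_mem _).mp hC
  refine ⟨C, Y, fun w hw => ?_⟩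
  have h1 := hY w hw
  have h1' : ‖(⇑f ∣[(2 : ℤ)] (σ : GL (Fin 2) ℝ)) w‖ ≤
    C * ‖Real.exp (-2 * Real.pi * w.im / 1)‖ := h1
  rw [Real.norm_of_nonneg (Real.exp_pos _).le] at h1'
  have h2 : w.im * Real.exp (-2 * Real.pi * w.im / 1) ≤ 1 := by
    have hp := w.im_pos
    have h3 : w.im ≤ Real.exp (2 * Real.pi * w.im) := by
      have := Real.add_one_le_exp (2 * Real.pi * w.im)
      nlinarith [Real.pi_gt_three]
    rw [show -2 * Real.pi * w.im / 1 = -(2 * Real.pi * w.im) by ring, Real.exp_neg]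
    rw [← div_eq_mul_inv, div_le_one (Real.exp_pos _)]
    exact h3
  have hp := w.im_pos
  calc _ ≤ w.im * (C * Real.exp (-2 * Real.pi * w.im / 1)) := by gcongr
    _ = C * (w.im * Real.exp (-2 * Real.pi * w.im / 1)) := by ring
    _ ≤ C * 1 := by gcongr
    _ = C := mul_one C

variable {Γ : Subgroup (GL (Fin 2) ℝ)} [Γ.HasDetOne]

/-- A point hardly moved by a parabolic element lies high up in a cusp. -/
theorem exists_im_gt_of_parabolic {r : ℕ} {a : Fin r → OnePoint ℝ}
    (ha : IsCuspRepresentatives Γ a) {σ : Fin r → SL(2, ℝ)}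
    (hσ : ∀ i, IsScalingMatrix Γ (a i) (σ i)) {ε : ℝ} (hε : 0 < ε) {z : ℍ} {A : SL(2, ℝ)}
    (hA : A ∈ slSubgroup Γ) (hA1 : A ≠ 1) (hAtr : A 0 0 + A 1 1 = 2)
    (hAε : deviationAt z A < ε) :
    ∃ i, ∃ γ ∈ Γ, 1 / ε < (((σ i : GL (Fin 2) ℝ)⁻¹ * γ) • z).im := by
  have hpar : (A : GL (Fin 2) ℝ).IsParabolic := by
    refine ⟨?_, ?_⟩
    · rintro ⟨x, hx⟩
      have e00 := congrFun₂ hx 0 0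
      have e01 := congrFun₂ hx 0 1
      have e10 := congrFun₂ hx 1 0
      have e11 := congrFun₂ hx 1 1
      simp at e00 e01 e10 e11
      apply hA1
      ext i j
      fin_cases i <;> fin_cases j <;> simp <;> linarith
    · rw [Matrix.discr_fin_two, Matrix.trace_fin_two]
      have h1 := det_coe_eq_one A
      rw [h1]
      change (A 0 0 + A 1 1) ^ 2 - 4 * 1 = 0
      rw [hAtr]; norm_num
  set c := (A : GL (Fin 2) ℝ).parabolicFixedPoint with hc
  have hfix : (A : GL (Fin 2) ℝ) • c = c := hpar.smul_eq_self_iff.mpr hc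
  obtain ⟨i, ⟨γ, hγ, hγc⟩, -⟩ := ha.2 c ⟨_, hA, hpar, hfix⟩
  refine ⟨i, γ⁻¹, inv_mem hγ, ?_⟩
  have hfix' : (γ⁻¹ * (A : GL (Fin 2) ℝ) * γ) • a i = a i := by
    rw [mul_smul, mul_smul, hγc, hfix, ← hγc, inv_smul_smul]
  obtain ⟨k, hk⟩ := (hσ i).exists_smul_eq (mul_mem (mul_mem (inv_mem hγ) hA) hγ) hfix'
  set w : ℍ := ((σ i : GL (Fin 2) ℝ)⁻¹ * γ⁻¹) • z with hw
  have hdist : dist z (A • z) = dist w ((k : ℝ) +ᵥ w) := by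
    have h1 : A • z = (γ * (σ i : GL (Fin 2) ℝ)) • ((k : ℝ) +ᵥ w) := by
      have := hk (γ⁻¹ • z)
      rw [hw, mul_smul, mul_smul, ← this]
      simp only [← mul_smul, ← coe_smul_eq]
      congr 1
      group
    have h2 : z = (γ * (σ i : GL (Fin 2) ℝ)) • w := by
      rw [hw, ← mul_smul]
      simp
    conv_lhs => rw [h1]
    conv_lhs => enter [1]; rw [h2]
    exact dist_smul_smul_of_det_eq_one
      (det_mul_eq_one (det_eq_one_of_mem hγ) (det_coe_eq_one _)) _ _
  -- With trace `2` the deviation equals `|k| / Im w`. Once `k ≠ 0` is known, small deviation means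
  -- great height.
  have hdev : deviationAt z A ^ 2 = (k : ℝ) ^ 2 / w.im ^ 2 := by
    rw [deviationAt_sq, hdist, cosh_dist_vadd, hAtr]
    have := w.im_ne_zero
    field_simp
    ring
  have hk0 : k ≠ 0 := by
    rintro rfl
    simp only [Int.cast_zero, ne_eq, OfNat.ofNat_ne_zero, not_false_eq_true, zero_pow, zero_div,
      pow_eq_zero_iff] at hdev
    have h2 := deviation_eq_zero_iff.mp hdev
    apply hA1
    rw [show A = z.toSL2R * (z.toSL2R⁻¹ * A * z.toSL2R) * z.toSL2R⁻¹ by group, h2]; group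
  have hk1 : (1 : ℝ) ≤ (k : ℝ) ^ 2 := by
    have : 1 ≤ k ^ 2 := by
      have := sq_nonneg k
      have h3 : k ^ 2 ≠ 0 := pow_ne_zero 2 hk0
      omega
    exact_mod_cast this
  have hwp := w.im_pos
  have h3 : 1 / w.im ^ 2 < ε ^ 2 := by
    calc 1 / w.im ^ 2 ≤ (k : ℝ) ^ 2 / w.im ^ 2 := by gcongr
      _ = deviationAt z A ^ 2 := hdev.symm
      _ < ε ^ 2 := by
        have := deviationAt_nonneg z A
        gcongr
  rw [div_lt_iff₀ (by positivity), ← mul_pow] at h3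
  rw [div_lt_iff₀ hε]
  have := (one_lt_sq_iff₀ (by positivity)).mp h3
  linarith

/-- For a cusp form `f` of weight two on a group of finite covolume, `Im z |f z|` is bounded. -/
theorem exists_im_mul_norm_le [DiscreteTopology Γ] (hΓ : HasFiniteCovolume Γ) {r : ℕ}
    {a : Fin r → OnePoint ℝ} (ha : IsCuspRepresentatives Γ a) {σ : Fin r → SL(2, ℝ)}
    (hσ : ∀ i, IsScalingMatrix Γ (a i) (σ i)) (f : CuspForm Γ 2) :
    ∃ C : ℝ, ∀ z : ℍ, z.im * ‖f z‖ ≤ C := by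
  have hinv : ∀ γ ∈ Γ, ∀ z : ℍ, (γ • z).im * ‖f (γ • z)‖ = z.im * ‖f z‖ := by
    intro γ hγ z
    rw [im_mul_norm_slash f (det_eq_one_of_mem hγ), SlashInvariantFormClass.slash_action_eq f γ hγ]
  choose C Y hCY using fun i => exists_im_mul_norm_slash_le f (ha.1 i) (hσ i)
  -- With `ε = 1 / Y'`, the `10` keeps `ε` within the Zassenhaus threshold `1 / 10`, and the sum
  -- puts the parabolic case above every height `Y i`.
  set Y' := ∑ i, |Y i| + 10 with hY'
  have hYp : 0 ≤ ∑ i, |Y i| := Finset.sum_nonneg fun _ _ => abs_nonneg _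
  obtain ⟨F, -, hFfin, hF⟩ := hΓ
  have hF' : ∀ z : ℍ, ∃ γ ∈ slSubgroup Γ, γ • z ∈ F := by
    intro z
    obtain ⟨γ, hγ, hz⟩ := hF z
    obtain ⟨s, rfl⟩ := exists_specialLinearGroup (det_eq_one_of_mem hγ)
    exact ⟨s, hγ, hz⟩
  obtain ⟨T, R, hT⟩ := (finiteDisplacement_slSubgroup Γ).exists_finset_or_parabolic hFfin hF'
    (ε := 1 / Y') (by positivity) (by
      rw [div_le_div_iff_of_pos_left one_pos (by positivity) (by norm_num)]; linarith)
  have hcpt : IsCompact (⋃ t ∈ T, Metric.closedBall t R) :=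
    T.isCompact_biUnion fun t _ => isCompact_closedBall t R
  have hfc : Continuous f := (CuspFormClass.holo f).continuous
  obtain ⟨C₀, hC₀⟩ := hcpt.exists_bound_of_continuousOn (f := fun z : ℍ => z.im * ‖f z‖)
    (by fun_prop)
  refine ⟨max C₀ (∑ i, |C i|), fun z => ?_⟩
  rcases hT z with ⟨t, ht, γ, hγ, hd⟩ | ⟨A, hA, hA1, hAtr, hAε⟩
  · have h1 := hC₀ (γ • z) (Set.mem_iUnion₂.mpr ⟨t, ht, hd⟩)
    rw [← hinv _ hγ z]
    exact ((le_abs_self _).trans h1).trans (le_max_left _ _)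
  · obtain ⟨i, γ, hγ, him⟩ := exists_im_gt_of_parabolic ha hσ (by positivity) hA hA1 hAtr hAε
    rw [one_div_one_div] at him
    have hYi : |Y i| ≤ ∑ i, |Y i| :=
      Finset.single_le_sum (f := fun i => |Y i|) (fun _ _ => abs_nonneg _) (Finset.mem_univ i)
    have hCi : |C i| ≤ ∑ i, |C i| :=
      Finset.single_le_sum (f := fun i => |C i|) (fun _ _ => abs_nonneg _) (Finset.mem_univ i)
    have h1 := hCY i (((σ i : GL (Fin 2) ℝ)⁻¹ * γ) • z) (by linarith [le_abs_self (Y i)])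
    rw [← im_mul_norm_slash f (det_coe_eq_one (σ i)), ← mul_smul, mul_inv_cancel_left,
      hinv γ hγ] at h1
    exact (h1.trans ((le_abs_self _).trans hCi)).trans (le_max_right _ _)

end Bounded

/-! ### Convergence of the series of heights by counting orbit points. -/

section Counting

theorem dist_le_of_cosh_dist_le {z w : ℍ} {R : ℝ} (hR : 0 ≤ R)
    (h : Real.cosh (dist z w) ≤ (R + 1) / 2) : dist z w ≤ R := by
  have h1 : (R + 1) / 2 ≤ Real.cosh R := by
    rw [Real.cosh_eq]
    have := Real.add_one_le_exp R
    have := Real.exp_pos (-R)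
    linarith
  have h2 := Real.cosh_le_cosh.mp (h.trans h1)
  rwa [abs_of_nonneg dist_nonneg, abs_of_nonneg hR] at h2

theorem summable_comp_of_card_fiber_le {ι : Type*} {u : ι → ℝ} {φ : ℕ → ℝ} (N : ι → ℕ) {M : ℕ}
    (hu : ∀ q, 0 ≤ u q) (huφ : ∀ q, u q ≤ φ (N q)) (hφ0 : ∀ n, 0 ≤ φ n) (hφ : Summable φ)
    (hM : ∀ (S : Finset ι) (n : ℕ), (∀ q ∈ S, N q = n) → S.card ≤ M) : Summable u := by
  classical
  refine summable_of_sum_le (c := M * ∑' n, φ n) hu fun S => ?_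
  calc ∑ q ∈ S, u q ≤ ∑ q ∈ S, φ (N q) := Finset.sum_le_sum fun q _ => huφ q
    _ = ∑ n ∈ S.image N, (S.filter fun q => N q = n).card • φ n := Finset.sum_comp φ N
    _ ≤ ∑ n ∈ S.image N, M * φ n := by
      refine Finset.sum_le_sum fun n _ => ?_
      rw [nsmul_eq_mul]
      have h1 := hM (S.filter fun q => N q = n) n fun q hq => (Finset.mem_filter.mp hq).2
      have h2 := hφ0 n
      gcongr
    _ = M * ∑ n ∈ S.image N, φ n := by rw [Finset.mul_sum]
    _ ≤ M * ∑' n, φ n := by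
      gcongr
      exact hφ.sum_le_tsum _ fun n _ => hφ0 n

theorem cosh_dist_le_of_box {w v : ℍ} {Y t : ℝ} (hY : 1 ≤ Y) (ht : 0 < t)
    (hre : |w.re - v.re| ≤ 1 / t) (hw : w.im ≤ Y / t) (hw' : Y / (2 * t) ≤ w.im)
    (hv : v.im ≤ Y / t) (hv' : Y / (2 * t) ≤ v.im) : Real.cosh (dist w v) ≤ 5 := by
  rw [UpperHalfPlane.cosh_dist]
  have h1 : dist (w : ℂ) v ^ 2 = (w.re - v.re) ^ 2 + (w.im - v.im) ^ 2 := by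
    rw [Complex.dist_eq_re_im, Real.sq_sqrt (by positivity)]; rfl
  rw [h1]
  have hwp := w.im_pos
  have hvp := v.im_pos
  have h2 : (w.re - v.re) ^ 2 ≤ (Y / t) ^ 2 := by
    rw [← sq_abs]
    have : (1 : ℝ) / t ≤ Y / t := by gcongr
    have := abs_nonneg (w.re - v.re)
    gcongr
    linarith
  have h3 : (w.im - v.im) ^ 2 ≤ (Y / t) ^ 2 := by
    apply sq_le_sq' <;> linarith
  have h4 : (Y / (2 * t)) * (Y / (2 * t)) ≤ w.im * v.im := by gcongr
  have h5 : (Y / (2 * t)) * (Y / (2 * t)) = (Y / t) ^ 2 / 4 := by field_simp; norm_num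
  have h6 : ((w.re - v.re) ^ 2 + (w.im - v.im) ^ 2) / (2 * w.im * v.im) ≤ 4 := by
    rw [div_le_iff₀ (by positivity)]
    nlinarith
  linarith

variable {Γ : Subgroup (GL (Fin 2) ℝ)} {c : OnePoint ℝ} {σ : SL(2, ℝ)}

theorem IsScalingMatrix.exists_smul_vadd_eq (hσ : IsScalingMatrix Γ c σ) (γ : Γ) (k : ℤ) :
    ∃ δ : Γ, δ • c = c ∧ ∀ z : ℍ, ((σ : GL (Fin 2) ℝ)⁻¹ * (δ * γ : Γ)) • z =
      (k : ℝ) +ᵥ ((σ : GL (Fin 2) ℝ)⁻¹ * γ) • z := by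
  obtain ⟨δ, hδ, hδc, h⟩ := hσ.exists_mem_smul_eq k
  refine ⟨⟨δ, hδ⟩, hδc, fun z => ?_⟩
  have h1 := h ((γ : GL (Fin 2) ℝ) • z)
  rw [mul_smul, mul_smul, Subgroup.coe_mul, mul_smul, h1, inv_smul_smul]

/-- Every coset has a representative moving `z` into the strip `0 ≤ Re < 1`. -/
theorem IsScalingMatrix.exists_representatives (hσ : IsScalingMatrix Γ c σ) (z : ℍ) :
    ∃ ρ : CuspCosets Γ c → Γ, (∀ q, ∃ δ : Γ, δ • c = c ∧ ρ q = δ * q.out) ∧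
      Function.Injective ρ ∧ ∀ q, 0 ≤ (((σ : GL (Fin 2) ℝ)⁻¹ * ρ q) • z).re ∧
        (((σ : GL (Fin 2) ℝ)⁻¹ * ρ q) • z).re < 1 := by
  choose δ hδc hδ using fun q : CuspCosets Γ c => hσ.exists_smul_vadd_eq q.out
    (-⌊(((σ : GL (Fin 2) ℝ)⁻¹ * (q.out : Γ)) • z).re⌋)
  refine ⟨fun q => δ q * q.out, fun q => ⟨δ q, hδc q, rfl⟩, ?_, fun q => ?_⟩
  · intro p q hpq
    simp only at hpq
    rw [← p.out_eq, ← q.out_eq]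
    apply Quotient.sound
    rw [← Quotient.eq_iff_equiv, Quotient.eq, QuotientGroup.rightRel_apply]
    have : (q.out : Γ) * (p.out)⁻¹ = (δ q)⁻¹ * δ p := by
      rw [mul_inv_eq_iff_eq_mul, mul_assoc, hpq, inv_mul_cancel_left]
    rw [this]
    exact mul_mem (inv_mem (hδc q)) (hδc p)
  · rw [hδ, vadd_re]
    push_cast
    constructor
    · linarith [Int.floor_le (((σ : GL (Fin 2) ℝ)⁻¹ * (q.out : Γ)) • z).re]
    · linarith [Int.lt_floor_add_one (((σ : GL (Fin 2) ℝ)⁻¹ * (q.out : Γ)) • z).re]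

variable [Γ.HasDetOne]

/-- Only boundedly many points of an orbit, with multiplicity, lie in a set of bounded diameter. -/
theorem exists_card_le_of_dist_le [DiscreteTopology Γ] (z : ℍ) (R : ℝ) :
    ∃ M : ℕ, ∀ {ι : Type} (S : Finset ι) (ρ : ι → Γ), Function.Injective ρ →
      (∀ i ∈ S, ∀ j ∈ S, dist (ρ i • z) (ρ j • z) ≤ R) → S.card ≤ M := by
  classical
  have hfin := finiteDisplacement_slSubgroup Γ z R
  refine ⟨hfin.toFinset.card, fun {ι} S ρ hρ hS => ?_⟩
  rcases S.eq_empty_or_nonempty with rfl | ⟨i₀, hi₀⟩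
  · simp
  choose e he using fun γ : Γ => exists_specialLinearGroup (det_eq_one_of_mem γ.2)
  refine Finset.card_le_card_of_injOn (fun i => e ((ρ i₀)⁻¹ * ρ i)) (fun i hi => ?_) ?_
  · rw [Finset.mem_coe, Set.Finite.mem_toFinset]
    refine ⟨?_, ?_⟩
    · change ((e ((ρ i₀)⁻¹ * ρ i) : SL(2, ℝ)) : GL (Fin 2) ℝ) ∈ Γ
      rw [he]; exact ((ρ i₀)⁻¹ * ρ i).2
    · rw [← coe_smul_eq, he]
      have h1 := hS i₀ hi₀ i hi
      rw [← dist_smul_smul_of_det_eq_one (det_inv_eq_one (det_eq_one_of_mem (ρ i₀).2))] at h1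
      convert h1 using 2
      · exact (inv_smul_smul (ρ i₀) z).symm
      · exact mul_smul (ρ i₀)⁻¹ (ρ i) z
  · intro i _ j _ hij
    have h1 := congrArg (fun s : SL(2, ℝ) => (s : GL (Fin 2) ℝ)) hij
    simp only [he] at h1
    exact hρ (mul_left_cancel (Subtype.ext h1))

/-- Unit translations move a point at height above `M + 1` very little, so `M + 1` of its translates
would lie close together, one more than discreteness allows. -/
theorem IsScalingMatrix.exists_im_le [DiscreteTopology Γ] (hσ : IsScalingMatrix Γ c σ) (z : ℍ) :
    ∃ Y : ℝ, 1 ≤ Y ∧ ∀ γ : Γ, (((σ : GL (Fin 2) ℝ)⁻¹ * γ) • z).im ≤ Y := by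
  obtain ⟨M, hM⟩ := exists_card_le_of_dist_le (Γ := Γ) z 9
  refine ⟨M + 1, by simp, fun γ => ?_⟩
  by_contra! hlt
  choose δ hδ using fun k : ℕ => hσ.exists_smul_vadd_eq γ k
  set w := ((σ : GL (Fin 2) ℝ)⁻¹ * γ) • z with hw
  have hdet := det_inv_eq_one (det_coe_eq_one σ)
  have hinj : Function.Injective fun k => δ k * γ := by
    intro k l hkl
    have h1 := (hδ k).2 z
    simp only at hkl
    rw [hkl, (hδ l).2 z] at h1
    have h2 := congrArg UpperHalfPlane.re h1
    simp only [vadd_re] at h2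
    have h3 : ((l : ℤ) : ℝ) = (k : ℤ) := by linarith
    exact_mod_cast h3.symm
  have := hM (Finset.range (M + 1)) _ hinj (by
    intro k hk l hl
    rw [← dist_smul_smul_of_det_eq_one hdet]
    have e1 := (hδ k).2 z
    have e2 := (hδ l).2 z
    rw [mul_smul] at e1 e2
    change dist ((σ : GL (Fin 2) ℝ)⁻¹ • (((δ k * γ : Γ) : GL (Fin 2) ℝ) • z))
      ((σ : GL (Fin 2) ℝ)⁻¹ • (((δ l * γ : Γ) : GL (Fin 2) ℝ) • z)) ≤ 9
    rw [e1, e2]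
    apply dist_le_of_cosh_dist_le (by norm_num)
    have e3 : ((l : ℤ) : ℝ) +ᵥ w = (((l : ℤ) : ℝ) - ((k : ℤ) : ℝ)) +ᵥ (((k : ℤ) : ℝ) +ᵥ w) := by
      rw [vadd_vadd]; congr 1; ring
    rw [← hw, e3, cosh_dist_vadd, vadd_im]
    have hk' : (k : ℝ) ≤ M := by
      have := Finset.mem_range.mp hk; exact_mod_cast (by omega : k ≤ M)
    have hl' : (l : ℝ) ≤ M := by
      have := Finset.mem_range.mp hl; exact_mod_cast (by omega : l ≤ M)
    have hk0 : (0 : ℝ) ≤ k := Nat.cast_nonneg k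
    have hl0 : (0 : ℝ) ≤ l := Nat.cast_nonneg l
    have h4 : (((l : ℤ) : ℝ) - ((k : ℤ) : ℝ)) ^ 2 ≤ w.im ^ 2 := by
      apply sq_le_sq'
      · push_cast; linarith
      · push_cast; linarith
    have hwp := w.im_pos
    have h5 : (((l : ℤ) : ℝ) - ((k : ℤ) : ℝ)) ^ 2 / (2 * w.im ^ 2) ≤ 1 := by
      rw [div_le_one (by positivity)]
      nlinarith
    linarith)
  simp at this

/-- The strip below height `Y` is cut into dyadic boxes: level `k` consists of `2^k` boxes of height
about `Y / 2^k`, and box `l` of level `k` gets the number `2^k + l`. Boxes have bounded hyperbolic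
diameter, so each holds at most `M` orbit points. In box `N` the height is at most `2Y / N`, so the
sum is dominated by a multiple of `∑ N^{-t}`. -/
theorem IsScalingMatrix.summable_im_rpow [DiscreteTopology Γ] (hσ : IsScalingMatrix Γ c σ)
    {z : ℍ} {ρ : CuspCosets Γ c → Γ} (hρ : Function.Injective ρ)
    (hre : ∀ q, 0 ≤ (((σ : GL (Fin 2) ℝ)⁻¹ * ρ q) • z).re ∧
      (((σ : GL (Fin 2) ℝ)⁻¹ * ρ q) • z).re < 1) {t : ℝ} (ht : 1 < t) :
    Summable fun q => (((σ : GL (Fin 2) ℝ)⁻¹ * ρ q) • z).im ^ t := by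
  obtain ⟨M, hM⟩ := exists_card_le_of_dist_le (Γ := Γ) z 9
  obtain ⟨Y, hY1, hY⟩ := hσ.exists_im_le z
  set w : CuspCosets Γ c → ℍ := fun q => ((σ : GL (Fin 2) ℝ)⁻¹ * ρ q) • z with hw
  have hY0 : 0 < Y := by linarith
  have hk : ∀ q, ∃ k : ℕ, (2 : ℝ) ^ k ≤ Y / (w q).im ∧ Y / (w q).im < 2 ^ (k + 1) := fun q =>
    exists_nat_pow_near ((one_le_div (w q).im_pos).mpr (hY (ρ q))) one_lt_two
  choose k hk1 hk2 using hk
  set l : CuspCosets Γ c → ℕ := fun q => ⌊(w q).re * 2 ^ k q⌋₊ with hl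
  have hl1 : ∀ q, (l q : ℝ) ≤ (w q).re * 2 ^ k q := fun q =>
    Nat.floor_le (mul_nonneg (hre q).1 (by positivity))
  have hl2 : ∀ q, (w q).re * 2 ^ k q < l q + 1 := fun q => Nat.lt_floor_add_one _
  have hl3 : ∀ q, l q < 2 ^ k q := by
    intro q
    have h1 : (w q).re * 2 ^ k q < 1 * 2 ^ k q := by
      have := (hre q).2
      gcongr
    exact_mod_cast (hl1 q).trans_lt (h1.trans_eq (one_mul _))
  have hN : ∀ q, Nat.log 2 (2 ^ k q + l q) = k q := by
    intro q
    rw [Nat.log_eq_iff (Or.inr ⟨by norm_num, by positivity⟩)]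
    have := hl3 q
    rw [pow_succ]; omega
  refine summable_comp_of_card_fiber_le (φ := fun n : ℕ => (2 * Y) ^ t * (n : ℝ) ^ (-t))
    (fun q => 2 ^ k q + l q) (M := M) (fun q => ?_) (fun q => ?_) (fun n => by positivity)
    ((Real.summable_nat_rpow.mpr (by linarith)).mul_left _) ?_
  · have := (w q).im_pos
    positivity
  · have hNpos : (0 : ℝ) < ((2 ^ k q + l q : ℕ) : ℝ) := by
      have : 0 < 2 ^ k q + l q := by positivity
      exact_mod_cast this
    have h1 : (w q).im ≤ 2 * Y / ((2 ^ k q + l q : ℕ) : ℝ) := by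
      rw [le_div_iff₀ hNpos]
      have h2 := hk1 q
      rw [le_div_iff₀ (w q).im_pos] at h2
      have h3 : ((2 ^ k q + l q : ℕ) : ℝ) ≤ 2 * 2 ^ k q := by
        have := hl3 q
        exact_mod_cast (by omega : 2 ^ k q + l q ≤ 2 * 2 ^ k q)
      have := (w q).im_pos
      nlinarith
    have hp := (w q).im_pos
    calc (w q).im ^ t ≤ (2 * Y / ((2 ^ k q + l q : ℕ) : ℝ)) ^ t := by gcongr
      _ = _ := by
        rw [Real.div_rpow (by positivity) hNpos.le, Real.rpow_neg hNpos.le, div_eq_mul_inv]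
  · intro S n hS
    refine hM S ρ hρ fun p hp q hq => ?_
    have hkk : k p = k q := by rw [← hN p, ← hN q, hS p hp, hS q hq]
    have hll : l p = l q := by
      have := (hS p hp).trans (hS q hq).symm
      rw [hkk] at this
      omega
    rw [← dist_smul_smul_of_det_eq_one (det_inv_eq_one (det_coe_eq_one σ))]
    have e : ∀ q, (σ : GL (Fin 2) ℝ)⁻¹ • ρ q • z = w q := fun q => (mul_smul _ _ z).symm
    rw [e, e]
    refine dist_le_of_cosh_dist_le (by norm_num) ?_
    have h2 : (0 : ℝ) < 2 ^ k q := by positivity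
    have him : ∀ p, k p = k q → (w p).im ≤ Y / 2 ^ k q ∧ Y / (2 * 2 ^ k q) ≤ (w p).im := by
      intro p h
      have h3 := hk1 p
      have h4 := hk2 p
      have h5 := (w p).im_pos
      rw [h] at h3 h4
      rw [le_div_iff₀ h5] at h3
      rw [div_lt_iff₀ h5, pow_succ] at h4
      rw [le_div_iff₀ h2, div_le_iff₀ (by positivity)]
      constructor <;> linarith
    have h6 := cosh_dist_le_of_box (w := w p) (v := w q) hY1 h2 (by
      have a1 := hl1 p
      have a2 := hl2 p
      have a3 := hl1 q
      have a4 := hl2 q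
      rw [hkk, hll] at a1 a2
      rw [le_div_iff₀ h2, ← abs_of_pos h2, ← abs_mul, abs_le]
      constructor <;> linarith) (him p hkk).1 (him p hkk).2 (him q rfl).1 (him q rfl).2
    linarith

end Counting

/-! ### Logarithmic growth of modular symbols and absolute convergence. -/

section Convergence

open Filter Topology
open scoped ModularForm

theorem IsPrimitive.hasDerivAt {h : ℍ → ℂ} {H : ℂ → ℂ} (hH : IsPrimitive h H) {w : ℂ}
    (hw : 0 < w.im) : HasDerivAt H (h ⟨w, hw⟩) w := hH ⟨w, hw⟩

/-- Integrate vertically to height `1` and then horizontally to `i`. Parametrizing the vertical path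
by `u = log y` makes the integrand `y h`, of size at most `C`. -/
theorem IsPrimitive.norm_sub_I_le {h : ℍ → ℂ} {H : ℂ → ℂ} (hH : IsPrimitive h H) {C : ℝ}
    (hC : ∀ z : ℍ, z.im * ‖h z‖ ≤ C) (w : ℍ) :
    ‖H w - H Complex.I‖ ≤ C * (|w.re| + |Real.log w.im|) := by
  have h1 : ‖H w - H (w.re + Complex.I)‖ ≤ C * |Real.log w.im| := by
    have him : ∀ u : ℝ, 0 < ((w.re : ℂ) + (Real.exp u : ℂ) * Complex.I).im := fun u => by
      simpa [-Complex.ofReal_exp] using Real.exp_pos u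
    have hd : ∀ u : ℝ, HasDerivAt (fun u : ℝ => H ((w.re : ℂ) + (Real.exp u : ℂ) * Complex.I))
        (h ⟨_, him u⟩ * ((Real.exp u : ℂ) * Complex.I)) u := fun u => by
      have h2 : HasDerivAt (fun u : ℝ => (w.re : ℂ) + (Real.exp u : ℂ) * Complex.I)
          ((Real.exp u : ℂ) * Complex.I) u :=
        (((Real.hasDerivAt_exp u).ofReal_comp).mul_const Complex.I).const_add _
      exact (hH.hasDerivAt (him u)).comp u h2
    have h3 := convex_univ.norm_image_sub_le_of_norm_hasDerivWithin_le (C := C)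
      (fun u _ => (hd u).hasDerivWithinAt) (fun u _ => by
        have h4 := hC ⟨_, him u⟩
        have h5 : (⟨_, him u⟩ : ℍ).im = Real.exp u := by
          change ((w.re : ℂ) + (Real.exp u : ℂ) * Complex.I).im = _
          simp [-Complex.ofReal_exp]
        rw [h5] at h4
        rw [norm_mul, norm_mul, Complex.norm_I, mul_one, Complex.norm_real,
          Real.norm_of_nonneg (Real.exp_pos u).le, mul_comm]
        exact h4) (Set.mem_univ 0) (Set.mem_univ (Real.log w.im))
    rw [Real.exp_log w.im_pos] at h3
    have e : (w : ℂ) = (w.re : ℂ) + (w.im : ℂ) * Complex.I := by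
      apply Complex.ext <;> simp
    simpa [← e] using h3
  have h2 : ‖H (w.re + Complex.I) - H Complex.I‖ ≤ C * |w.re| := by
    have him : ∀ x : ℝ, 0 < ((x : ℂ) + Complex.I).im := fun x => by simp
    have hd : ∀ x : ℝ, HasDerivAt (fun x : ℝ => H ((x : ℂ) + Complex.I))
        (h ⟨_, him x⟩) x := fun x => by
      have h2 : HasDerivAt (fun x : ℝ => (x : ℂ) + Complex.I) 1 x :=
        ((hasDerivAt_id x).ofReal_comp).add_const _
      have h3 := (hH.hasDerivAt (him x)).comp x h2
      rw [mul_one] at h3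
      exact h3
    have h3 := convex_univ.norm_image_sub_le_of_norm_hasDerivWithin_le (C := C)
      (fun u _ => (hd u).hasDerivWithinAt) (fun u _ => by
        have h4 := hC ⟨_, him u⟩
        have h5 : (⟨_, him u⟩ : ℍ).im = 1 := by
          change ((u : ℂ) + Complex.I).im = _
          simp
        rwa [h5, one_mul] at h4) (Set.mem_univ 0) (Set.mem_univ w.re)
    simpa using h3
  calc ‖H w - H Complex.I‖ ≤ ‖H w - H (w.re + Complex.I)‖ + ‖H (w.re + Complex.I) - H Complex.I‖ :=
        norm_sub_le_norm_sub_add_norm_sub _ _ _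
    _ ≤ _ := by linarith

theorem one_add_le_mul_exp {u δ : ℝ} (hu : 0 ≤ u) (hδ : 0 < δ) :
    1 + u ≤ (1 + 1 / δ) * Real.exp (δ * u) := by
  have h1 : 1 ≤ Real.exp (δ * u) := Real.one_le_exp (by positivity)
  have h2 := Real.add_one_le_exp (δ * u)
  have h3 : u ≤ 1 / δ * Real.exp (δ * u) := by
    rw [one_div, inv_mul_eq_div, le_div_iff₀ hδ]; linarith
  linarith

theorem exp_abs_log_le {y Y : ℝ} (hy : 0 < y) (hY1 : 1 ≤ Y) (hyY : y ≤ Y) :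
    Real.exp |Real.log y| ≤ Y ^ 2 / y := by
  rcases le_total 0 (Real.log y) with h | h
  · rw [abs_of_nonneg h, Real.exp_log hy, le_div_iff₀ hy, sq]
    gcongr
  · rw [abs_of_nonpos h, Real.exp_neg, Real.exp_log hy, inv_eq_one_div]
    gcongr
    nlinarith

/-- Powers of the logarithm are absorbed by an arbitrarily small power. -/
theorem exists_one_add_abs_log_pow_le {Y t t' : ℝ} (hY1 : 1 ≤ Y) (htt' : t' < t) (p : ℕ) :
    ∃ K : ℝ, 0 ≤ K ∧ ∀ y : ℝ, 0 < y → y ≤ Y → (1 + |Real.log y|) ^ p * y ^ t ≤ K * y ^ t' := by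
  -- Dividing by `p + 1` rather than `p` gives `p δ ≤ t - t'` and covers `p = 0`.
  set δ := (t - t') / (p + 1) with hδ
  have hδ0 : 0 < δ := div_pos (by linarith) (by positivity)
  have hδp : p * δ ≤ t - t' := by
    rw [hδ, mul_div_assoc', div_le_iff₀ (by positivity)]
    nlinarith
  refine ⟨(1 + 1 / δ) ^ p * (Y ^ 2) ^ (t - t'), by positivity, fun y hy hyY => ?_⟩
  have hYy : 1 ≤ Y ^ 2 / y := by
    rw [one_le_div hy]; nlinarith
  have h1 : (1 + |Real.log y|) ^ p ≤ (1 + 1 / δ) ^ p * (Y ^ 2 / y) ^ (t - t') := by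
    calc (1 + |Real.log y|) ^ p ≤ ((1 + 1 / δ) * Real.exp (δ * |Real.log y|)) ^ p := by
          gcongr
          exact one_add_le_mul_exp (abs_nonneg _) hδ0
      _ = (1 + 1 / δ) ^ p * (Real.exp |Real.log y|) ^ (p * δ) := by
          rw [mul_pow, ← Real.exp_nat_mul, ← Real.exp_mul]
          congr 2; ring
      _ ≤ (1 + 1 / δ) ^ p * (Y ^ 2 / y) ^ (p * δ) := by
          gcongr
          exact exp_abs_log_le hy hY1 hyY
      _ ≤ (1 + 1 / δ) ^ p * (Y ^ 2 / y) ^ (t - t') := by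
          gcongr
  calc (1 + |Real.log y|) ^ p * y ^ t
      ≤ (1 + 1 / δ) ^ p * (Y ^ 2 / y) ^ (t - t') * y ^ t := by gcongr
    _ = (1 + 1 / δ) ^ p * (Y ^ 2) ^ (t - t') * y ^ t' := by
        rw [Real.div_rpow (by positivity) hy.le, mul_div_assoc', div_mul_eq_mul_div, mul_div_assoc,
          ← Real.rpow_sub hy]
        congr 2; ring

variable {Γ : Subgroup (GL (Fin 2) ℝ)} {c : OnePoint ℝ} {σ : SL(2, ℝ)}

/-- The bound on `y |f|` passes to the slash of `f` by `σ`, and with the real part bounded only the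
logarithm of the height is left. Such coset representatives exist by
`IsScalingMatrix.exists_representatives`. -/
theorem exists_norm_modularSymbol_le [Γ.HasDetOne] {f : CuspForm Γ 2} {C : ℝ}
    (hC : ∀ z : ℍ, z.im * ‖f z‖ ≤ C) (σ : SL(2, ℝ)) (z₀ : ℍ) :
    ∃ B : ℝ, 0 ≤ B ∧ ∀ γ : Γ, |(((σ : GL (Fin 2) ℝ)⁻¹ * γ) • z₀).re| ≤ 1 →
      ‖modularSymbol f z₀ γ‖ ≤
        B * (1 + |Real.log (((σ : GL (Fin 2) ℝ)⁻¹ * γ) • z₀).im|) := by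
  obtain ⟨F, hF⟩ := exists_isPrimitive (CuspFormClass.holo f)
  have hσ1 := det_coe_eq_one σ
  have hH := hF.slash hσ1
  set H : ℂ → ℂ := fun w => F (((σ : GL (Fin 2) ℝ) • ofComplex w : ℍ) : ℂ) with hHdef
  have hC0 : 0 ≤ C := (mul_nonneg z₀.im_pos.le (norm_nonneg _)).trans (hC z₀)
  refine ⟨C + ‖H Complex.I - F z₀‖, by positivity, fun γ hγ => ?_⟩
  set w := ((σ : GL (Fin 2) ℝ)⁻¹ * γ) • z₀ with hw
  have h1 := hH.norm_sub_I_le (C := C) (fun z => by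
    rw [← im_mul_norm_slash _ hσ1]; exact hC _) w
  have h2 : modularSymbol f z₀ γ = H w - F z₀ := by
    rw [modularSymbol_eq f z₀ hF γ.2 z₀, hHdef]
    simp only [ofComplex_apply]
    rw [hw, mul_smul, smul_inv_smul]
  have h3 : 0 ≤ |Real.log w.im| := abs_nonneg _
  have h4 := norm_nonneg (H Complex.I - F z₀)
  calc ‖modularSymbol f z₀ γ‖ = ‖(H w - H Complex.I) + (H Complex.I - F z₀)‖ := by
        rw [h2]; congr 1; ring
    _ ≤ C * (|w.re| + |Real.log w.im|) + ‖H Complex.I - F z₀‖ :=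
        (norm_add_le _ _).trans (by gcongr)
    _ ≤ C * (1 + |Real.log w.im|) + ‖H Complex.I - F z₀‖ * (1 + |Real.log w.im|) := by
        gcongr
        nlinarith
    _ = _ := by ring

variable (χ : Γ →* Circle) (f g : CuspForm Γ 2) (z₀ : ℍ)

/-- The coefficient `χ(γ) ⟨γ, f⟩^m conj(⟨γ, g⟩)^n`. -/
def symbolWeight (m n : ℕ) (γ : Γ) : ℂ :=
  (χ γ : ℂ) * modularSymbol f z₀ γ ^ m * conj (modularSymbol g z₀ γ) ^ n

theorem eisensteinTerm_eq (m n : ℕ) (s : ℂ) (z : ℍ) (γ : Γ) :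
    eisensteinTerm Γ χ f g z₀ σ m n s z γ =
      symbolWeight χ f g z₀ m n γ * (((((σ : GL (Fin 2) ℝ)⁻¹ * γ) • z).im : ℝ) : ℂ) ^ s := rfl

theorem norm_symbolWeight (m n : ℕ) (γ : Γ) : ‖symbolWeight χ f g z₀ m n γ‖ =
    ‖modularSymbol f z₀ γ‖ ^ m * ‖modularSymbol g z₀ γ‖ ^ n := by
  rw [symbolWeight, norm_mul, norm_mul, norm_pow, norm_pow, RCLike.norm_conj, Circle.norm_coe,
    one_mul]

variable {χ f g z₀}

theorem symbolWeight_mul_left [Γ.HasDetOne] (hσ : IsScalingMatrix Γ c σ) (hc : IsCusp c Γ)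
    (hχ : ∀ γ : Γ, γ • c = c → χ γ = 1) (m n : ℕ) {δ : Γ} (hδ : δ • c = c) (γ : Γ) :
    symbolWeight χ f g z₀ m n (δ * γ) = symbolWeight χ f g z₀ m n γ := by
  have h1 : ∀ f : CuspForm Γ 2, modularSymbol f z₀ ((δ * γ : Γ) : GL (Fin 2) ℝ) =
      modularSymbol f z₀ γ := fun f => by
    rw [Subgroup.coe_mul, modularSymbol_mul f z₀ δ.2 γ.2,
      modularSymbol_eq_zero f z₀ hσ hc δ.2 hδ, zero_add]
  rw [symbolWeight, symbolWeight, h1, h1, map_mul, hχ δ hδ, one_mul]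

theorem IsScalingMatrix.im_mul_smul (hσ : IsScalingMatrix Γ c σ) {δ : Γ} (hδ : δ • c = c)
    (γ : Γ) (z : ℍ) : (((σ : GL (Fin 2) ℝ)⁻¹ * (δ * γ : Γ)) • z).im =
      (((σ : GL (Fin 2) ℝ)⁻¹ * γ) • z).im := by
  obtain ⟨k, hk⟩ := hσ.exists_smul_eq δ.2 hδ
  rw [mul_smul, Subgroup.coe_mul, mul_smul, hk, inv_smul_smul, vadd_im, mul_smul]

theorem eisensteinTerm_mul_left [Γ.HasDetOne] (hσ : IsScalingMatrix Γ c σ) (hc : IsCusp c Γ)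
    (hχ : ∀ γ : Γ, γ • c = c → χ γ = 1) (m n : ℕ) (s : ℂ) (z : ℍ) {δ : Γ} (hδ : δ • c = c)
    (γ : Γ) : eisensteinTerm Γ χ f g z₀ σ m n s z (δ * γ) =
      eisensteinTerm Γ χ f g z₀ σ m n s z γ := by
  rw [eisensteinTerm_eq, eisensteinTerm_eq, symbolWeight_mul_left hσ hc hχ m n hδ,
    hσ.im_mul_smul hδ]

/-- The point is the base point `z₀`, because the symbol of `γ` is controlled by the position of
`σ⁻¹ γ z₀`. Other points follow by `Summable.mul_im_rpow`. -/
theorem summable_norm_symbolWeight_mul [Γ.HasDetOne] [DiscreteTopology Γ]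
    (hσ : IsScalingMatrix Γ c σ)
    (hc : IsCusp c Γ) (hχ : ∀ γ : Γ, γ • c = c → χ γ = 1)
    (hf : ∃ C : ℝ, ∀ z : ℍ, z.im * ‖f z‖ ≤ C) (hg : ∃ C : ℝ, ∀ z : ℍ, z.im * ‖g z‖ ≤ C)
    (m n : ℕ) {t : ℝ} (ht : 1 < t) :
    Summable fun q : CuspCosets Γ c => ‖symbolWeight χ f g z₀ m n q.out‖ *
      (((σ : GL (Fin 2) ℝ)⁻¹ * (q.out : Γ)) • z₀).im ^ t := by
  obtain ⟨ρ, hρ, hinj, hre⟩ := hσ.exists_representatives z₀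
  have h1 : ∀ q, ‖symbolWeight χ f g z₀ m n q.out‖ *
      (((σ : GL (Fin 2) ℝ)⁻¹ * (q.out : Γ)) • z₀).im ^ t =
      ‖symbolWeight χ f g z₀ m n (ρ q)‖ * (((σ : GL (Fin 2) ℝ)⁻¹ * ρ q) • z₀).im ^ t := by
    intro q
    obtain ⟨δ, hδ, h⟩ := hρ q
    rw [h, symbolWeight_mul_left hσ hc hχ m n hδ, hσ.im_mul_smul hδ]
  simp_rw [h1]
  obtain ⟨C, hC⟩ := hf
  obtain ⟨D, hD⟩ := hg
  obtain ⟨B, hB0, hB⟩ := exists_norm_modularSymbol_le hC σ z₀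
  obtain ⟨B', hB'0, hB'⟩ := exists_norm_modularSymbol_le hD σ z₀
  obtain ⟨Y, hY1, hY⟩ := hσ.exists_im_le z₀
  -- The exponent `(1 + t) / 2` lies strictly between `1` and `t`: it leaves room for the logarithms
  -- and still gives convergence.
  obtain ⟨K, hK0, hK⟩ := exists_one_add_abs_log_pow_le hY1 (t := t) (t' := (1 + t) / 2)
    (by linarith) (m + n)
  refine Summable.of_nonneg_of_le (fun q => ?_) (fun q => ?_)
    ((hσ.summable_im_rpow hinj hre (t := (1 + t) / 2) (by linarith)).mul_left (B ^ m * B' ^ n * K))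
  · have := (((σ : GL (Fin 2) ℝ)⁻¹ * ρ q) • z₀).im_pos
    positivity
  · set w := ((σ : GL (Fin 2) ℝ)⁻¹ * ρ q) • z₀ with hw
    have hre' : |w.re| ≤ 1 := by
      rw [abs_le]; constructor <;> linarith [(hre q).1, (hre q).2]
    have hp := w.im_pos
    have h2 := hK w.im hp (hY (ρ q))
    rw [norm_symbolWeight]
    calc _ ≤ (B * (1 + |Real.log w.im|)) ^ m * (B' * (1 + |Real.log w.im|)) ^ n * w.im ^ t := by
          gcongr
          · exact hB _ hre'
          · exact hB' _ hre'
      _ = B ^ m * B' ^ n * ((1 + |Real.log w.im|) ^ (m + n) * w.im ^ t) := by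
          rw [mul_pow, mul_pow, pow_add]; ring
      _ ≤ B ^ m * B' ^ n * (K * w.im ^ ((1 + t) / 2)) := by gcongr
      _ = _ := by ring

theorem im_smul_le_mul {h : GL (Fin 2) ℝ} (hh : h.val.det = 1) (z w : ℍ) :
    (h • z).im ≤ Real.exp (dist z w) * (h • w).im := by
  have h1 := UpperHalfPlane.im_le_im_mul_exp_dist (h • z) (h • w)
  rw [dist_smul_smul_of_det_eq_one hh] at h1
  linarith

/-- Heights of the images of two points differ at most by the factor `e^{dist}`, uniformly in the
group element. -/
theorem Summable.mul_im_rpow {ι : Type*} {u : ι → ℝ} {h : ι → GL (Fin 2) ℝ}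
    (hu : ∀ q, 0 ≤ u q) (hh : ∀ q, (h q).val.det = 1) {z₀ : ℍ} {t : ℝ} (ht : 0 ≤ t)
    (hs : Summable fun q => u q * (h q • z₀).im ^ t) (z : ℍ) :
    Summable fun q => u q * (h q • z).im ^ t := by
  refine Summable.of_nonneg_of_le (fun q => ?_) (fun q => ?_)
    (hs.mul_left (Real.exp (dist z z₀) ^ t))
  · have := (h q • z).im_pos
    have := hu q
    positivity
  · have := (h q • z).im_pos
    have := (h q • z₀).im_pos
    have := hu q
    calc u q * (h q • z).im ^ t ≤ u q * (Real.exp (dist z z₀) * (h q • z₀).im) ^ t := by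
          gcongr
          exact im_smul_le_mul (hh q) z z₀
      _ = _ := by
          rw [Real.mul_rpow (by positivity) (by positivity)]; ring

end Convergence

/-! ### Calculus with `∂/∂z` and `∂/∂z̄`. -/

section Wirtinger

open Complex

/-- The real-linear map `v ↦ A v + B conj v`. -/
def wirtinger (A B : ℂ) : ℂ →L[ℝ] ℂ :=
  A • ContinuousLinearMap.id ℝ ℂ + B • (conjCLE : ℂ →L[ℝ] ℂ)

@[simp] theorem wirtinger_apply (A B v : ℂ) : wirtinger A B v = A * v + B * conj v := by
  simp [wirtinger]

theorem norm_wirtinger_le (A B : ℂ) : ‖wirtinger A B‖ ≤ ‖A‖ + ‖B‖ := by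
  refine ContinuousLinearMap.opNorm_le_bound _ (by positivity) fun v => ?_
  rw [wirtinger_apply]
  refine (norm_add_le _ _).trans (le_of_eq ?_)
  rw [norm_mul, norm_mul, RCLike.norm_conj]; ring

theorem HasSum.wirtinger {ι : Type*} {a b : ι → ℂ} {A B : ℂ} (ha : HasSum a A) (hb : HasSum b B) :
    HasSum (fun i => wirtinger (a i) (b i)) (wirtinger A B) :=
  (ha.smul_const _).add (hb.smul_const _)

theorem ContDiffOn.wirtinger {n : WithTop ℕ∞} {U : Set ℂ} {a b : ℂ → ℂ}
    (ha : ContDiffOn ℝ n a U) (hb : ContDiffOn ℝ n b U) :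
    ContDiffOn ℝ n (fun w => wirtinger (a w) (b w)) U :=
  (ha.smul contDiffOn_const).add (hb.smul contDiffOn_const)

variable {F G : ℂ → ℂ} {A B A' B' w : ℂ}

theorem eq_wirtinger {L : ℂ →L[ℝ] ℂ} (h : ∀ v, L v = A * v + B * conj v) : L = wirtinger A B :=
  ContinuousLinearMap.ext fun v => by rw [h, wirtinger_apply]

theorem hasFDerivAt_wirtinger_id (w : ℂ) : HasFDerivAt (fun w : ℂ => w) (wirtinger 1 0) w :=
  (hasFDerivAt_id w).congr_fderiv (eq_wirtinger fun v => by simp)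

theorem hasFDerivAt_wirtinger_conj (w : ℂ) :
    HasFDerivAt (fun w : ℂ => conj w) (wirtinger 0 1) w :=
  ((conjCLE : ℂ →L[ℝ] ℂ).hasFDerivAt (x := w)).congr_fderiv (eq_wirtinger fun v => by simp)

theorem hasFDerivAt_wirtinger_im (w : ℂ) :
    HasFDerivAt (fun w : ℂ => (w.im : ℂ)) (wirtinger (1 / (2 * Complex.I)) (-1 / (2 * Complex.I)))
      w :=
  ((ofRealCLM.comp imCLM).hasFDerivAt (x := w)).congr_fderiv (eq_wirtinger fun v => by
    have h := Complex.sub_conj v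
    have hI := Complex.I_ne_zero
    push_cast at h
    simp only [ContinuousLinearMap.comp_apply, imCLM_apply, ofRealCLM_apply]
    field_simp
    linear_combination -h)

theorem HasDerivAt.comp_wirtinger {G' : ℂ} (hG : HasDerivAt G G' (F w))
    (hF : HasFDerivAt F (wirtinger A B) w) :
    HasFDerivAt (fun w => G (F w)) (wirtinger (G' * A) (G' * B)) w :=
  ((hG.hasFDerivAt.restrictScalars ℝ).comp w hF).congr_fderiv (eq_wirtinger fun v => by
    simp; ring)

theorem HasFDerivAt.mul_wirtinger (hF : HasFDerivAt F (wirtinger A B) w)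
    (hG : HasFDerivAt G (wirtinger A' B') w) :
    HasFDerivAt (fun w => F w * G w) (wirtinger (F w * A' + A * G w) (F w * B' + B * G w)) w :=
  (hF.mul hG).congr_fderiv (eq_wirtinger fun v => by simp; ring)

theorem dz_eq (h : HasFDerivAt F (wirtinger A B) w) : dz F w = A := by
  rw [dz, h.fderiv]
  simp
  linear_combination (B - A) / 2 * I_mul_I

theorem dzbar_eq (h : HasFDerivAt F (wirtinger A B) w) : dzbar F w = B := by
  rw [dzbar, h.fderiv]
  simp
  linear_combination (A - B) / 2 * I_mul_I

end Wirtinger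

/-! ### Raising and lowering the weight of a single term. -/

section PoincareTerm

open Complex

/-- `Im(g w)^s (conj j / j)^k` where `j = j(g, w)` is the automorphy factor. -/
def poincareTerm (g : GL (Fin 2) ℝ) (s : ℂ) (k : ℤ) (w : ℂ) : ℂ :=
  ((w.im : ℂ) * ((denom g w)⁻¹ * (conj (denom g w))⁻¹)) ^ s *
    (conj (denom g w) * (denom g w)⁻¹) ^ k

/-- The coefficient of the holomorphic derivative in terms of the neighbouring weights. -/
def raiseCoeff (s : ℂ) (P : ℤ → ℂ) (k : ℤ) (y : ℝ) : ℂ :=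
  (s * P (k + 1) + k * (P (k + 1) - P k)) / (2 * Complex.I * y)

/-- The coefficient of the antiholomorphic derivative in terms of the neighbouring weights. -/
def lowerCoeff (s : ℂ) (P : ℤ → ℂ) (k : ℤ) (y : ℝ) : ℂ :=
  (-s * P (k - 1) + k * (P (k - 1) - P k)) / (2 * Complex.I * y)

variable {g : GL (Fin 2) ℝ}

theorem im_mul_denom_eq (hg : g.val.det = 1) (z : ℍ) :
    ((z : ℂ).im : ℂ) * ((denom g z)⁻¹ * (conj (denom g z))⁻¹) = (((g • z).im : ℝ) : ℂ) := by
  rw [im_smul_eq_div_normSq, GeneralLinearGroup.val_det_apply, hg, ← mul_inv, Complex.mul_conj]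
  simp [div_eq_mul_inv]

theorem poincareTerm_zero (hg : g.val.det = 1) (s : ℂ) (z : ℍ) :
    poincareTerm g s 0 z = (((g • z).im : ℝ) : ℂ) ^ s := by
  rw [poincareTerm, im_mul_denom_eq hg, zpow_zero, mul_one]

theorem norm_poincareTerm (hg : g.val.det = 1) (s : ℂ) (k : ℤ) (z : ℍ) :
    ‖poincareTerm g s k z‖ = (g • z).im ^ s.re := by
  have hj : ‖denom g z‖ ≠ 0 := norm_ne_zero_iff.mpr (denom_ne_zero g z)
  rw [poincareTerm, im_mul_denom_eq hg, norm_mul, norm_cpow_eq_rpow_re_of_pos (g • z).im_pos,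
    norm_zpow, norm_mul, norm_inv, RCLike.norm_conj, mul_inv_cancel₀ hj, _root_.one_zpow, mul_one]

/-- These are the Maass operators: `2iy ∂/∂z + k` takes weight `k` to `(s + k)` times weight `k +
1`, and `2iy ∂/∂z̄ + k` takes it to `(k - s)` times weight `k - 1`. The coefficients are free of
`g`, so the formulas can be summed. -/
theorem hasFDerivAt_poincareTerm (hg : g.val.det = 1) (s : ℂ) (k : ℤ) (z : ℍ) :
    HasFDerivAt (poincareTerm g s k)
      (wirtinger (raiseCoeff s (fun k => poincareTerm g s k z) k z.im)
        (lowerCoeff s (fun k => poincareTerm g s k z) k z.im)) z := by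
  have hj : denom g z ≠ 0 := denom_ne_zero g z
  have hj' : conj (denom g z) ≠ 0 := (map_ne_zero _).mpr hj
  have hy : ((z.im : ℝ) : ℂ) ≠ 0 := ofReal_ne_zero.mpr z.im_ne_zero
  -- This relation eliminates the lower left entry of `g` from the derivative.
  have hrel : denom g z - conj (denom g z) = 2 * Complex.I * z.im * (g 1 0 : ℝ) := by
    apply Complex.ext <;> simp [denom]; ring
  have hlin : ∀ w, HasDerivAt (fun w : ℂ => (g 1 0 : ℂ) * w + (g 1 1 : ℂ)) (g 1 0 : ℂ) w := by
    intro w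
    simpa using ((hasDerivAt_id w).const_mul (g 1 0 : ℂ)).add_const (g 1 1 : ℂ)
  have h1 : HasFDerivAt (fun w : ℂ => denom g w) (wirtinger (g 1 0 : ℝ) 0) (z : ℂ) := by
    have := HasDerivAt.comp_wirtinger (hlin z) (hasFDerivAt_wirtinger_id (z : ℂ))
    rwa [mul_one, mul_zero] at this
  have h2 : HasFDerivAt (fun w : ℂ => conj (denom g w)) (wirtinger 0 (g 1 0 : ℝ)) (z : ℂ) := by
    have := HasDerivAt.comp_wirtinger (hlin (conj (z : ℂ))) (hasFDerivAt_wirtinger_conj (z : ℂ))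
    simpa [denom] using this
  have h1' := HasDerivAt.comp_wirtinger (F := fun w => denom g w) (hasDerivAt_inv hj) h1
  have h2' := HasDerivAt.comp_wirtinger (F := fun w => conj (denom g w)) (hasDerivAt_inv hj') h2
  set j := denom g z with hjdef
  set θ := conj j * j⁻¹ with hθ
  set Y := (((z : ℂ).im : ℝ) : ℂ) * (j⁻¹ * (conj j)⁻¹) with hY
  have hθ0 : θ ≠ 0 := mul_ne_zero hj' (inv_ne_zero hj)
  have hY0 : Y ≠ 0 := mul_ne_zero hy (mul_ne_zero (inv_ne_zero hj) (inv_ne_zero hj'))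
  have hYd := HasFDerivAt.mul_wirtinger (hasFDerivAt_wirtinger_im (z : ℂ))
    (HasFDerivAt.mul_wirtinger h1' h2')
  have hθd := HasFDerivAt.mul_wirtinger h2 h1'
  have hYslit : Y ∈ slitPlane := by
    rw [hY, hjdef, im_mul_denom_eq hg]
    exact ofReal_mem_slitPlane.mpr (g • z).im_pos
  have hYs := HasDerivAt.comp_wirtinger (G := fun u => u ^ s)
    ((hasDerivAt_id Y).cpow_const hYslit) hYd
  have hθk := HasDerivAt.comp_wirtinger (hasDerivAt_zpow k θ (Or.inl hθ0)) hθd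
  have := HasFDerivAt.mul_wirtinger hYs hθk
  refine this.congr_fderiv ?_
  have hc : ((g 1 0 : ℝ) : ℂ) = (j - conj j) / (2 * Complex.I * z.im) := by
    rw [hrel]; field_simp
  have hk1 : θ ^ (k + 1) = θ ^ k * θ := zpow_add_one₀ hθ0 k
  have hk2 : θ ^ (k - 1) = θ ^ k * θ⁻¹ := zpow_sub_one₀ hθ0 k
  have hs1 : Y ^ (s - 1) = Y ^ s * Y⁻¹ := by rw [cpow_sub _ _ hY0, cpow_one, div_eq_mul_inv]
  simp only [raiseCoeff, lowerCoeff, poincareTerm, ← hjdef, ← hθ, id, hk1, hk2, hs1, coe_im]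
  rw [coe_im] at hY
  rw [← hY]
  generalize Y ^ s = P
  generalize θ ^ k = Q
  rw [hθ, hY, hc]
  generalize conj j = j' at *
  congr 1
  · field_simp
    ring
  · field_simp
    ring

end PoincareTerm

/-! ### Termwise differentiation, smoothness and the eigenvalue. -/

section PoincareSeries

open Complex Topology

theorem norm_raiseCoeff_le {s : ℂ} {P : ℤ → ℂ} {k : ℤ} {y b : ℝ} (hy : 0 < y)
    (hP : ∀ k, ‖P k‖ ≤ b) : ‖raiseCoeff s P k y‖ ≤ (‖s‖ + 2 * |(k : ℝ)|) * b / (2 * y) := by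
  have h2 : ‖2 * Complex.I * (y : ℂ)‖ = 2 * y := by
    simp [abs_of_pos hy]
  rw [raiseCoeff, norm_div, h2]
  gcongr
  calc _ ≤ ‖s * P (k + 1)‖ + ‖(k : ℂ) * (P (k + 1) - P k)‖ := norm_add_le _ _
    _ ≤ ‖s‖ * b + |(k : ℝ)| * (b + b) := by
      rw [norm_mul, norm_mul, Complex.norm_intCast]
      gcongr
      · exact hP _
      · exact (norm_sub_le _ _).trans (add_le_add (hP _) (hP _))
    _ = _ := by ring

theorem norm_lowerCoeff_le {s : ℂ} {P : ℤ → ℂ} {k : ℤ} {y b : ℝ} (hy : 0 < y)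
    (hP : ∀ k, ‖P k‖ ≤ b) : ‖lowerCoeff s P k y‖ ≤ (‖s‖ + 2 * |(k : ℝ)|) * b / (2 * y) := by
  have h2 : ‖2 * Complex.I * (y : ℂ)‖ = 2 * y := by
    simp [abs_of_pos hy]
  rw [lowerCoeff, norm_div, h2]
  gcongr
  calc _ ≤ ‖-s * P (k - 1)‖ + ‖(k : ℂ) * (P (k - 1) - P k)‖ := norm_add_le _ _
    _ ≤ ‖s‖ * b + |(k : ℝ)| * (b + b) := by
      rw [norm_mul, norm_mul, Complex.norm_intCast, norm_neg]
      gcongr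
      · exact hP _
      · exact (norm_sub_le _ _).trans (add_le_add (hP _) (hP _))
    _ = _ := by ring

/-- The series `∑ c_q Im(h_q w)^s (conj j / j)^k`. -/
def poincareSeries {ι : Type*} (c : ι → ℂ) (h : ι → GL (Fin 2) ℝ) (s : ℂ) (k : ℤ) (w : ℂ) : ℂ :=
  ∑' q, c q * poincareTerm (h q) s k w

variable {ι : Type*} {c : ι → ℂ} {h : ι → GL (Fin 2) ℝ} {s : ℂ}

theorem hasSum_poincareSeries (hh : ∀ q, (h q).val.det = 1)
    (hs : ∀ z : ℍ, Summable fun q => ‖c q‖ * (h q • z).im ^ s.re) (k : ℤ) (z : ℍ) :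
    HasSum (fun q => c q * poincareTerm (h q) s k z) (poincareSeries c h s k z) :=
  (Summable.of_norm ((hs z).congr fun q => by
    rw [norm_mul, norm_poincareTerm (hh q)])).hasSum

theorem HasSum.raiseCoeff {P : ι → ℤ → ℂ} {Q : ℤ → ℂ} (hP : ∀ k, HasSum (fun q => P q k) (Q k))
    (k : ℤ) (y : ℝ) : HasSum (fun q => raiseCoeff s (P q) k y) (raiseCoeff s Q k y) :=
  (((hP _).mul_left _).add (((hP _).sub (hP _)).mul_left _)).div_const _

theorem HasSum.lowerCoeff {P : ι → ℤ → ℂ} {Q : ℤ → ℂ} (hP : ∀ k, HasSum (fun q => P q k) (Q k))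
    (k : ℤ) (y : ℝ) : HasSum (fun q => lowerCoeff s (P q) k y) (lowerCoeff s Q k y) :=
  (((hP _).mul_left _).add (((hP _).sub (hP _)).mul_left _)).div_const _

theorem mem_ball_half_im {z : ℍ} {w : ℂ} (hw : w ∈ Metric.ball (z : ℂ) (z.im / 2)) :
    ∃ v : ℍ, (v : ℂ) = w ∧ z.im / 2 ≤ v.im ∧ dist v z ≤ 9 := by
  rw [Metric.mem_ball, dist_eq_norm] at hw
  have h1 := (abs_le.mp ((Complex.abs_im_le_norm (w - z)).trans hw.le)).1
  have h2 : z.im / 2 ≤ w.im := by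
    simp only [sub_im, coe_im] at h1; linarith
  have hz := z.im_pos
  refine ⟨⟨w, by linarith⟩, rfl, h2, dist_le_of_cosh_dist_le (by norm_num) ?_⟩
  rw [UpperHalfPlane.cosh_dist]
  set v : ℍ := ⟨w, by linarith⟩ with hv
  have h3 : v.im = w.im := rfl
  have h4 : dist (v : ℂ) z ^ 2 ≤ (z.im / 2) ^ 2 := by
    rw [dist_eq_norm]
    gcongr
  have h5 : dist (v : ℂ) z ^ 2 / (2 * v.im * z.im) ≤ 4 := by
    rw [div_le_iff₀ (by have := v.im_pos; positivity)]
    rw [h3]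
    nlinarith
  linarith

/-- All weights have terms of the same absolute value, so the differentiated series is dominated
near `z` by a multiple of the original one. -/
theorem hasFDerivAt_poincareSeries (hh : ∀ q, (h q).val.det = 1)
    (hs : ∀ z : ℍ, Summable fun q => ‖c q‖ * (h q • z).im ^ s.re) (hs0 : 0 ≤ s.re) (k : ℤ) (z : ℍ) :
    HasFDerivAt (poincareSeries c h s k)
      (wirtinger (raiseCoeff s (fun k => poincareSeries c h s k z) k z.im)
        (lowerCoeff s (fun k => poincareSeries c h s k z) k z.im)) z := by
  have hz := z.im_pos
  set D : ι → ℂ → ℂ →L[ℝ] ℂ := fun q w =>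
    wirtinger (raiseCoeff s (fun k => c q * poincareTerm (h q) s k w) k w.im)
      (lowerCoeff s (fun k => c q * poincareTerm (h q) s k w) k w.im) with hD
  have hsum : HasSum (fun q => D q z) (wirtinger
      (raiseCoeff s (fun k => poincareSeries c h s k z) k z.im)
      (lowerCoeff s (fun k => poincareSeries c h s k z) k z.im)) :=
    HasSum.wirtinger
      (HasSum.raiseCoeff (P := fun q k => c q * poincareTerm (h q) s k z)
        (fun k => hasSum_poincareSeries hh hs k z) k z.im)
      (HasSum.lowerCoeff (P := fun q k => c q * poincareTerm (h q) s k z)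
        (fun k => hasSum_poincareSeries hh hs k z) k z.im)
  rw [← hsum.tsum_eq]
  refine hasFDerivAt_tsum_of_isPreconnected
    -- On the disc of radius `Im z / 2` heights are at least `Im z / 2` and hyperbolic distances to
    -- `z` at most `9`, whence the denominator and the factor `e^9`.
    (u := fun q => 2 * ((‖s‖ + 2 * |(k : ℝ)|) / (2 * (z.im / 2)) * Real.exp 9 ^ s.re *
      (‖c q‖ * (h q • z).im ^ s.re)))
    (((hs z).mul_left _).mul_left 2) Metric.isOpen_ball
    (convex_ball (z : ℂ) (z.im / 2)).isPreconnected
    (f := fun q w => c q * poincareTerm (h q) s k w) (f' := D) ?_ ?_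
    (Metric.mem_ball_self (by positivity)) (hasSum_poincareSeries hh hs k z).summable
    (Metric.mem_ball_self (by positivity))
  · intro q w hw
    obtain ⟨v, rfl, -, -⟩ := mem_ball_half_im hw
    refine ((hasFDerivAt_poincareTerm (hh q) s k v).const_mul (c q)).congr_fderiv
      (eq_wirtinger fun x => ?_)
    simp [raiseCoeff, lowerCoeff]
    ring
  · intro q w hw
    obtain ⟨v, rfl, hv, hd⟩ := mem_ball_half_im hw
    have hvp := v.im_pos
    have hqz := (h q • z).im_pos
    have hqv := (h q • v).im_pos
    have hP : ∀ k, ‖c q * poincareTerm (h q) s k v‖ ≤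
        ‖c q‖ * (Real.exp 9 * (h q • z).im) ^ s.re := fun k => by
      rw [norm_mul, norm_poincareTerm (hh q)]
      gcongr
      refine (im_smul_le_mul (hh q) v z).trans ?_
      gcongr
    refine (norm_wirtinger_le _ _).trans ((add_le_add (norm_raiseCoeff_le hvp hP)
      (norm_lowerCoeff_le hvp hP)).trans ?_)
    rw [← two_mul, Real.mul_rpow (by positivity) hqz.le]
    gcongr 2 * ?_
    rw [div_mul_eq_mul_div, div_mul_eq_mul_div, mul_assoc, mul_left_comm ‖c q‖]
    gcongr

/-- Induction on the order for all weights at once: the derivative in weight `k` involves only the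
weights `k - 1`, `k`, `k + 1` and `1 / y`. -/
theorem contDiffOn_poincareSeries (hh : ∀ q, (h q).val.det = 1)
    (hs : ∀ z : ℍ, Summable fun q => ‖c q‖ * (h q • z).im ^ s.re) (hs0 : 0 ≤ s.re) (k : ℤ) :
    ContDiffOn ℝ ∞ (poincareSeries c h s k) {w : ℂ | 0 < w.im} := by
  have hopen : IsOpen {w : ℂ | 0 < w.im} := isOpen_upperHalfPlaneSet
  rw [contDiffOn_infty]
  intro n
  induction n generalizing k with
  | zero =>
    rw [Nat.cast_zero, contDiffOn_zero]
    exact fun w hw =>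
      (hasFDerivAt_poincareSeries hh hs hs0 k ⟨w, hw⟩).continuousAt.continuousWithinAt
  | succ n ih =>
    rw [Nat.cast_succ, contDiffOn_succ_iff_fderiv_of_isOpen hopen]
    refine ⟨fun w hw => (hasFDerivAt_poincareSeries hh hs hs0 k
      ⟨w, hw⟩).differentiableAt.differentiableWithinAt, by simp, ?_⟩
    have him : ContDiffOn ℝ n (fun w : ℂ => 2 * Complex.I * ((w.im : ℝ) : ℂ)) {w : ℂ | 0 < w.im} :=
      (contDiff_const.mul (ofRealCLM.contDiff.comp imCLM.contDiff)).contDiffOn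
    have hne : ∀ w ∈ {w : ℂ | 0 < w.im}, 2 * Complex.I * ((w.im : ℝ) : ℂ) ≠ 0 := fun w hw => by
      simpa using (ne_of_gt hw)
    refine (ContDiffOn.wirtinger
      (a := fun w => raiseCoeff s (fun k => poincareSeries c h s k w) k w.im)
      (b := fun w => lowerCoeff s (fun k => poincareSeries c h s k w) k w.im) ?_ ?_).congr
      fun w hw => (hasFDerivAt_poincareSeries hh hs hs0 k ⟨w, hw⟩).fderiv
    · simp only [raiseCoeff, div_eq_mul_inv]
      exact ((contDiffOn_const.mul (ih _)).add
        (contDiffOn_const.mul ((ih _).sub (ih _)))).mul (him.inv hne)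
    · simp only [lowerCoeff, div_eq_mul_inv]
      exact ((contDiffOn_const.mul (ih _)).add
        (contDiffOn_const.mul ((ih _).sub (ih _)))).mul (him.inv hne)

/-- Lowering from weight `0` gives `-s` and raising back gives `s - 1`. The leftover term of weight
`-1` cancels against the derivative of `1 / y`. -/
theorem dz_dzbar_poincareSeries (hh : ∀ q, (h q).val.det = 1)
    (hs : ∀ z : ℍ, Summable fun q => ‖c q‖ * (h q • z).im ^ s.re) (hs0 : 0 ≤ s.re) (z : ℍ) :
    -4 * (z.im : ℂ) ^ 2 * dz (dzbar (poincareSeries c h s 0)) z =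
      s * (1 - s) * poincareSeries c h s 0 z := by
  have hz : ((z.im : ℝ) : ℂ) ≠ 0 := ofReal_ne_zero.mpr z.im_ne_zero
  have h1 : HasFDerivAt (fun w : ℂ => (-s / (2 * Complex.I) * (w.im : ℂ)⁻¹) *
      poincareSeries c h s (-1) w) _ (z : ℂ) :=
    HasFDerivAt.mul_wirtinger
      (HasDerivAt.comp_wirtinger (F := fun w : ℂ => (w.im : ℂ))
        (G := fun u => -s / (2 * Complex.I) * u⁻¹)
        ((hasDerivAt_inv hz).const_mul _) (hasFDerivAt_wirtinger_im (z : ℂ)))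
      (hasFDerivAt_poincareSeries hh hs hs0 (-1) z)
  have h2 : dzbar (poincareSeries c h s 0) =ᶠ[𝓝 (z : ℂ)] fun w : ℂ =>
      (-s / (2 * Complex.I) * (w.im : ℂ)⁻¹) * poincareSeries c h s (-1) w := by
    filter_upwards [isOpen_upperHalfPlaneSet.mem_nhds z.im_pos] with w hw
    rw [dzbar_eq (hasFDerivAt_poincareSeries hh hs hs0 0 ⟨w, hw⟩)]
    have hw' : ((w.im : ℝ) : ℂ) ≠ 0 := ofReal_ne_zero.mpr (ne_of_gt hw)
    simp only [lowerCoeff]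
    change (_ / (2 * Complex.I * ((w.im : ℝ) : ℂ)) : ℂ) = _
    simp
    field_simp
  rw [dz_eq (h1.congr_of_eventuallyEq h2)]
  simp only [raiseCoeff]
  norm_num
  field_simp
  rw [Complex.I_sq]
  ring

end PoincareSeries

/-! ### Transfer to functions on `ℍ`. -/

section EigenfunctionOnUpperHalfPlane

open Filter Topology

theorem dz_congr {F G : ℂ → ℂ} {w : ℂ} (h : F =ᶠ[𝓝 w] G) : dz F w = dz G w := by
  rw [dz, dz, h.fderiv_eq]

theorem dzbar_congr {F G : ℂ → ℂ} {w : ℂ} (h : F =ᶠ[𝓝 w] G) : dzbar F =ᶠ[𝓝 w] dzbar G := by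
  filter_upwards [h.fderiv (𝕜 := ℝ)] with v hv
  rw [dzbar, dzbar, hv]

theorem comp_ofComplex_eventuallyEq {u : ℍ → ℂ} {F : ℂ → ℂ} (h : ∀ z : ℍ, u z = F z) (z : ℍ) :
    (fun w => u (ofComplex w)) =ᶠ[𝓝 (z : ℂ)] F := by
  filter_upwards [isOpen_upperHalfPlaneSet.mem_nhds z.im_pos] with w hw
  rw [h, ofComplex_apply_of_im_pos hw]

variable {ι : Type*} {c : ι → ℂ} {h : ι → GL (Fin 2) ℝ} {s : ℂ} {u : ℍ → ℂ}

theorem isSmooth_of_eq_poincareSeries (hh : ∀ q, (h q).val.det = 1)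
    (hs : ∀ z : ℍ, Summable fun q => ‖c q‖ * (h q • z).im ^ s.re) (hs0 : 0 ≤ s.re)
    (hu : ∀ z : ℍ, u z = poincareSeries c h s 0 z) : IsSmooth u :=
  (contDiffOn_poincareSeries hh hs hs0 0).congr fun w hw => by
    rw [hu, ofComplex_apply_of_im_pos hw]

theorem hyperbolicLaplacian_of_eq_poincareSeries (hh : ∀ q, (h q).val.det = 1)
    (hs : ∀ z : ℍ, Summable fun q => ‖c q‖ * (h q • z).im ^ s.re) (hs0 : 0 ≤ s.re)
    (hu : ∀ z : ℍ, u z = poincareSeries c h s 0 z) (z : ℍ) :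
    hyperbolicLaplacian u z = s * (1 - s) * u z := by
  rw [hyperbolicLaplacian, dz_congr (dzbar_congr (comp_ofComplex_eventuallyEq hu z)), hu,
    dz_dzbar_poincareSeries hh hs hs0]

end EigenfunctionOnUpperHalfPlane

/-! ### The representation as a composition of binomial expansions. -/

section Representation

open Finset

/-- Compare the coefficients of `X^q` in `((X + y) + x)^p = (X + (x + y))^p`. -/
theorem sum_choose_mul_choose (p q : ℕ) {m : ℕ} (hp : p ≤ m) (x y : ℂ) :
    ∑ k ∈ range (m + 1), (p.choose k * x ^ (p - k)) * (k.choose q * y ^ (k - q)) =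
      p.choose q * (x + y) ^ (p - q) := by
  have h1 : ((Polynomial.X + Polynomial.C y) + Polynomial.C x) ^ p =
      (Polynomial.X + Polynomial.C (x + y)) ^ p := by
    rw [Polynomial.C_add]; ring
  have h2 := congrArg (fun P => Polynomial.coeff P q) h1
  simp only [add_pow (Polynomial.X + Polynomial.C y), Polynomial.finsetSum_coeff,
    Polynomial.coeff_X_add_C_pow, ← Polynomial.C_pow, ← Polynomial.C_eq_natCast,
    Polynomial.coeff_mul_C] at h2
  rw [mul_comm, ← h2]
  symm
  refine (sum_subset (range_mono (by omega)) fun k _ hk => ?_).trans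
    (sum_congr rfl fun k _ => ?_)
  · rw [mem_range, not_lt] at hk
    simp [Nat.choose_eq_zero_of_lt (show p < k by omega)]
  · ring

theorem sum_choose_mul_pow {p m : ℕ} (hp : p ≤ m) (x y : ℂ) :
    ∑ k ∈ range (m + 1), (p.choose k * x ^ (p - k)) * y ^ k = (x + y) ^ p := by
  simpa using sum_choose_mul_choose p 0 hp x y

namespace EisIndex

variable {m n r : ℕ}

theorem fst_le (I : EisIndex m n r) : I.fst ≤ m := Nat.lt_succ_iff.mp (ofLex I).1.2

theorem snd_le (I : EisIndex m n r) : I.snd ≤ n := Nat.lt_succ_iff.mp (ofLex (ofLex I).2).1.2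

theorem ext {I J : EisIndex m n r} (h1 : I.fst = J.fst) (h2 : I.snd = J.snd)
    (h3 : I.cusp = J.cusp) : I = J :=
  ofLex.injective (Prod.ext (Fin.ext h1) (ofLex.injective (Prod.ext (Fin.ext h2) h3)))

theorem lt_cases {I J : EisIndex m n r} (h : I < J) :
    I.fst < J.fst ∨ I.snd < J.snd ∨ I.cusp ≠ J.cusp := by
  rcases Prod.Lex.lt_iff.mp h with h1 | ⟨-, h1⟩
  · exact Or.inl h1
  rcases Prod.Lex.lt_iff.mp h1 with h2 | ⟨-, h2⟩
  · exact Or.inr (Or.inl h2)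
  · exact Or.inr (Or.inr h2.ne)

theorem sum_univ (F : ℕ → ℕ → Fin r → ℂ) :
    ∑ J : EisIndex m n r, F (m - J.fst) (n - J.snd) J.cusp =
      ∑ k ∈ range (m + 1), ∑ l ∈ range (n + 1), ∑ c, F k l c := by
  have h1 : ∑ J : EisIndex m n r, F (m - J.fst) (n - J.snd) J.cusp =
      ∑ i : Fin (m + 1), ∑ j : Fin (n + 1), ∑ c, F (m - i) (n - j) c := by
    rw [← Equiv.sum_comp toLex, Fintype.sum_prod_type]
    refine sum_congr rfl fun i _ => ?_
    rw [← Equiv.sum_comp toLex, Fintype.sum_prod_type]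
    rfl
  rw [h1, Fin.sum_univ_eq_sum_range fun i => ∑ j : Fin (n + 1), ∑ c, F (m - i) (n - j) c,
    sum_flip fun k => ∑ j : Fin (n + 1), ∑ c, F k (n - j) c]
  refine sum_congr rfl fun k _ => ?_
  rw [Fin.sum_univ_eq_sum_range fun j => ∑ c, F k (n - j) c, sum_flip fun l => ∑ c, F k l c]

end EisIndex

variable {Γ : Subgroup (GL (Fin 2) ℝ)} (χ : Γ →* Circle) (f g : CuspForm Γ 2) (z₀ : ℍ)
  {m n r : ℕ}

/-- In the reversed indices `m - i₁`, `n - i₂` the entries are the coefficients of a substitution `X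
↦ X + x` in each variable, the form that `EisIndex.sum_univ` and the binomial sums require. -/
theorem piMatrix_apply (γ : Γ) (I J : EisIndex m n r) :
    piMatrix Γ χ f g z₀ m n r γ I J = conj (χ γ : ℂ) *
      (((m - I.fst).choose (m - J.fst) : ℂ) *
        (-modularSymbol f z₀ γ) ^ ((m - I.fst) - (m - J.fst))) *
      (((n - I.snd).choose (n - J.snd) : ℂ) *
        (-conj (modularSymbol g z₀ γ)) ^ ((n - I.snd) - (n - J.snd))) *
      (if I.cusp = J.cusp then 1 else 0) := by
  have h1 := I.fst_le
  have h2 := J.fst_le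
  have h3 := I.snd_le
  have h4 := J.snd_le
  rw [piMatrix, of_apply, symbolFactor,
    show (m - I.fst) - (m - J.fst) = J.fst - I.fst by omega,
    show (n - I.snd) - (n - J.snd) = J.snd - I.snd by omega]
  ring

theorem choose_mul_zero_pow_eq (p q : ℕ) :
    (p.choose q : ℂ) * 0 ^ (p - q) = if p = q then 1 else 0 := by
  rcases lt_trichotomy p q with h | rfl | h
  · simp [Nat.choose_eq_zero_of_lt h, h.ne]
  · simp
  · rw [zero_pow (by omega), mul_zero, if_neg h.ne']

theorem conj_circle_mul_self (u : Circle) : conj (u : ℂ) * (u : ℂ) = 1 := by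
  rw [mul_comm, Complex.mul_conj, Circle.normSq_coe, Complex.ofReal_one]

theorem piMatrix_apply_of_lt (γ : Γ) {I J : EisIndex m n r} (h : J < I) :
    piMatrix Γ χ f g z₀ m n r γ I J = 0 := by
  rw [piMatrix_apply]
  have h1 := I.fst_le
  have h3 := I.snd_le
  rcases EisIndex.lt_cases h with h | h | h
  · rw [Nat.choose_eq_zero_of_lt (show m - I.fst < m - J.fst by omega)]; simp
  · rw [Nat.choose_eq_zero_of_lt (show n - I.snd < n - J.snd by omega)]; simp
  · rw [if_neg h.symm, mul_zero]

theorem piMatrix_apply_self (γ : Γ) (I : EisIndex m n r) :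
    piMatrix Γ χ f g z₀ m n r γ I I = conj (χ γ : ℂ) := by
  rw [piMatrix_apply]; simp

theorem blockTriangular_piMatrix (γ : Γ) : (piMatrix Γ χ f g z₀ m n r γ).BlockTriangular id :=
  fun _ _ h => piMatrix_apply_of_lt χ f g z₀ γ h

/-- The characteristic polynomial is a power of `X`; apply Cayley-Hamilton. -/
theorem isNilpotent_of_strictly_upperTriangular {ι : Type*} [Fintype ι] [DecidableEq ι]
    [LinearOrder ι] {A : Matrix ι ι ℂ} (hA : A.BlockTriangular id) (hd : ∀ i, A i i = 0) :
    IsNilpotent A := by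
  have h1 := Matrix.charpoly_of_isUpperTriangular A hA
  simp only [hd, map_zero, sub_zero, prod_const] at h1
  have h2 := Matrix.aeval_self_charpoly A
  rw [h1, map_pow, Polynomial.aeval_X] at h2
  exact ⟨_, h2⟩

theorem smul_piMatrix_mem_uni (γ : Γ) :
    (χ γ : ℂ) • piMatrix Γ χ f g z₀ m n r γ ∈ Uni (EisIndex m n r) := by
  refine isNilpotent_of_strictly_upperTriangular (fun I J (h : J < I) => ?_) fun I => ?_
  · have hne : I ≠ J := ne_of_gt h
    rw [Matrix.sub_apply, Matrix.smul_apply, piMatrix_apply_of_lt χ f g z₀ γ h,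
      Matrix.one_apply_ne hne, smul_zero, sub_zero]
  · rw [Matrix.sub_apply, Matrix.smul_apply, piMatrix_apply_self, Matrix.one_apply_eq, smul_eq_mul,
      mul_comm, conj_circle_mul_self, sub_self]

variable [Γ.HasDetOne]

theorem piMatrix_one : piMatrix Γ χ f g z₀ m n r 1 = 1 := by
  ext I J
  have h1 := I.fst_le
  have h2 := J.fst_le
  have h3 := I.snd_le
  have h4 := J.snd_le
  rw [piMatrix_apply, Subgroup.coe_one, modularSymbol_one, modularSymbol_one, map_zero, neg_zero,
    choose_mul_zero_pow_eq, choose_mul_zero_pow_eq, map_one, Circle.coe_one, map_one, one_mul]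
  by_cases h : I = J
  · subst h; simp
  · rw [Matrix.one_apply_ne h]
    by_cases e1 : m - I.fst = m - J.fst
    · by_cases e2 : n - I.snd = n - J.snd
      · rw [if_neg fun e3 => h (EisIndex.ext (by omega) (by omega) e3), mul_zero]
      · simp [e2]
    · simp [e1]

theorem piMatrix_mul (γ δ : Γ) : piMatrix Γ χ f g z₀ m n r (γ * δ) =
    piMatrix Γ χ f g z₀ m n r γ * piMatrix Γ χ f g z₀ m n r δ := by
  ext I J
  rw [Matrix.mul_apply]
  simp only [piMatrix_apply]
  rw [EisIndex.sum_univ fun k l c => (conj (χ γ : ℂ) *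
      (((m - I.fst).choose k : ℂ) * (-modularSymbol f z₀ γ) ^ ((m - I.fst) - k)) *
      (((n - I.snd).choose l : ℂ) * (-conj (modularSymbol g z₀ γ)) ^ ((n - I.snd) - l)) *
      (if I.cusp = c then 1 else 0)) * (conj (χ δ : ℂ) *
      ((k.choose (m - J.fst) : ℂ) * (-modularSymbol f z₀ δ) ^ (k - (m - J.fst))) *
      ((l.choose (n - J.snd) : ℂ) * (-conj (modularSymbol g z₀ δ)) ^ (l - (n - J.snd))) *
      (if c = J.cusp then 1 else 0))]
  have hf := sum_choose_mul_choose (m - I.fst) (m - J.fst) (Nat.sub_le m I.fst)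
    (-modularSymbol f z₀ γ) (-modularSymbol f z₀ δ)
  have hg := sum_choose_mul_choose (n - I.snd) (n - J.snd) (Nat.sub_le n I.snd)
    (-conj (modularSymbol g z₀ γ)) (-conj (modularSymbol g z₀ δ))
  rw [Subgroup.coe_mul, modularSymbol_mul f z₀ γ.2 δ.2, modularSymbol_mul g z₀ γ.2 δ.2, map_add,
    neg_add, neg_add, ← hf, ← hg, map_mul, Circle.coe_mul, map_mul]
  simp only [mul_sum, sum_mul]
  rw [sum_comm]
  refine sum_congr rfl fun k _ => sum_congr rfl fun l _ => ?_
  rw [sum_eq_single I.cusp]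
  · simp only [if_true]; ring
  · intro c _ hc
    rw [if_neg hc.symm]; ring
  · simp

/-- The representation `π^{m,n}`. -/
def piHom (m n r : ℕ) : Γ →* Matrix (EisIndex m n r) (EisIndex m n r) ℂ where
  toFun := piMatrix Γ χ f g z₀ m n r
  map_one' := piMatrix_one χ f g z₀
  map_mul' := piMatrix_mul χ f g z₀

end Representation

/-! ### The transformation law of the vector of series. -/

section Equivariance

open Finset

variable {Γ : Subgroup (GL (Fin 2) ℝ)} {c : OnePoint ℝ}

/-- Left invariance under the stabilizer makes the arbitrary choice in `Quotient.out` harmless. -/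
theorem apply_out_mk {α : Type*} {F : Γ → α} (hF : ∀ δ γ : Γ, δ • c = c → F (δ * γ) = F γ)
    (γ : Γ) : F (Quotient.mk (QuotientGroup.rightRel (MulAction.stabilizer Γ c)) γ).out = F γ := by
  have h := Quotient.mk_out (s := QuotientGroup.rightRel (MulAction.stabilizer Γ c)) γ
  rw [QuotientGroup.rightRel_apply] at h
  rw [← hF _ _ h, inv_mul_cancel_right]

/-- Right translation of the cosets `Γ_c \ Γ`. -/
def cosetMulRight (c : OnePoint ℝ) (γ : Γ) : CuspCosets Γ c ≃ CuspCosets Γ c :=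
  Quotient.congr (Equiv.mulRight γ) fun x y => by
    rw [QuotientGroup.rightRel_apply, QuotientGroup.rightRel_apply]
    simp

theorem apply_out_cosetMulRight {α : Type*} {F : Γ → α}
    (hF : ∀ δ γ : Γ, δ • c = c → F (δ * γ) = F γ) (γ : Γ) (q : CuspCosets Γ c) :
    F (cosetMulRight c γ q).out = F (q.out * γ) := by
  conv_lhs => rw [← q.out_eq]
  exact apply_out_mk hF (q.out * γ)

variable [Γ.HasDetOne] {σ : SL(2, ℝ)} {χ : Γ →* Circle} {f g : CuspForm Γ 2} {z₀ : ℍ} {m n r : ℕ}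

/-- Write `⟨τ⟩ = ⟨τγ⟩ - ⟨γ⟩` and `χ(τ) = conj χ(γ) χ(τγ)`, then expand both powers. The ranges run
to `m` and `n`; the extra binomial coefficients vanish. -/
theorem eisensteinTerm_smul {p p' : ℕ} (hp : p ≤ m) (hp' : p' ≤ n) (s : ℂ) (γ : Γ) (z : ℍ)
    (τ : Γ) : eisensteinTerm Γ χ f g z₀ σ p p' s (γ • z) τ =
      ∑ k ∈ range (m + 1), ∑ l ∈ range (n + 1), conj (χ γ : ℂ) *
        ((p.choose k : ℂ) * (-modularSymbol f z₀ γ) ^ (p - k)) *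
        ((p'.choose l : ℂ) * (-conj (modularSymbol g z₀ γ)) ^ (p' - l)) *
        eisensteinTerm Γ χ f g z₀ σ k l s z (τ * γ) := by
  have hf := sum_choose_mul_pow hp (-modularSymbol f z₀ γ)
    (modularSymbol f z₀ ((τ * γ : Γ) : GL (Fin 2) ℝ))
  have hg := sum_choose_mul_pow hp' (-conj (modularSymbol g z₀ γ))
    (conj (modularSymbol g z₀ ((τ * γ : Γ) : GL (Fin 2) ℝ)))
  have ef : -modularSymbol f z₀ γ + modularSymbol f z₀ ((τ * γ : Γ) : GL (Fin 2) ℝ) =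
      modularSymbol f z₀ τ := by
    rw [Subgroup.coe_mul, modularSymbol_mul f z₀ τ.2 γ.2]; ring
  have eg : -conj (modularSymbol g z₀ γ) +
      conj (modularSymbol g z₀ ((τ * γ : Γ) : GL (Fin 2) ℝ)) = conj (modularSymbol g z₀ τ) := by
    rw [Subgroup.coe_mul, modularSymbol_mul g z₀ τ.2 γ.2, map_add]; ring
  have eχ : (χ τ : ℂ) = conj (χ γ : ℂ) * (χ (τ * γ) : ℂ) := by
    rw [map_mul, Circle.coe_mul]
    linear_combination -(χ τ : ℂ) * conj_circle_mul_self (χ γ)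
  have ez : ((σ : GL (Fin 2) ℝ)⁻¹ * (τ : GL (Fin 2) ℝ)) • γ • z =
      ((σ : GL (Fin 2) ℝ)⁻¹ * ((τ * γ : Γ) : GL (Fin 2) ℝ)) • z := by
    rw [Subgroup.coe_mul, ← mul_assoc]
    exact (mul_smul _ _ z).symm
  rw [ef] at hf
  rw [eg] at hg
  simp only [eisensteinTerm]
  rw [ez, eχ, ← hf, ← hg]
  simp only [mul_sum, sum_mul]
  rw [sum_comm]
  refine sum_congr rfl fun k _ => sum_congr rfl fun l _ => ?_
  ring

theorem eisensteinSeries_smul {s : ℂ} {z : ℍ}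
    (hinv : ∀ (k l : ℕ) (δ γ : Γ), δ • c = c → eisensteinTerm Γ χ f g z₀ σ k l s z (δ * γ) =
      eisensteinTerm Γ χ f g z₀ σ k l s z γ)
    (hsum : ∀ k l : ℕ, Summable fun q : CuspCosets Γ c =>
      eisensteinTerm Γ χ f g z₀ σ k l s z q.out)
    {p p' : ℕ} (hp : p ≤ m) (hp' : p' ≤ n) (γ : Γ) :
    eisensteinSeries Γ χ f g z₀ c σ p p' (γ • z) s =
      ∑ k ∈ range (m + 1), ∑ l ∈ range (n + 1), conj (χ γ : ℂ) *
        ((p.choose k : ℂ) * (-modularSymbol f z₀ γ) ^ (p - k)) *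
        ((p'.choose l : ℂ) * (-conj (modularSymbol g z₀ γ)) ^ (p' - l)) *
        eisensteinSeries Γ χ f g z₀ c σ k l z s := by
  have h1 : ∀ k l, HasSum (fun q : CuspCosets Γ c =>
      eisensteinTerm Γ χ f g z₀ σ k l s z (q.out * γ))
      (eisensteinSeries Γ χ f g z₀ c σ k l z s) := fun k l => by
    have h2 := (cosetMulRight c γ).hasSum_iff.mpr (hsum k l).hasSum
    refine h2.congr_fun fun q => ?_
    exact (apply_out_cosetMulRight (hinv k l) γ q).symm
  rw [eisensteinSeries]
  simp_rw [eisensteinTerm_smul hp hp']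
  exact (hasSum_sum fun k _ => hasSum_sum fun l _ => (h1 k l).mul_left _).tsum_eq

theorem eisensteinVector_smul {a : Fin r → OnePoint ℝ} {σ : Fin r → SL(2, ℝ)} {s : ℂ} {z : ℍ}
    (hinv : ∀ (i : Fin r) (k l : ℕ) (δ γ : Γ), δ • a i = a i →
      eisensteinTerm Γ χ f g z₀ (σ i) k l s z (δ * γ) =
        eisensteinTerm Γ χ f g z₀ (σ i) k l s z γ)
    (hsum : ∀ (i : Fin r) (k l : ℕ), Summable fun q : CuspCosets Γ (a i) =>
      eisensteinTerm Γ χ f g z₀ (σ i) k l s z q.out) (γ : Γ) :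
    eisensteinVector Γ χ f g z₀ a σ m n (γ • z) s =
      piMatrix Γ χ f g z₀ m n r γ *ᵥ eisensteinVector Γ χ f g z₀ a σ m n z s := by
  ext I
  rw [Matrix.mulVec, dotProduct]
  simp only [piMatrix_apply, eisensteinVector]
  rw [EisIndex.sum_univ fun k l c => conj (χ γ : ℂ) *
      (((m - I.fst).choose k : ℂ) * (-modularSymbol f z₀ γ) ^ ((m - I.fst) - k)) *
      (((n - I.snd).choose l : ℂ) * (-conj (modularSymbol g z₀ γ)) ^ ((n - I.snd) - l)) *
      (if I.cusp = c then 1 else 0) * eisensteinSeries Γ χ f g z₀ (a c) (σ c) k l z s,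
    eisensteinSeries_smul (hinv I.cusp) (hsum I.cusp) (Nat.sub_le m I.fst) (Nat.sub_le n I.snd) γ]
  refine sum_congr rfl fun k _ => sum_congr rfl fun l _ => ?_
  rw [sum_eq_single I.cusp]
  · simp
  · intro c _ hc
    rw [if_neg hc.symm]; ring
  · simp

end Equivariance

/-! ### Descent to a section of the flat bundle. -/

section Bundle

variable {Γ : Subgroup (GL (Fin 2) ℝ)} {ι : Type} [Fintype ι] [DecidableEq ι]

/-- Equivariance says exactly that the class of `(z, u z)` depends only on the orbit of `z`. -/
theorem exists_section_of_equivariant (π : Γ →* Matrix ι ι ℂ) {u : ℍ → ι → ℂ}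
    (hu : ∀ (γ : Γ) (z : ℍ), u (γ • z) = π γ *ᵥ u z) :
    ∃ sec : MulAction.orbitRel.Quotient Γ ℍ → FlatBundle π,
      (∀ p, FlatBundle.proj π (sec p) = p) ∧
      ∀ z : ℍ, sec (Quotient.mk (MulAction.orbitRel Γ ℍ) z) = FlatBundle.mk π z (u z) := by
  refine ⟨Quotient.lift (fun z => FlatBundle.mk π z (u z)) ?_, ?_, fun z => rfl⟩
  · rintro _ w ⟨γ, rfl⟩
    exact (Quotient.sound (s := flatSetoid π) ⟨γ, rfl, (hu γ w).symm⟩).symm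
  · rintro ⟨z⟩
    rfl

end Bundle

/-! ### Eisenstein series as Poincaré series of weight zero, and the theorem. -/

section EisensteinSeries

variable {Γ : Subgroup (GL (Fin 2) ℝ)} [Γ.HasDetOne] {c : OnePoint ℝ} {σ : SL(2, ℝ)}
  {χ : Γ →* Circle} {f g : CuspForm Γ 2} {z₀ : ℍ}

theorem eisensteinSeries_eq_poincareSeries (σ : SL(2, ℝ)) (m n : ℕ) (s : ℂ) (z : ℍ) :
    eisensteinSeries Γ χ f g z₀ c σ m n z s =
      poincareSeries (fun q : CuspCosets Γ c => symbolWeight χ f g z₀ m n q.out)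
        (fun q => (σ : GL (Fin 2) ℝ)⁻¹ * (q.out : Γ)) s 0 z := by
  refine tsum_congr fun q => ?_
  rw [poincareTerm_zero (det_mul_eq_one (det_inv_eq_one (det_coe_eq_one σ))
    (det_eq_one_of_mem q.out.2)), eisensteinTerm_eq]

theorem summable_symbolWeight_mul_im_rpow [DiscreteTopology Γ] (hσ : IsScalingMatrix Γ c σ)
    (hc : IsCusp c Γ) (hχ : ∀ γ : Γ, γ • c = c → χ γ = 1)
    (hf : ∃ C : ℝ, ∀ z : ℍ, z.im * ‖f z‖ ≤ C) (hg : ∃ C : ℝ, ∀ z : ℍ, z.im * ‖g z‖ ≤ C)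
    (m n : ℕ) {t : ℝ} (ht : 1 < t) (z : ℍ) :
    Summable fun q : CuspCosets Γ c => ‖symbolWeight χ f g z₀ m n q.out‖ *
      (((σ : GL (Fin 2) ℝ)⁻¹ * (q.out : Γ)) • z).im ^ t :=
  Summable.mul_im_rpow (fun _ => norm_nonneg _)
    (fun q => det_mul_eq_one (det_inv_eq_one (det_coe_eq_one σ)) (det_eq_one_of_mem q.out.2))
    (by linarith) (summable_norm_symbolWeight_mul hσ hc hχ hf hg m n ht) z

end EisensteinSeries

end HigherEisenstein

end

theorem theorem2p1
    (Γ : Subgroup (GL (Fin 2) ℝ)) [Γ.HasDetOne] [DiscreteTopology Γ]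
    (hΓ : HigherEisenstein.HasFiniteCovolume Γ)
    {r : ℕ} (a : Fin r → OnePoint ℝ) (ha : HigherEisenstein.IsCuspRepresentatives Γ a)
    (σ : Fin r → SL(2, ℝ)) (hσ : ∀ i, HigherEisenstein.IsScalingMatrix Γ (a i) (σ i))
    (f g : CuspForm Γ 2)
    (χ : Γ →* Circle) (hχ : ∀ (i : Fin r) (γ : Γ), γ • a i = a i → χ γ = 1)
    (z₀ : ℍ) (m n : ℕ) :
    -- for `Re s > 1` the series are well defined on cosets and converge absolutely
    (∀ (i : Fin r) (k l : ℕ) (s : ℂ), 1 < s.re → ∀ z : ℍ,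
      (∀ δ γ : Γ, δ • a i = a i →
        HigherEisenstein.eisensteinTerm Γ χ f g z₀ (σ i) k l s z (δ * γ) =
          HigherEisenstein.eisensteinTerm Γ χ f g z₀ (σ i) k l s z γ) ∧
      Summable fun q : HigherEisenstein.CuspCosets Γ (a i) =>
        ‖HigherEisenstein.eisensteinTerm Γ χ f g z₀ (σ i) k l s z q.out‖) ∧
    ∃ π : Γ →* Matrix (HigherEisenstein.EisIndex m n r) (HigherEisenstein.EisIndex m n r) ℂ,
      -- `π` is the explicit one
      (∀ γ : Γ, π γ = HigherEisenstein.piMatrix Γ χ f g z₀ m n r γ) ∧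
      -- up to the character `conj χ` it is unipotent, and it is upper triangular
      (∀ γ : Γ, (χ γ : ℂ) • π γ ∈ HigherEisenstein.Uni (HigherEisenstein.EisIndex m n r)) ∧
      (∀ γ : Γ, (π γ).BlockTriangular id) ∧
      -- `𝔼(γ z, s) = π(γ) 𝔼(z, s)`
      (∀ s : ℂ, 1 < s.re → ∀ (γ : Γ) (z : ℍ),
        HigherEisenstein.eisensteinVector Γ χ f g z₀ a σ m n (γ • z) s =
          π γ *ᵥ HigherEisenstein.eisensteinVector Γ χ f g z₀ a σ m n z s) ∧
      -- `Δ 𝔼 = s (1 - s) 𝔼`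
      (∀ s : ℂ, 1 < s.re → ∀ (z : ℍ) (I : HigherEisenstein.EisIndex m n r),
        HigherEisenstein.hyperbolicLaplacian
            (fun w => HigherEisenstein.eisensteinVector Γ χ f g z₀ a σ m n w s I) z =
          s * (1 - s) * HigherEisenstein.eisensteinVector Γ χ f g z₀ a σ m n z s I) ∧
      -- `𝔼(·, s)` is a smooth eigensection of the bundle attached to `π`
      (∀ s : ℂ, 1 < s.re →
        HigherEisenstein.IsEigensection π (s * (1 - s))
          (fun z => HigherEisenstein.eisensteinVector Γ χ f g z₀ a σ m n z s)) := by
  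
  have hc := ha.1
  have hf := HigherEisenstein.exists_im_mul_norm_le hΓ ha hσ f
  have hg := HigherEisenstein.exists_im_mul_norm_le hΓ ha hσ g
  have hdet : ∀ (i : Fin r) (q : HigherEisenstein.CuspCosets Γ (a i)),
      ((σ i : GL (Fin 2) ℝ)⁻¹ * (q.out : Γ)).val.det = 1 := fun i q =>
    HigherEisenstein.det_mul_eq_one
      (HigherEisenstein.det_inv_eq_one (HigherEisenstein.det_coe_eq_one (σ i)))
      (HigherEisenstein.det_eq_one_of_mem q.out.2)
  have hs : ∀ (i : Fin r) (k l : ℕ) (s : ℂ), 1 < s.re → ∀ z : ℍ,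
      Summable fun q : HigherEisenstein.CuspCosets Γ (a i) =>
        ‖HigherEisenstein.symbolWeight χ f g z₀ k l q.out‖ *
          (((σ i : GL (Fin 2) ℝ)⁻¹ * (q.out : Γ)) • z).im ^ s.re := fun i k l s h z =>
    HigherEisenstein.summable_symbolWeight_mul_im_rpow (hσ i) (hc i) (hχ i) hf hg k l h z
  have hinv : ∀ (i : Fin r) (k l : ℕ) (s : ℂ) (z : ℍ) (δ γ : Γ), δ • a i = a i →
      HigherEisenstein.eisensteinTerm Γ χ f g z₀ (σ i) k l s z (δ * γ) =
        HigherEisenstein.eisensteinTerm Γ χ f g z₀ (σ i) k l s z γ := fun i k l s z δ γ h =>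
    HigherEisenstein.eisensteinTerm_mul_left (hσ i) (hc i) (hχ i) k l s z h γ
  have hsum : ∀ (i : Fin r) (k l : ℕ) (s : ℂ), 1 < s.re → ∀ z : ℍ,
      Summable fun q : HigherEisenstein.CuspCosets Γ (a i) =>
        ‖HigherEisenstein.eisensteinTerm Γ χ f g z₀ (σ i) k l s z q.out‖ := fun i k l s h z =>
    (hs i k l s h z).congr fun q => by
      rw [HigherEisenstein.eisensteinTerm_eq, norm_mul,
        Complex.norm_cpow_eq_rpow_re_of_pos (UpperHalfPlane.im_pos _)]
  have heq : ∀ s : ℂ, 1 < s.re → ∀ (γ : Γ) (z : ℍ),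
      HigherEisenstein.eisensteinVector Γ χ f g z₀ a σ m n (γ • z) s =
        HigherEisenstein.piMatrix Γ χ f g z₀ m n r γ *ᵥ
          HigherEisenstein.eisensteinVector Γ χ f g z₀ a σ m n z s := fun s h γ z =>
    HigherEisenstein.eisensteinVector_smul (fun i k l => hinv i k l s z)
      (fun i k l => (hsum i k l s h z).of_norm) γ
  have hlap : ∀ s : ℂ, 1 < s.re → ∀ (z : ℍ) (I : HigherEisenstein.EisIndex m n r),
      HigherEisenstein.hyperbolicLaplacian
          (fun w => HigherEisenstein.eisensteinVector Γ χ f g z₀ a σ m n w s I) z =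
        s * (1 - s) * HigherEisenstein.eisensteinVector Γ χ f g z₀ a σ m n z s I :=
    fun s h z I => HigherEisenstein.hyperbolicLaplacian_of_eq_poincareSeries (hdet I.cusp)
      (hs I.cusp _ _ s h) (by linarith)
      (HigherEisenstein.eisensteinSeries_eq_poincareSeries (σ I.cusp) _ _ s) z
  refine ⟨fun i k l s h z => ⟨hinv i k l s z, hsum i k l s h z⟩,
    HigherEisenstein.piHom χ f g z₀ m n r, fun γ => rfl,
    HigherEisenstein.smul_piMatrix_mem_uni χ f g z₀,
    HigherEisenstein.blockTriangular_piMatrix χ f g z₀, heq, hlap, fun s h =>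
    ⟨fun I => ?_, heq s h, HigherEisenstein.exists_section_of_equivariant _ (heq s h), hlap s h⟩⟩
  exact HigherEisenstein.isSmooth_of_eq_poincareSeries (hdet I.cusp) (hs I.cusp _ _ s h)
    (by linarith) (HigherEisenstein.eisensteinSeries_eq_poincareSeries (σ I.cusp) _ _ s)
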